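/- Let $q\ge 5$ be an integer. Consider the zero-temperature $q$-state Potts antiferromagnet on the square lattice $\mathbb Z^2$: for finite $\Lambda\subset\mathbb Z^2$ and a configuration $\omega$ outside $\Lambda$, $\pi^{\rm Potts}_\Lambda(\,\cdot\mid\omega)$ is the uniform distribution on the assignments of values in $\{1,\dots,q\}$ to the sites of $\Lambda$ for which the two ends of every nearest-neighbour bond meeting $\Lambda$ have different values. Sum over the spins on the odd sublattice. The decimated system lives on the even sublattice $\mathcal L=\{x\in\mathbb Z^2: x_1+x_2 \text{ even}\}$; its plaquettes are the sets of the four nearest neighbours of an odd site, and its specification $\pi=\{\pi_\Lambda\}$ gives the spins in a finite $\Lambda\subset\mathcal L$, conditionally on the spins outside $\Lambda$, probability proportional to the product of $q-C(t_1,t_2,t_3,t_4)$ over the plaquettes meeting $\Lambda$, where $t_1,\dots,t_4$ are the spins of the plaquette and $C$ is the number of distinct values among them. A Gibbs measure for a specification is a probability measure on the space of infinite configurations whose conditional distribution, given the spins outside any finite $\Lambda$, is $\pi_\Lambda$. Two sites of $\mathcal L$ are nearest neighbours (nn) if they differ by $(\pm1,\pm1)$, and next-to-nearest neighbours (nnn)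 if they differ by $(\pm2,0)$ or $(0,\pm2)$. For $i\neq j$ let $$c_{ij}=\sup\ \max_{A\subseteq\{1,\dots,q\}}\bigl|\pi_{\{i\}}(t_i\in A\mid t)-\pi_{\{i\}}(t_i\in A\mid\tilde t)\bigr| ,$$ the supremum being over all pairs $t,\tilde t$ of configurations that agree off $j$, and let $\alpha=\sup_i\sum_{j\ne i}c_{ij}$ be the Dobrushin constant of the decimated system. Then: 1. $\sum_{s=1}^q\prod_{k=1}^4(1-\delta_{s,t_k})=q-C(t_1,\dots,t_4)$ for every plaquette configuration, and the restriction to $\mathcal L$ of any Gibbs measure of the zero-temperature Potts antiferromagnet on $\mathbb Z^2$ is a Gibbs measure of the decimated system. 2. $c_{ij}$ has the same value $c_{\rm nn}$ for all nn pairs and the same value $c_{\rm nnn}$ for all nnn pairs, and $\alpha=4c_{\rm nn}+4c_{\rm nnn}$. Moreover $$c_{\rm nn}=\frac{(q-3)^2(2q-7)}{q^5-16q^4+108q^3-391q^2+764q-639}\quad(q\ge6),\qquad c_{\rm nn}=\frac38\quad(q=5),$$ $$c_{\rm nnn}=\frac{(q-3)^3}{q^5-16q^4+108q^3-389q^2+749q-611}\quad(q\ge5).$$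 3. If $q\ge7$, then $\alpha<1$, and the decimated system and the zero-temperature Potts antiferromagnet on $\mathbb Z^2$ each have exactly one Gibbs measure. Each of these two measures $\mu$ has exponentially decaying correlations: there are constants $K$ and $m>0$, depending only on $q$, such that all measurable functions $f,g$ of the spins with finite total oscillation are such that $f$, $g$ and $fg$ are $\mu$-integrable and $$|\mu(fg)-\mu(f)\mu(g)|\le K\sum_{i,j}\delta_i(f)\,e^{-m|i-j|}\,\delta_j(g).$$ Here $\delta_i(f)$ is the supremum of $|f(\sigma)-f(\sigma')|$ over configurations $\sigma,\sigma'$ that agree off $i$, the total oscillation of $f$ is $\sum_i\delta_i(f)$, and $|\cdot|$ is the maximum norm on $\mathbb Z^2$. -/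

import Mathlib

open MeasureTheory
open scoped ENNReal

noncomputable section

/-! ### Specifications on `L → E` with finite spin space `E`, Gibbs measures -/

/-- The configuration equal to `ζ` inside `Λ` and to `ω` outside `Λ`. -/
def glue {L E : Type} [DecidableEq L] (Λ : Finset L) (ζ : Λ → E) (ω : L → E) : L → E :=
  fun i => if h : i ∈ Λ then ζ ⟨i, h⟩ else ω i

/-- The kernel `π_Λ(· | ω)`: the spins outside `Λ` are frozen to those of `ω`, and the spins
inside `Λ` are chosen with probability proportional to `W Λ`, where `W Λ σ` is the product of all
the local Boltzmann factors of the configuration `σ` that involve at least one site of `Λ`. -/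
def gibbsKernel {L E : Type} [DecidableEq L] [Fintype E] [MeasurableSpace E]
    (W : Finset L → (L → E) → ℝ) (Λ : Finset L) (ω : L → E) : Measure (L → E) :=
  ∑ ζ : Λ → E,
    ENNReal.ofReal (W Λ (glue Λ ζ ω) / ∑ ξ : Λ → E, W Λ (glue Λ ξ ω)) •
      Measure.dirac (glue Λ ζ ω)

/-- `μ` is an infinite-volume Gibbs measure for `π = {π_Λ}`: it is a probability measure, and for
every finite `Λ` its conditional distribution given the spins outside `Λ` is `π_Λ`. -/
def IsGibbsMeasure {L E : Type} [MeasurableSpace E]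
    (π : Finset L → (L → E) → Measure (L → E)) (μ : Measure (L → E)) : Prop :=
  IsProbabilityMeasure μ ∧
    ∀ (Λ : Finset L) (A : Set (L → E)), MeasurableSet A →
      μ[A.indicator (fun _ => (1 : ℝ)) | cylinderEvents ((Λ : Set L)ᶜ)]
        =ᵐ[μ] fun ω => (π Λ ω).real A

/-! ### Dobrushin's interdependence matrix and constant -/

/-- `d(μ, ν) = sup_A |μ(A) - ν(A)|`. -/
def varDist {E : Type} [MeasurableSpace E] (μ ν : Measure E) : ℝ≥0∞ :=
  ⨆ (A : Set E) (_ : MeasurableSet A), ENNReal.ofReal |μ.real A - ν.real A|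

/-- The conditional distribution of the single spin at `i`, given the other spins of `ω`. -/
def singleSpin {L E : Type} [MeasurableSpace E]
    (π : Finset L → (L → E) → Measure (L → E)) (i : L) (ω : L → E) : Measure E :=
  (π {i} ω).map (fun σ => σ i)

/-- The entry `c_{ij}` of the interdependence matrix. -/
def dobrushinCoeff {L E : Type} [MeasurableSpace E]
    (π : Finset L → (L → E) → Measure (L → E)) (i j : L) : ℝ≥0∞ :=
  ⨆ (σ : L → E) (σ' : L → E) (_ : ∀ k, k ≠ j → σ k = σ' k),
    varDist (singleSpin π i σ) (singleSpin π i σ')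

/-- The Dobrushin constant `α = sup_i ∑_{j ≠ i} c_{ij}`. -/
def dobrushinConst {L E : Type} [MeasurableSpace E]
    (π : Finset L → (L → E) → Measure (L → E)) : ℝ≥0∞ :=
  ⨆ i : L, ∑' j : {j : L // j ≠ i}, dobrushinCoeff π i j

/-! ### Decay of correlations -/

/-- The oscillation `δ_i(f)` of `f` at the site `i`. -/
def osc {L E : Type} (f : (L → E) → ℝ) (i : L) : ℝ≥0∞ :=
  ⨆ (σ : L → E) (σ' : L → E) (_ : ∀ k, k ≠ i → σ k = σ' k), ENNReal.ofReal |f σ - f σ'|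

/-- `f` has finite total oscillation `∑_i δ_i(f) < ∞`. -/
def FiniteTotalOsc {L E : Type} (f : (L → E) → ℝ) : Prop :=
  ∑' i : L, osc f i < ∞

/-- Exponential decay of correlations: there are `K` and `m > 0` with
`|μ(fg) - μ(f)μ(g)| ≤ K ∑_{i,j} δ_i(f) e^{-m|i-j|} δ_j(g)`
for all measurable `f`, `g` of finite total oscillation (and these are integrable, as is `fg`). -/
def HasExponentialDecay {L E : Type} [Dist L] [MeasurableSpace E] (μ : Measure (L → E)) : Prop :=
  ∃ K m : ℝ, 0 < m ∧
    ∀ f g : (L → E) → ℝ, Measurable f → Measurable g → FiniteTotalOsc f → FiniteTotalOsc g →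
      Integrable f μ ∧ Integrable g μ ∧ Integrable (fun σ => f σ * g σ) μ ∧
      ENNReal.ofReal |(∫ σ, f σ * g σ ∂μ) - (∫ σ, f σ ∂μ) * (∫ σ, g σ ∂μ)| ≤
        ENNReal.ofReal K *
          ∑' (i : L) (j : L), osc f i * ENNReal.ofReal (Real.exp (-m * dist i j)) * osc g j

/-! ### The zero-temperature Potts antiferromagnet on the square lattice -/

/-- The four nearest neighbours of a site of the square lattice `ℤ²`. -/
def nbrs (x : ℤ × ℤ) : Finset (ℤ × ℤ) :=
  {(x.1 + 1, x.2), (x.1 - 1, x.2), (x.1, x.2 + 1), (x.1, x.2 - 1)}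

/-- The zero-temperature Boltzmann weight `∏ (1 - δ_{σ_x σ_y})`, the product being over the
nearest-neighbour bonds `{x, y}` that meet `Λ`. -/
def pottsWeight (q : ℕ) (Λ : Finset (ℤ × ℤ)) (σ : ℤ × ℤ → Fin q) : ℝ :=
  if ∀ x ∈ Λ, ∀ y ∈ nbrs x, σ x ≠ σ y then 1 else 0

/-- The specification of the `q`-state zero-temperature Potts antiferromagnet on `ℤ²`. -/
def pottsSpec (q : ℕ) :
    Finset (ℤ × ℤ) → (ℤ × ℤ → Fin q) → Measure (ℤ × ℤ → Fin q) :=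
  gibbsKernel (pottsWeight q)

/-! ### The decimated system -/

/-- The sites that survive decimation: the even sublattice of `ℤ²`.  The spins on the odd
sublattice are summed over. -/
abbrev EvenSite : Type := {x : ℤ × ℤ // Even (x.1 + x.2)}

/-- The plaquette of the decimated lattice centred at the (odd) site `x`: the set of the four
neighbours of `x`. -/
def plaquette (x : ℤ × ℤ) : Finset EvenSite :=
  (nbrs x).subtype (fun y => Even (y.1 + y.2))

/-- The number `C(t_1, …, t_4)` of distinct spin values on the plaquette centred at `x`. -/
def numColors {q : ℕ} (x : ℤ × ℤ) (t : EvenSite → Fin q) : ℕ :=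
  ((plaquette x).image t).card

/-- The centres of the plaquettes that meet `Λ`. -/
def centers (Λ : Finset EvenSite) : Finset (ℤ × ℤ) :=
  Λ.biUnion (fun y => nbrs y.1)

/-- The product of the plaquette weights `q - C` over the plaquettes that meet `Λ`. -/
def decimatedWeight (q : ℕ) (Λ : Finset EvenSite) (t : EvenSite → Fin q) : ℝ :=
  ∏ x ∈ centers Λ, ((q : ℝ) - (numColors x t : ℝ))

/-- The specification of the decimated system. -/
def decimatedSpec (q : ℕ) :
    Finset EvenSite → (EvenSite → Fin q) → Measure (EvenSite → Fin q) :=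
  gibbsKernel (decimatedWeight q)

/-- Restriction of a configuration on `ℤ²` to the even sublattice. -/
def restrictEven {q : ℕ} (σ : ℤ × ℤ → Fin q) : EvenSite → Fin q := fun x => σ x.1

/-- Nearest neighbours in the decimated lattice (a square lattice rotated by 45 degrees):
the sites that share two plaquettes. -/
def IsNN (x y : EvenSite) : Prop :=
  |x.1.1 - y.1.1| = 1 ∧ |x.1.2 - y.1.2| = 1

/-- Next-to-nearest neighbours in the decimated lattice: the sites that are diagonally opposite
in a plaquette, and so share exactly one. -/
def IsNNN (x y : EvenSite) : Prop :=
  (|x.1.1 - y.1.1| = 2 ∧ x.1.2 = y.1.2) ∨ (x.1.1 = y.1.1 ∧ |x.1.2 - y.1.2| = 2)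

end

/-! Odd sites are pairwise non-adjacent, so given the even spins the odd ones are independent. An
odd site may take exactly the colours missing from its plaquette, which gives the factor `q - C`.
Hence the Potts average over a set of even sites together with all their odd neighbours, applied to
a function of the even spins, is the decimated average (`gibbsAvg_potts_restrictEven`). Gibbs
measures are handled throughout as measures invariant under the averages `gibbsAvg`.

Coefficients. Let `B` be the set of the other colours of a plaquette. As a function of the central
spin, the plaquette weight is proportional to `1 + 1/(q-1-|B|)` on `B` and to `1` off `B`, so the
single-spin law is a normalized product `plaqProd` of four such factors. Suppose one neighbour
changes from `α` to `β`. If neither colour occurs elsewhere in the plaquettes concerned, a factor `1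
+ Δ` moves from `α` to `β`, and `tvLe_exchange` bounds the effect by `Δ/(m+2+Δ)`, where `m` measures
the weight of the remaining colours. If a plaquette contains `α` or `β` anyway, its colour set gains
or loses at most one colour, which has the small effect `stepBound` (`tvLe_change_colour`). The
delicate case, in which both colours are new in one plaquette and exactly one of them is new in the
other, is `tvLe_fresh_mixed`. The extremal bounds come from plaquettes with three distinct other
colours and are attained by explicit configurations (`Patch.dobrushinCoeff_nearest`,
`Patch.dobrushinCoeff_diagonal`). For nearest neighbours the extremal configuration needs six
colours, whence the separate value at `q = 5`. The condition `α < 1` for `q ≥ 7` is then a rational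
inequality.

Uniqueness and decay. A functional `ℓ` is bounded by `∑ a i * osc f i`. Averaging `f` at `i` removes
the oscillation at `i` and passes the fraction `c i j` of it to `j`, so `a i` may be replaced by `∑
c i j * a j + s i`, where `s i` is the error made in `ℓ`. Iteration drives `a` down to any bounded
supersolution (`BlockSystem.estimate`). With `ℓ f = |μ f - ν f|` and `s = 0` the zero vector is a
supersolution, which gives uniqueness. With a covariance for `ℓ`, the oscillations of `g` are the
source, and exponentially weighted sums of them form a supersolution, which gives decay.

The same argument serves the Potts model, by way of `BlockSystem`: an even site is averaged together
with its four odd neighbours, which acts on functions not depending on those neighbours with the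
decimated coefficients, and an odd site is averaged alone, at the cost of at most one unit of
oscillation at each of its four neighbours. Functions of finite total oscillation may be unbounded,
but uniqueness makes tail events trivial, so they are almost surely within their total oscillation
of a constant and can be truncated. -/

noncomputable section

set_option linter.unusedSectionVars false

/-! ### Sums over finite modifications -/

section SumOver

variable {L E : Type} [DecidableEq L]

lemma glue_of_mem {Λ : Finset L} {i : L} (h : i ∈ Λ) (ζ : Λ → E) (ω : L → E) :
    glue Λ ζ ω i = ζ ⟨i, h⟩ := by simp [glue, h]

lemma glue_of_notMem {Λ : Finset L} {i : L} (h : i ∉ Λ) (ζ : Λ → E) (ω : L → E) :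
    glue Λ ζ ω i = ω i := by simp [glue, h]

lemma glue_congr {Λ : Finset L} (ζ : Λ → E) {ω ω' : L → E} (h : ∀ i, i ∉ Λ → ω i = ω' i) :
    glue Λ ζ ω = glue Λ ζ ω' := by
  funext i
  by_cases hi : i ∈ Λ
  · simp [glue, hi]
  · simp [glue, hi, h i hi]

lemma glue_self (Λ : Finset L) (ω : L → E) : glue Λ (fun i => ω i) ω = ω := by
  funext i
  by_cases h : i ∈ Λ <;> simp [glue, h]

lemma exists_glue_eq {Λ : Finset L} {ω ω' : L → E} (h : ∀ i, i ∉ Λ → ω i = ω' i) :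
    ∃ ζ : Λ → E, glue Λ ζ ω = ω' :=
  ⟨fun i => ω' i, by rw [glue_congr _ h, glue_self]⟩

variable [Fintype E]

/-- The sum of `F` over all configurations that agree with `ω` off `Λ`. -/
def sumOver (Λ : Finset L) (F : (L → E) → ℝ) (ω : L → E) : ℝ :=
  ∑ ζ : Λ → E, F (glue Λ ζ ω)

lemma sumOver_congr_out {Λ : Finset L} {F : (L → E) → ℝ} {ω ω' : L → E}
    (h : ∀ i, i ∉ Λ → ω i = ω' i) : sumOver Λ F ω = sumOver Λ F ω' := by
  unfold sumOver
  exact Finset.sum_congr rfl fun ζ _ => by rw [glue_congr ζ h]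

lemma sumOver_singleton (i : L) (F : (L → E) → ℝ) (ω : L → E) :
    sumOver {i} F ω = ∑ s : E, F (Function.update ω i s) := by
  unfold sumOver
  refine Fintype.sum_equiv (Equiv.funUnique ({i} : Finset L) E) _ _ fun ζ => ?_
  congr 1
  funext k
  by_cases hk : k = i
  · subst hk
    rw [glue_of_mem (Finset.mem_singleton_self k)]
    simp only [Function.update_self, Equiv.funUnique_apply]
    congr 1
  · rw [glue_of_notMem (by simpa using hk), Function.update_of_ne hk]

lemma sumOver_union {A B : Finset L} (hAB : Disjoint A B) (F : (L → E) → ℝ) (ω : L → E) :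
    sumOver (A ∪ B) F ω = sumOver A (sumOver B F) ω := by
  unfold sumOver
  rw [← Fintype.sum_prod_type']
  refine Fintype.sum_bijective
    (fun ζ : (A ∪ B : Finset L) → E => ((fun i : A => ζ ⟨i, Finset.mem_union_left _ i.2⟩,
      fun i : B => ζ ⟨i, Finset.mem_union_right _ i.2⟩) : (A → E) × (B → E))) ⟨?_, ?_⟩ _ _ ?_
  · intro ζ ζ' h
    funext i
    rcases Finset.mem_union.1 i.2 with hi | hi
    · exact congrFun (congrArg Prod.fst h) ⟨i, hi⟩
    · exact congrFun (congrArg Prod.snd h) ⟨i, hi⟩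
  · rintro ⟨ξ, η⟩
    refine ⟨fun i => if h : (i : L) ∈ A then ξ ⟨i, h⟩ else
      η ⟨i, (Finset.mem_union.1 i.2).resolve_left h⟩, ?_⟩
    ext i
    · simp
    · have : (i : L) ∉ A := fun h => Finset.disjoint_left.1 hAB h i.2
      simp [this]
  · intro ζ
    congr 1
    funext i
    by_cases hB : i ∈ B
    · simp [glue, hB]
    · by_cases hA : i ∈ A <;> simp [glue, hA, hB]

lemma sumOver_mul_right {Λ : Finset L} {F R : (L → E) → ℝ}
    (hR : ∀ (ζ : Λ → E) σ, R (glue Λ ζ σ) = R σ) (ω : L → E) :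
    sumOver Λ (fun σ => F σ * R σ) ω = sumOver Λ F ω * R ω := by
  simp only [sumOver, hR, Finset.sum_mul]

/-- The average of `f` with respect to the kernel defined by the weight `W`. -/
def gibbsAvg (W : Finset L → (L → E) → ℝ) (Λ : Finset L) (f : (L → E) → ℝ) (ω : L → E) : ℝ :=
  sumOver Λ (fun σ => W Λ σ * f σ) ω / sumOver Λ (W Λ) ω

/-- The properties of the local weights used in the theory of Gibbs measures: they are
nonnegative, finite range, not identically zero whatever the boundary condition, and consistent. -/
structure GoodWeight (W : Finset L → (L → E) → ℝ) : Prop where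
  nonneg : ∀ Λ σ, 0 ≤ W Λ σ
  pos : ∀ Λ ω, 0 < sumOver Λ (W Λ) ω
  local_dep : ∀ Λ, ∃ S : Finset L, DependsOn (W Λ) (S : Set L)
  factor : ∀ Λ Δ, Λ ⊆ Δ → ∃ R : (L → E) → ℝ, (∀ σ, W Δ σ = W Λ σ * R σ) ∧
    ∀ (ζ : Λ → E) σ, R (glue Λ ζ σ) = R σ

variable {W : Finset L → (L → E) → ℝ}

lemma gibbsAvg_congr_out (Λ : Finset L) (f : (L → E) → ℝ) {ω ω' : L → E}
    (h : ∀ i, i ∉ Λ → ω i = ω' i) : gibbsAvg W Λ f ω = gibbsAvg W Λ f ω' := by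
  unfold gibbsAvg
  rw [sumOver_congr_out h, sumOver_congr_out h]

lemma gibbsAvg_glue (Λ : Finset L) (f : (L → E) → ℝ) (ξ : Λ → E) (ω : L → E) :
    gibbsAvg W Λ f (glue Λ ξ ω) = gibbsAvg W Λ f ω :=
  gibbsAvg_congr_out Λ f fun _ hi => glue_of_notMem hi _ _

lemma gibbsAvg_eq_sum (Λ : Finset L) (f : (L → E) → ℝ) (ω : L → E) :
    gibbsAvg W Λ f ω =
      ∑ ζ : Λ → E, (W Λ (glue Λ ζ ω) / sumOver Λ (W Λ) ω) * f (glue Λ ζ ω) := by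
  simp only [gibbsAvg, sumOver, Finset.sum_div]
  exact Finset.sum_congr rfl fun ζ _ => by ring

/-- Properness of the kernels: what is determined by the spins outside `Λ` acts as a constant under
the average. -/
lemma gibbsAvg_mul_of_invariant {Λ : Finset L} {f h : (L → E) → ℝ}
    (hh : ∀ (ζ : Λ → E) σ, h (glue Λ ζ σ) = h σ) (ω : L → E) :
    gibbsAvg W Λ (fun σ => h σ * f σ) ω = h ω * gibbsAvg W Λ f ω := by
  simp only [gibbsAvg_eq_sum, hh, Finset.mul_sum]
  exact Finset.sum_congr rfl fun ζ _ => by ring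

namespace GoodWeight

variable (hW : GoodWeight W)
include hW

lemma sum_prob (Λ : Finset L) (ω : L → E) :
    ∑ ζ : Λ → E, W Λ (glue Λ ζ ω) / sumOver Λ (W Λ) ω = 1 := by
  rw [← Finset.sum_div]
  exact div_self (hW.pos Λ ω).ne'

lemma prob_nonneg (Λ : Finset L) (ζ : Λ → E) (ω : L → E) :
    0 ≤ W Λ (glue Λ ζ ω) / sumOver Λ (W Λ) ω :=
  div_nonneg (hW.nonneg _ _) (hW.pos Λ ω).le

lemma gibbsAvg_const (Λ : Finset L) (a : ℝ) (ω : L → E) :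
    gibbsAvg W Λ (fun _ => a) ω = a := by
  rw [gibbsAvg_eq_sum, ← Finset.sum_mul, hW.sum_prob, one_mul]

lemma abs_gibbsAvg_sub_le {Λ : Finset L} {f : (L → E) → ℝ} {ω : L → E} {a C : ℝ}
    (h : ∀ ζ : Λ → E, |f (glue Λ ζ ω) - a| ≤ C) : |gibbsAvg W Λ f ω - a| ≤ C := by
  have h1 : gibbsAvg W Λ f ω - a =
      ∑ ζ : Λ → E, (W Λ (glue Λ ζ ω) / sumOver Λ (W Λ) ω) * (f (glue Λ ζ ω) - a) := by
    simp only [mul_sub, Finset.sum_sub_distrib, ← Finset.sum_mul, hW.sum_prob, one_mul,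
      ← gibbsAvg_eq_sum]
  rw [h1]
  calc _ ≤ ∑ ζ : Λ → E, |(W Λ (glue Λ ζ ω) / sumOver Λ (W Λ) ω) * (f (glue Λ ζ ω) - a)| :=
        Finset.abs_sum_le_sum_abs _ _
    _ ≤ ∑ ζ : Λ → E, (W Λ (glue Λ ζ ω) / sumOver Λ (W Λ) ω) * C := by
        refine Finset.sum_le_sum fun ζ _ => ?_
        rw [abs_mul, abs_of_nonneg (hW.prob_nonneg Λ ζ ω)]
        exact mul_le_mul_of_nonneg_left (h ζ) (hW.prob_nonneg Λ ζ ω)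
    _ = C := by rw [← Finset.sum_mul, hW.sum_prob, one_mul]

lemma abs_gibbsAvg_le {Λ : Finset L} {f : (L → E) → ℝ} {C : ℝ} (h : ∀ σ, |f σ| ≤ C) (ω : L → E) :
    |gibbsAvg W Λ f ω| ≤ C := by
  simpa using hW.abs_gibbsAvg_sub_le (a := 0) (fun ζ => by simpa using h (glue Λ ζ ω))

/-- Consistency of the finite-volume kernels. -/
lemma gibbsAvg_gibbsAvg {Λ Δ : Finset L} (h : Λ ⊆ Δ) (f : (L → E) → ℝ) (ω : L → E) :
    gibbsAvg W Δ (gibbsAvg W Λ f) ω = gibbsAvg W Δ f ω := by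
  obtain ⟨R, hR, hR'⟩ := hW.factor Λ Δ h
  have key : ∀ τ, sumOver Λ (fun σ => W Δ σ * gibbsAvg W Λ f σ) τ =
      sumOver Λ (fun σ => W Δ σ * f σ) τ := by
    intro τ
    have h1 : sumOver Λ (fun σ => W Δ σ * f σ) τ = sumOver Λ (fun σ => W Λ σ * f σ) τ * R τ := by
      rw [← sumOver_mul_right hR']
      congr 1
      funext σ
      rw [hR]; ring
    have h2 : sumOver Λ (fun σ => W Δ σ * gibbsAvg W Λ f σ) τ =
        sumOver Λ (W Λ) τ * (gibbsAvg W Λ f τ * R τ) := by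
      rw [← sumOver_mul_right (R := fun σ => gibbsAvg W Λ f σ * R σ)]
      · congr 1
        funext σ
        rw [hR]; ring
      · intro ζ σ
        simp only [hR', gibbsAvg_glue]
    rw [h1, h2, gibbsAvg]
    field_simp [(hW.pos Λ τ).ne']
  -- The sum over `Δ` is carried out over `Λ` first; `key` compares the inner sums.
  have hU : Δ = (Δ \ Λ) ∪ Λ := (Finset.sdiff_union_of_subset h).symm
  have hD : Disjoint (Δ \ Λ) Λ := Finset.sdiff_disjoint
  have h3 : ∀ F, sumOver Δ F ω = sumOver (Δ \ Λ) (sumOver Λ F) ω := fun F => by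
    rw [← sumOver_union hD, ← hU]
  unfold gibbsAvg at key ⊢
  congr 1
  rw [h3, h3, funext key]

end GoodWeight

end SumOver

/-! ### Gibbs measures as invariant measures -/

section Gibbs

variable {L E : Type} [DecidableEq L] [Countable L] [Fintype E] [MeasurableSpace E]
  [MeasurableSingletonClass E]

lemma measurable_of_dependsOn {f : (L → E) → ℝ} {S : Finset L} (hf : DependsOn f (S : Set L)) :
    Measurable f := by
  obtain ⟨g, rfl⟩ := dependsOn_iff_exists_comp.1 hf
  have hg : Measurable g := measurable_of_finite g
  exact hg.comp (measurable_pi_lambda _ fun i => measurable_pi_apply _)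

variable {W : Finset L → (L → E) → ℝ}

lemma measurable_glue (Λ : Finset L) (ζ : Λ → E) :
    Measurable[cylinderEvents ((Λ : Set L)ᶜ)] (glue Λ ζ : (L → E) → (L → E)) := by
  refine @measurable_pi_lambda _ _ _ (cylinderEvents ((Λ : Set L)ᶜ)) _ _ fun i => ?_
  by_cases h : i ∈ Λ
  · simp only [glue, h, dite_true]
    exact @measurable_const _ _ _ (cylinderEvents ((Λ : Set L)ᶜ)) _
  · simp only [glue, h, dite_false]
    exact measurable_cylinderEvent_apply (by simpa using h)

/-- Such an event is a preimage under restriction to the complement of `Λ`, and the restriction does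
not see `ζ`. -/
lemma glue_mem_iff_of_cylinderEvents {Λ : Finset L} {B : Set (L → E)}
    (hB : MeasurableSet[cylinderEvents ((Λ : Set L)ᶜ)] B) (ζ : Λ → E) (ω : L → E) :
    glue Λ ζ ω ∈ B ↔ ω ∈ B := by
  have hle : cylinderEvents (X := fun _ : L => E) ((Λ : Set L)ᶜ) ≤
      MeasurableSpace.comap (fun ω : L → E => fun i : ((Λ : Set L)ᶜ : Set L) => ω i)
        MeasurableSpace.pi := by
    refine iSup₂_le fun i hi => ?_
    rintro s ⟨t, ht, rfl⟩
    exact ⟨(fun f => f ⟨i, hi⟩) ⁻¹' t, measurable_pi_apply _ ht, rfl⟩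
  obtain ⟨t, -, rfl⟩ := hle _ hB
  simp only [Set.mem_preimage]
  have : (fun i : ((Λ : Set L)ᶜ : Set L) => glue Λ ζ ω i) =
      fun i : ((Λ : Set L)ᶜ : Set L) => ω i := by
    funext i
    exact glue_of_notMem (fun h => i.2 (Finset.mem_coe.2 h)) _ _
  rw [this]

namespace GoodWeight

variable (hW : GoodWeight W)
include hW

lemma measurable_weight (Λ : Finset L) : Measurable (W Λ) :=
  let ⟨_, hS⟩ := hW.local_dep Λ
  measurable_of_dependsOn hS

lemma measurable_gibbsAvg_cylinder {f : (L → E) → ℝ} (hf : Measurable f) (Λ : Finset L) :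
    Measurable[cylinderEvents ((Λ : Set L)ᶜ)] (gibbsAvg W Λ f) := by
  have h : ∀ F : (L → E) → ℝ, Measurable F →
      Measurable[cylinderEvents ((Λ : Set L)ᶜ)] (sumOver Λ F) := fun F hF =>
    Finset.measurable_sum (m := cylinderEvents ((Λ : Set L)ᶜ)) _ fun ζ _ =>
      hF.comp (measurable_glue Λ ζ)
  exact (h _ ((hW.measurable_weight Λ).mul hf)).div (h _ (hW.measurable_weight Λ))

lemma measurable_gibbsAvg {f : (L → E) → ℝ} (hf : Measurable f) (Λ : Finset L) :
    Measurable (gibbsAvg W Λ f) :=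
  (hW.measurable_gibbsAvg_cylinder hf Λ).mono cylinderEvents_le_pi le_rfl

lemma gibbsKernel_apply (Λ : Finset L) (ω : L → E) {A : Set (L → E)} (hA : MeasurableSet A) :
    gibbsKernel W Λ ω A = ENNReal.ofReal (gibbsAvg W Λ (A.indicator fun _ => 1) ω) := by
  rw [gibbsAvg_eq_sum, ENNReal.ofReal_sum_of_nonneg]
  · simp only [gibbsKernel, Measure.coe_finsetSum, Finset.sum_apply, Measure.smul_apply,
      smul_eq_mul, Measure.dirac_apply' _ hA]
    refine Finset.sum_congr rfl fun ζ _ => ?_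
    by_cases h : glue Λ ζ ω ∈ A <;> simp [h, sumOver]
  · intro ζ _
    exact mul_nonneg (hW.prob_nonneg _ _ _) (Set.indicator_nonneg (fun _ _ => zero_le_one) _)

lemma isProbabilityMeasure_gibbsKernel (Λ : Finset L) (ω : L → E) :
    IsProbabilityMeasure (gibbsKernel W Λ ω) :=
  ⟨by rw [hW.gibbsKernel_apply Λ ω MeasurableSet.univ, Set.indicator_univ, hW.gibbsAvg_const]
      simp⟩

lemma gibbsAvg_indicator_nonneg (Λ : Finset L) (ω : L → E) (A : Set (L → E)) :
    0 ≤ gibbsAvg W Λ (A.indicator fun _ => 1) ω := by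
  rw [gibbsAvg_eq_sum]
  exact Finset.sum_nonneg fun ζ _ =>
    mul_nonneg (hW.prob_nonneg _ _ _) (Set.indicator_nonneg (fun _ _ => zero_le_one) _)

lemma gibbsKernel_real (Λ : Finset L) (ω : L → E) {A : Set (L → E)} (hA : MeasurableSet A) :
    (gibbsKernel W Λ ω).real A = gibbsAvg W Λ (A.indicator fun _ => 1) ω := by
  rw [measureReal_def, hW.gibbsKernel_apply Λ ω hA,
    ENNReal.toReal_ofReal (hW.gibbsAvg_indicator_nonneg Λ ω A)]

lemma measurable_gibbsKernel (Λ : Finset L) : Measurable (gibbsKernel W Λ) := by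
  refine Measure.measurable_of_measurable_coe _ fun A hA => ?_
  simp only [hW.gibbsKernel_apply Λ _ hA]
  exact (hW.measurable_gibbsAvg (measurable_const.indicator hA) Λ).ennreal_ofReal

lemma integral_gibbsKernel (Λ : Finset L) (ω : L → E) (f : (L → E) → ℝ) :
    ∫ σ, f σ ∂(gibbsKernel W Λ ω) = gibbsAvg W Λ f ω := by
  unfold gibbsKernel
  rw [integral_finsetSum_measure, gibbsAvg_eq_sum]
  · refine Finset.sum_congr rfl fun ζ _ => ?_
    rw [integral_smul_measure, integral_dirac,
      ENNReal.toReal_ofReal (by exact hW.prob_nonneg Λ ζ ω), smul_eq_mul]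
    rfl
  · intro ζ _
    exact (integrable_dirac (by simp)).smul_measure ENNReal.ofReal_ne_top

end GoodWeight

/-- The measure `μ` is invariant under all the kernels defined by the weight `W`. -/
def Invariant (W : Finset L → (L → E) → ℝ) (μ : Measure (L → E)) : Prop :=
  ∀ (Λ : Finset L) (f : (L → E) → ℝ), Measurable f → (∃ C, ∀ σ, |f σ| ≤ C) →
    ∫ σ, gibbsAvg W Λ f σ ∂μ = ∫ σ, f σ ∂μ

lemma integrable_of_bounded {Ω : Type} [MeasurableSpace Ω] {μ : Measure Ω} [IsFiniteMeasure μ]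
    {f : Ω → ℝ} (hf : Measurable f) (hb : ∃ C, ∀ σ, |f σ| ≤ C) : Integrable f μ :=
  let ⟨C, hC⟩ := hb
  Integrable.of_bound hf.aestronglyMeasurable C (Filter.Eventually.of_forall hC)

variable {μ : Measure (L → E)}

lemma GoodWeight.invariant_of_bind_eq (hW : GoodWeight W) [IsProbabilityMeasure μ]
    (h : ∀ Λ, μ.bind (gibbsKernel W Λ) = μ) : Invariant W μ := by
  intro Λ f hf hb
  let η : ProbabilityTheory.Kernel (L → E) (L → E) := ⟨gibbsKernel W Λ, hW.measurable_gibbsKernel Λ⟩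
  have h1 : ((ProbabilityTheory.Kernel.comp η (ProbabilityTheory.Kernel.const Unit μ)) ()) = μ := by
    rw [ProbabilityTheory.Kernel.comp_apply]
    exact h Λ
  have h2 := ProbabilityTheory.Kernel.integral_comp (η := η)
    (κ := ProbabilityTheory.Kernel.const Unit μ) (a := ()) (f := f)
    (by rw [h1]; exact integrable_of_bounded hf hb)
  rw [h1] at h2
  rw [h2]
  exact integral_congr_ae (Filter.Eventually.of_forall fun ω =>
    (hW.integral_gibbsKernel Λ ω f).symm)

lemma GoodWeight.bind_eq_of_isGibbsMeasure (hW : GoodWeight W)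
    (hμ : IsGibbsMeasure (gibbsKernel W) μ) (Λ : Finset L) : μ.bind (gibbsKernel W Λ) = μ := by
  obtain ⟨hp, hμ⟩ := hμ
  ext A hA
  have hi : Integrable (A.indicator fun _ => (1 : ℝ)) μ :=
    (integrable_const 1).indicator hA
  have h1 : ∫ ω, gibbsAvg W Λ (A.indicator fun _ => 1) ω ∂μ = μ.real A := by
    have h2 := integral_condExp (μ := μ) (f := A.indicator fun _ => (1 : ℝ))
      (cylinderEvents_le_pi (X := fun _ : L => E) (Δ := (Λ : Set L)ᶜ))
    rw [integral_indicator_const _ hA, smul_eq_mul, mul_one] at h2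
    rw [← h2]
    refine integral_congr_ae ((hμ Λ A hA).symm.mono fun ω hω => ?_)
    rw [← hW.gibbsKernel_real Λ ω hA]
    exact hω
  rw [Measure.bind_apply hA (hW.measurable_gibbsKernel Λ).aemeasurable]
  simp only [hW.gibbsKernel_apply Λ _ hA]
  rw [← ofReal_integral_eq_lintegral_ofReal, h1, measureReal_def,
    ENNReal.ofReal_toReal (measure_ne_top _ _)]
  · refine integrable_of_bounded (hW.measurable_gibbsAvg (measurable_const.indicator hA) Λ)
      ⟨1, fun ω => hW.abs_gibbsAvg_le (fun σ => ?_) ω⟩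
    by_cases h : σ ∈ A <;> simp [h]
  · exact Filter.Eventually.of_forall fun ω => hW.gibbsAvg_indicator_nonneg Λ ω A

lemma GoodWeight.invariant_of_isGibbsMeasure (hW : GoodWeight W)
    (hμ : IsGibbsMeasure (gibbsKernel W) μ) : Invariant W μ :=
  have := hμ.1
  hW.invariant_of_bind_eq (hW.bind_eq_of_isGibbsMeasure hμ)

/-- For an event `B` outside `Λ`, the indicator of `B` can be pulled into the average; invariance
applied to the indicator of `B ∩ A` is then the defining property of the conditional expectation. -/
lemma GoodWeight.isGibbsMeasure_of_invariant (hW : GoodWeight W) [hp : IsProbabilityMeasure μ]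
    (hμ : Invariant W μ) : IsGibbsMeasure (gibbsKernel W) μ := by
  refine ⟨hp, fun Λ A hA => ?_⟩
  have hb : ∀ (A : Set (L → E)), ∃ C, ∀ σ, |A.indicator (fun _ => (1 : ℝ)) σ| ≤ C := fun A =>
    ⟨1, fun σ => by by_cases h : σ ∈ A <;> simp [h]⟩
  have hm := hW.measurable_gibbsAvg_cylinder (measurable_const.indicator hA : Measurable
    (A.indicator fun _ => (1 : ℝ))) Λ
  simp only [hW.gibbsKernel_real Λ _ hA]
  have hint : Integrable (gibbsAvg W Λ (A.indicator fun _ => 1)) μ := by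
    refine integrable_of_bounded (hm.mono cylinderEvents_le_pi le_rfl) ?_
    obtain ⟨C, hC⟩ := hb A
    exact ⟨C, fun ω => hW.abs_gibbsAvg_le hC ω⟩
  refine (ae_eq_condExp_of_forall_setIntegral_eq cylinderEvents_le_pi
    ((integrable_const 1).indicator hA) (fun s _ _ => hint.integrableOn) (fun B hB _ => ?_)
    hm.stronglyMeasurable.aestronglyMeasurable).symm
  have hB' : MeasurableSet B := cylinderEvents_le_pi _ hB
  rw [← integral_indicator hB', ← integral_indicator hB']
  have h1 : B.indicator (A.indicator fun _ => (1 : ℝ)) = (B ∩ A).indicator fun _ => 1 := by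
    rw [Set.indicator_indicator]
  have h2 : B.indicator (gibbsAvg W Λ (A.indicator fun _ => 1)) =
      gibbsAvg W Λ ((B ∩ A).indicator fun _ => 1) := by
    funext ω
    have hfun : (B ∩ A).indicator (fun _ => (1 : ℝ)) =
        fun σ => B.indicator (fun _ => (1 : ℝ)) σ * A.indicator (fun _ => (1 : ℝ)) σ := by
      funext σ
      by_cases hσ : σ ∈ B <;> by_cases hσ' : σ ∈ A <;> simp [hσ, hσ']
    rw [hfun, gibbsAvg_mul_of_invariant]
    · by_cases hω : ω ∈ B <;> simp [hω]
    · intro ζ σ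
      by_cases hσ : σ ∈ B
      · simp [hσ, (glue_mem_iff_of_cylinderEvents hB ζ σ).2 hσ]
      · simp [hσ, mt (glue_mem_iff_of_cylinderEvents hB ζ σ).1 hσ]
  rw [h1, h2]
  exact hμ Λ _ (measurable_const.indicator (hB'.inter hA)) (hb _)

end Gibbs

/-! ### Local functions, and infinite-volume limits of the kernels -/

section Existence

variable {L E : Type} [DecidableEq L] [Countable L] [Fintype E] [MeasurableSpace E]
  [MeasurableSingletonClass E] {W : Finset L → (L → E) → ℝ}

lemma dependsOn_sumOver {Λ S : Finset L} {F : (L → E) → ℝ} (hF : DependsOn F (S : Set L)) :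
    DependsOn (sumOver Λ F) (S : Set L) := by
  intro ω ω' h
  unfold sumOver
  refine Finset.sum_congr rfl fun ζ _ => hF fun i hi => ?_
  by_cases hΛ : i ∈ Λ
  · simp [glue, hΛ]
  · simp [glue, hΛ, h i hi]

lemma GoodWeight.exists_dependsOn_gibbsAvg (hW : GoodWeight W) (Λ : Finset L) {S : Finset L}
    {f : (L → E) → ℝ} (hf : DependsOn f (S : Set L)) :
    ∃ T : Finset L, DependsOn (gibbsAvg W Λ f) (T : Set L) := by
  obtain ⟨S', hS'⟩ := hW.local_dep Λ
  refine ⟨S' ∪ S, fun ω ω' h => ?_⟩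
  have h1 : DependsOn (W Λ) ((S' ∪ S : Finset L) : Set L) := hS'.mono (by simp)
  have h2 : DependsOn f ((S' ∪ S : Finset L) : Set L) := hf.mono (by simp)
  have h3 : DependsOn (fun σ => W Λ σ * f σ) ((S' ∪ S : Finset L) : Set L) :=
    fun σ σ' hσ => by simp only [h1 hσ, h2 hσ]
  unfold gibbsAvg
  rw [dependsOn_sumOver h1 h, dependsOn_sumOver h3 h]

lemma exists_bound_of_dependsOn {f : (L → E) → ℝ} {S : Finset L} (hf : DependsOn f (S : Set L)) :
    ∃ C, ∀ σ, |f σ| ≤ C := by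
  obtain ⟨g, rfl⟩ := dependsOn_iff_exists_comp.1 hf
  obtain ⟨C, hC⟩ := (Set.finite_range fun x => |g x|).bddAbove
  exact ⟨C, fun σ => hC ⟨_, rfl⟩⟩

/-- A probability measure is determined by the integrals of the local functions. -/
lemma ext_of_integral_dependsOn {μ ν : Measure (L → E)} [IsProbabilityMeasure μ]
    [IsProbabilityMeasure ν]
    (h : ∀ (f : (L → E) → ℝ) (S : Finset L), DependsOn f (S : Set L) →
      ∫ σ, f σ ∂μ = ∫ σ, f σ ∂ν) : μ = ν := by
  refine ext_of_generate_finite _ generateFrom_measurableCylinders.symm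
    isPiSystem_measurableCylinders ?_ (by simp)
  intro A hA
  obtain ⟨S, T, hT, rfl⟩ := (mem_measurableCylinders _).1 hA
  have hA' : MeasurableSet (cylinder (α := fun _ : L => E) S T) := hT.cylinder S
  have h1 := h ((cylinder (α := fun _ : L => E) S T).indicator fun _ => 1) S (by
    intro σ σ' hσ
    have hr : S.restrict σ = S.restrict σ' := funext fun i => hσ i i.2
    have hr' : (σ ∈ cylinder (α := fun _ : L => E) S T) = (σ' ∈ cylinder S T) :=
      congrArg (fun x => x ∈ T) hr
    by_cases hc : σ' ∈ cylinder (α := fun _ : L => E) S T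
    · rw [Set.indicator_of_mem (hr'.mpr hc), Set.indicator_of_mem hc]
    · rw [Set.indicator_of_notMem (fun h => hc (hr'.mp h)), Set.indicator_of_notMem hc])
  rw [integral_indicator_const _ hA', integral_indicator_const _ hA', smul_eq_mul, mul_one,
    smul_eq_mul, mul_one] at h1
  exact (measureReal_eq_measureReal_iff (measure_ne_top _ _) (measure_ne_top _ _)).1 h1

/-- Local functions determine probability measures, so testing on them already identifies `μ.bind
(gibbsKernel W Λ)` with `μ`. -/
lemma GoodWeight.invariant_of_local (hW : GoodWeight W) {μ : Measure (L → E)}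
    [IsProbabilityMeasure μ]
    (h : ∀ (Λ : Finset L) (f : (L → E) → ℝ) (S : Finset L), DependsOn f (S : Set L) →
      ∫ σ, gibbsAvg W Λ f σ ∂μ = ∫ σ, f σ ∂μ) : Invariant W μ := by
  refine hW.invariant_of_bind_eq fun Λ => ?_
  let η : ProbabilityTheory.Kernel (L → E) (L → E) := ⟨gibbsKernel W Λ, hW.measurable_gibbsKernel Λ⟩
  have : ProbabilityTheory.IsMarkovKernel η := ⟨hW.isProbabilityMeasure_gibbsKernel Λ⟩
  have h1 : ((ProbabilityTheory.Kernel.comp η (ProbabilityTheory.Kernel.const Unit μ)) ()) =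
      μ.bind (gibbsKernel W Λ) := by
    rw [ProbabilityTheory.Kernel.comp_apply]
    rfl
  have hp : IsProbabilityMeasure (μ.bind (gibbsKernel W Λ)) := by rw [← h1]; infer_instance
  refine ext_of_integral_dependsOn fun f S hf => ?_
  have h2 := ProbabilityTheory.Kernel.integral_comp (η := η)
    (κ := ProbabilityTheory.Kernel.const Unit μ) (a := ()) (f := f)
    (by rw [h1]; exact integrable_of_bounded (measurable_of_dependsOn hf)
          (exists_bound_of_dependsOn hf))
  rw [h1] at h2
  rw [h2, ← h Λ f S hf]
  exact integral_congr_ae (Filter.Eventually.of_forall fun ω => hW.integral_gibbsKernel Λ ω f)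

lemma continuous_of_dependsOn [TopologicalSpace E] [DiscreteTopology E] {f : (L → E) → ℝ}
    {S : Finset L} (hf : DependsOn f (S : Set L)) : Continuous f := by
  obtain ⟨g, rfl⟩ := dependsOn_iff_exists_comp.1 hf
  have hg : Continuous g := continuous_of_discreteTopology
  exact hg.comp (continuous_pi fun i => continuous_apply _)

/-- Existence of Gibbs measures, by compactness. -/
theorem GoodWeight.exists_invariant [Nonempty E] [TopologicalSpace E] [DiscreteTopology E]
    [BorelSpace E] (hW : GoodWeight W) :
    ∃ μ : Measure (L → E), IsProbabilityMeasure μ ∧ Invariant W μ := by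
  obtain ⟨ω₀⟩ : Nonempty (L → E) := inferInstance
  let Φ : Finset L → ProbabilityMeasure (L → E) := fun Δ =>
    ⟨gibbsKernel W Δ ω₀, hW.isProbabilityMeasure_gibbsKernel Δ ω₀⟩
  -- An ultrafilter finer than `atTop` has a limit in the compact space of probability measures, so
  -- no subsequence has to be extracted.
  let U : Ultrafilter (Finset L) := Ultrafilter.of Filter.atTop
  have hU : (U : Filter (Finset L)) ≤ Filter.atTop := Ultrafilter.of_le _
  obtain ⟨μ, -, hμ⟩ := isCompact_univ.ultrafilter_le_nhds (U.map Φ) (by simp)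
  have hlim : Filter.Tendsto Φ U (nhds μ) := hμ
  rw [ProbabilityMeasure.tendsto_iff_forall_integral_tendsto] at hlim
  have hloc : ∀ (f : (L → E) → ℝ) (S : Finset L), DependsOn f (S : Set L) →
      Filter.Tendsto (fun Δ => gibbsAvg W Δ f ω₀) U (nhds (∫ σ, f σ ∂(μ : Measure (L → E)))) := by
    intro f S hf
    have h1 := hlim (BoundedContinuousFunction.mkOfCompact ⟨f, continuous_of_dependsOn hf⟩)
    have h2 : ∀ Δ, ∫ σ, f σ ∂(Φ Δ : Measure (L → E)) = gibbsAvg W Δ f ω₀ := fun Δ =>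
      hW.integral_gibbsKernel Δ ω₀ f
    simpa [h2] using h1
  refine ⟨μ, μ.2, hW.invariant_of_local fun Λ f S hf => ?_⟩
  obtain ⟨T, hT⟩ := hW.exists_dependsOn_gibbsAvg Λ hf
  -- By consistency the two averages over `Δ` coincide as soon as `Λ ⊆ Δ`.
  refine tendsto_nhds_unique (hloc _ T hT) ((hloc f S hf).congr' ?_)
  filter_upwards [hU (Filter.eventually_ge_atTop Λ)] with Δ hΔ
  exact (hW.gibbsAvg_gibbsAvg hΔ f ω₀).symm

end Existence

/-! ### Oscillations -/

section Osc

variable {L E : Type}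

lemma le_osc (f : (L → E) → ℝ) {i : L} {σ σ' : L → E} (h : ∀ k, k ≠ i → σ k = σ' k) :
    ENNReal.ofReal |f σ - f σ'| ≤ osc f i :=
  le_iSup_of_le σ (le_iSup_of_le σ' (le_iSup_of_le h le_rfl))

lemma osc_le {f : (L → E) → ℝ} {i : L} {C : ℝ≥0∞}
    (h : ∀ σ σ' : L → E, (∀ k, k ≠ i → σ k = σ' k) → ENNReal.ofReal |f σ - f σ'| ≤ C) :
    osc f i ≤ C :=
  iSup_le fun σ => iSup_le fun σ' => iSup_le fun hσ => h σ σ' hσ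

lemma abs_sub_le_osc {f : (L → E) → ℝ} {i : L} (hi : osc f i ≠ ∞) {σ σ' : L → E}
    (h : ∀ k, k ≠ i → σ k = σ' k) : |f σ - f σ'| ≤ (osc f i).toReal :=
  (ENNReal.ofReal_le_iff_le_toReal hi).1 (le_osc f h)

variable [DecidableEq L]

/-- Telescoping: the sites of `Λ` are changed one after another. -/
lemma abs_sub_le_sum_osc (f : (L → E) → ℝ) (Λ : Finset L) : ∀ {σ σ' : L → E},
    (∀ k, k ∉ Λ → σ k = σ' k) → ENNReal.ofReal |f σ - f σ'| ≤ ∑ i ∈ Λ, osc f i := by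
  induction Λ using Finset.induction_on with
  | empty =>
    intro σ σ' h
    have : σ = σ' := funext fun k => h k (by simp)
    simp [this]
  | insert i Λ hi ih =>
    intro σ σ' h
    rw [Finset.sum_insert hi]
    have h1 : ∀ k, k ≠ i → σ k = Function.update σ i (σ' i) k := fun k hk => by
      rw [Function.update_of_ne hk]
    have h2 : ∀ k, k ∉ Λ → Function.update σ i (σ' i) k = σ' k := fun k hk => by
      by_cases hki : k = i
      · subst hki; simp
      · rw [Function.update_of_ne hki]
        exact h k (by simp [hk, hki])
    calc ENNReal.ofReal |f σ - f σ'|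
        ≤ ENNReal.ofReal (|f σ - f (Function.update σ i (σ' i))| +
            |f (Function.update σ i (σ' i)) - f σ'|) :=
          ENNReal.ofReal_le_ofReal (abs_sub_le _ _ _)
      _ ≤ _ := (ENNReal.ofReal_add_le).trans (add_le_add (le_osc f h1) (ih h2))

lemma eq_of_osc_eq_zero_on {f : (L → E) → ℝ} {Λ : Finset L} (h0 : ∀ k ∈ Λ, osc f k = 0)
    {σ σ' : L → E} (h : ∀ k, k ∉ Λ → σ k = σ' k) : f σ = f σ' := by
  have h1 := abs_sub_le_sum_osc f Λ h
  rw [Finset.sum_eq_zero h0, nonpos_iff_eq_zero, ENNReal.ofReal_eq_zero] at h1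
  exact sub_eq_zero.1 (abs_eq_zero.1 (le_antisymm h1 (abs_nonneg _)))

lemma GoodWeight.abs_sub_gibbsAvg_le [Fintype E] {W : Finset L → (L → E) → ℝ} (hW : GoodWeight W)
    {f : (L → E) → ℝ} (hf : ∀ i, osc f i ≠ ∞) (Λ : Finset L) (σ : L → E) :
    |f σ - gibbsAvg W Λ f σ| ≤ (∑ i ∈ Λ, osc f i).toReal := by
  rw [abs_sub_comm]
  refine hW.abs_gibbsAvg_sub_le fun ζ => ?_
  rw [← ENNReal.ofReal_le_iff_le_toReal (ENNReal.sum_ne_top.2 fun i _ => hf i)]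
  exact abs_sub_le_sum_osc f Λ fun k hk => glue_of_notMem hk ζ σ

end Osc

/-! ### Total variation and the averaging of a single spin -/

section TotalVariation

variable {E : Type} [Fintype E]

/-- Subtracting the minimum of `φ` puts its values in `[0, D]`; the sum is then at most `D` times
the total of `p - p'` over the set where this is nonnegative. -/
lemma sum_mul_sub_le {p p' φ : E → ℝ} (hp : ∑ s, p s = 1) (hp' : ∑ s, p' s = 1) {c D : ℝ}
    (hφ : ∀ s s', φ s - φ s' ≤ D) (hc : ∀ A : Finset E, ∑ s ∈ A, p s - ∑ s ∈ A, p' s ≤ c) :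
    ∑ s, p s * φ s - ∑ s, p' s * φ s ≤ c * D := by
  classical
  have hne : Nonempty E := by
    by_contra h
    rw [not_nonempty_iff] at h
    simp at hp
  obtain ⟨m, -, hm⟩ := Finset.exists_min_image Finset.univ φ Finset.univ_nonempty
  have hD : 0 ≤ D := by simpa using hφ m m
  have h1 : ∑ s, p s * φ s - ∑ s, p' s * φ s = ∑ s, (p s - p' s) * (φ s - φ m) := by
    simp only [sub_mul, mul_sub, Finset.sum_sub_distrib, ← Finset.sum_mul, hp, hp']
    ring
  let G := Finset.univ.filter fun s => p' s ≤ p s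
  calc _ = ∑ s, (p s - p' s) * (φ s - φ m) := h1
    _ ≤ ∑ s, if p' s ≤ p s then (p s - p' s) * D else 0 := by
        refine Finset.sum_le_sum fun s _ => ?_
        have h2 := hm s (Finset.mem_univ s)
        split_ifs with h
        · exact mul_le_mul_of_nonneg_left (hφ s m) (by linarith)
        · exact mul_nonpos_of_nonpos_of_nonneg (by linarith) (by linarith)
    _ = (∑ s ∈ G, p s - ∑ s ∈ G, p' s) * D := by
        rw [← Finset.sum_filter, ← Finset.sum_mul, Finset.sum_sub_distrib]
    _ ≤ c * D := mul_le_mul_of_nonneg_right (hc G) hD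

lemma abs_sum_mul_sub_le {p p' φ : E → ℝ} (hp : ∑ s, p s = 1) (hp' : ∑ s, p' s = 1) {c D : ℝ}
    (hφ : ∀ s s', |φ s - φ s'| ≤ D) (hc : ∀ A : Finset E, |∑ s ∈ A, p s - ∑ s ∈ A, p' s| ≤ c) :
    |∑ s, p s * φ s - ∑ s, p' s * φ s| ≤ c * D := by
  have hφ' : ∀ s s', φ s - φ s' ≤ D := fun s s' => (le_abs_self _).trans (hφ s s')
  refine abs_sub_le_iff.2 ⟨sum_mul_sub_le hp hp' hφ' fun A => (le_abs_self _).trans (hc A),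
    sum_mul_sub_le hp' hp hφ' fun A => ?_⟩
  rw [← neg_sub]
  exact (neg_le_abs _).trans (hc A)

variable {L : Type} [DecidableEq L]

/-- The effect on the oscillations of averaging over a single spin. -/
lemma osc_average_le {p : (L → E) → E → ℝ} (hp0 : ∀ σ s, 0 ≤ p σ s) (hp1 : ∀ σ, ∑ s, p σ s = 1)
    {f g : (L → E) → ℝ} {i j : L} (hg : ∀ σ, g σ = ∑ s, p σ s * f (Function.update σ i s))
    {c : ℝ≥0∞} (hc : ∀ σ σ', (∀ k, k ≠ j → σ k = σ' k) → ∀ A : Finset E,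
      ENNReal.ofReal |∑ s ∈ A, p σ s - ∑ s ∈ A, p σ' s| ≤ c)
    (hc' : c ≠ ∞) (hi : osc f i ≠ ∞) :
    osc g j ≤ osc f j + c * osc f i := by
  by_cases hj : osc f j = ∞
  · simp [hj]
  refine osc_le fun σ σ' h => ?_
  -- The first part compares two functions under the same law, at the cost of the oscillation at
  -- `j`; the second compares two laws on the same function of the spin at `i`.
  have h1 : g σ - g σ' = (∑ s, p σ s * (f (Function.update σ i s) - f (Function.update σ' i s))) +
      (∑ s, p σ s * f (Function.update σ' i s) - ∑ s, p σ' s * f (Function.update σ' i s)) := by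
    rw [hg, hg]
    simp only [mul_sub, Finset.sum_sub_distrib]
    ring
  have h2 : |∑ s, p σ s * (f (Function.update σ i s) - f (Function.update σ' i s))| ≤
      (osc f j).toReal := by
    refine (Finset.abs_sum_le_sum_abs _ _).trans ?_
    calc _ ≤ ∑ s, p σ s * (osc f j).toReal := by
          refine Finset.sum_le_sum fun s _ => ?_
          rw [abs_mul, abs_of_nonneg (hp0 σ s)]
          refine mul_le_mul_of_nonneg_left (abs_sub_le_osc hj fun k hk => ?_) (hp0 σ s)
          by_cases hki : k = i
          · subst hki; simp
          · simp [Function.update_of_ne hki, h k hk]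
      _ = _ := by rw [← Finset.sum_mul, hp1, one_mul]
  have h3 : |∑ s, p σ s * f (Function.update σ' i s) - ∑ s, p σ' s * f (Function.update σ' i s)| ≤
      c.toReal * (osc f i).toReal := by
    refine abs_sum_mul_sub_le (hp1 σ) (hp1 σ') (fun s s' => abs_sub_le_osc hi fun k hk => ?_)
      fun A => (ENNReal.ofReal_le_iff_le_toReal hc').1 (hc σ σ' h A)
    simp [Function.update_of_ne hk]
  calc ENNReal.ofReal |g σ - g σ'|
      ≤ ENNReal.ofReal ((osc f j).toReal + c.toReal * (osc f i).toReal) :=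
        ENNReal.ofReal_le_ofReal (by rw [h1]; exact (abs_add_le _ _).trans (add_le_add h2 h3))
    _ = _ := by
        rw [ENNReal.ofReal_add ENNReal.toReal_nonneg (by positivity), ← ENNReal.toReal_mul,
          ENNReal.ofReal_toReal hj, ENNReal.ofReal_toReal (ENNReal.mul_ne_top hc' hi)]

end TotalVariation

/-! ### Estimates -/

section Estimate

variable {L E : Type} [DecidableEq L] [Fintype E] [MeasurableSpace E]

/-- A family of blocks on which the kernels of the weight `W` contract oscillations.  The blocks of
the sites of `O` are singletons; the block of another site consists of this site and of
sites of `O`. -/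
structure BlockSystem (W : Finset L → (L → E) → ℝ) where
  O : Set L
  block : L → Finset L
  c : L → L → ℝ≥0∞
  mem_block : ∀ i, i ∈ block i
  mem_O : ∀ i, ∀ k ∈ block i, k ≠ i → k ∈ O
  block_of_mem : ∀ x ∈ O, block x = {x}
  c_eq_zero : ∀ i, ∀ j ∈ O, c i j = 0
  osc_self : ∀ (i : L) (f : (L → E) → ℝ), osc (gibbsAvg W (block i) f) i = 0
  osc_le : ∀ (i : L) (f : (L → E) → ℝ), osc f i ≠ ∞ →
    (∀ k ∈ block i, k ≠ i → osc f k = 0) → ∀ j, j ≠ i →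
      osc (gibbsAvg W (block i) f) j ≤ osc f j + c i j * osc f i

variable {W : Finset L → (L → E) → ℝ} (B : BlockSystem W)

/-- The functional `ℓ` is estimated by the vector `a` on the functions of the class `P` which do
not depend on the spins in `Z`. -/
def EstimateOn (P : ((L → E) → ℝ) → Prop) (ℓ : ((L → E) → ℝ) → ℝ≥0∞) (Z : Finset L)
    (a : L → ℝ≥0∞) : Prop :=
  ∀ f, P f → (∀ k ∈ Z, osc f k = 0) → ℓ f ≤ ∑' i, a i * osc f i

variable {P : ((L → E) → ℝ) → Prop} {ℓ : ((L → E) → ℝ) → ℝ≥0∞} {s : L → ℝ≥0∞}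

lemma EstimateOn.mono {Z : Finset L} {a b : L → ℝ≥0∞} (h : EstimateOn P ℓ Z a)
    (hab : ∀ i, a i ≤ b i) : EstimateOn P ℓ Z b := fun f hf hZ =>
  (h f hf hZ).trans (ENNReal.tsum_le_tsum fun i => mul_le_mul_left (hab i) _)

/-- Sites are updated one at a time, so an induction reaches only finitely many of them. The others
cost at most `C` times the tail of the convergent sum of oscillations, which vanishes in the limit.
-/
lemma EstimateOn.of_finset {a b : L → ℝ≥0∞} {C : ℝ≥0∞} (hC : C ≠ ∞) (ha : ∀ i, a i ≤ C)
    (hP : ∀ f, P f → ∑' i, osc f i ≠ ∞)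
    (h : ∀ Λ : Finset L, EstimateOn P ℓ ∅ fun i => if i ∈ Λ then b i else a i) :
    EstimateOn P ℓ ∅ b := by
  intro f hf hZ
  have h1 : ∀ Λ : Finset L, ℓ f ≤ ∑' i, b i * osc f i + C * ∑' i : {i // i ∉ Λ}, osc f i := by
    intro Λ
    refine (h Λ f hf hZ).trans ?_
    have h2 : ∑' i : {i // i ∉ Λ}, osc f i = ∑' i, ((Λ : Set L)ᶜ).indicator (osc f) i :=
      tsum_subtype ((Λ : Set L)ᶜ) (osc f)
    rw [h2, ← ENNReal.tsum_mul_left, ← ENNReal.tsum_add]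
    refine ENNReal.tsum_le_tsum fun i => ?_
    by_cases hi : i ∈ Λ
    · simp [hi]
    · simp only [hi, if_false]
      rw [Set.indicator_of_mem (by simpa using hi)]
      exact (mul_le_mul_left (ha i) _).trans le_add_self
  have h3 : Filter.Tendsto (fun Λ : Finset L => ∑' i, b i * osc f i +
      C * ∑' i : {i // i ∉ Λ}, osc f i) Filter.atTop (nhds (∑' i, b i * osc f i + C * 0)) :=
    (ENNReal.Tendsto.const_mul (ENNReal.tendsto_tsum_compl_atTop_zero (hP f hf))
      (Or.inr hC)).const_add _
  simpa using ge_of_tendsto' h3 h1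

namespace BlockSystem

/-- The basic step: updating the vector at one site. -/
lemma step (hPγ : ∀ f i, P f → (∀ k ∈ B.block i, k ≠ i → osc f k = 0) →
      P (gibbsAvg W (B.block i) f))
    (hP : ∀ f, P f → ∑' i, osc f i ≠ ∞)
    (hℓ : ∀ f i, P f → (∀ k ∈ B.block i, k ≠ i → osc f k = 0) →
      ℓ f ≤ ℓ (gibbsAvg W (B.block i) f) + s i * osc f i)
    {Z Z' : Finset L} {a : L → ℝ≥0∞} (h : EstimateOn P ℓ Z a) (hZO : ∀ z ∈ Z, z ∈ B.O) (i : L)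
    (hZ : ∀ z ∈ Z, z ≠ i → z ∈ Z') (hb : ∀ k ∈ B.block i, k ≠ i → k ∈ Z') {v : ℝ≥0∞}
    (hv : ∑' j, B.c i j * a j + s i ≤ v) : EstimateOn P ℓ Z' (Function.update a i v) := by
  intro f hf h0
  have hi : osc f i ≠ ∞ := ENNReal.ne_top_of_tsum_ne_top (hP f hf) i
  have hosc := B.osc_le i f hi fun k hk hki => h0 k (hb k hk hki)
  -- The averaged function still does not depend on `Z`: at `i` because `i` has been averaged out,
  -- elsewhere because the coefficients towards `O` vanish.
  have h1 := h (gibbsAvg W (B.block i) f)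
    (hPγ f i hf fun k hk hki => h0 k (hb k hk hki)) (by
    intro z hz
    by_cases hzi : z = i
    · rw [hzi]; exact B.osc_self i f
    · refine le_antisymm ((hosc z hzi).trans ?_) bot_le
      simp [h0 z (hZ z hz hzi), B.c_eq_zero i z (hZO z hz)])
  have h2 : ∑' j, a j * osc (gibbsAvg W (B.block i) f) j ≤
      ∑' j, ((if j = i then 0 else a j * osc f j) + B.c i j * a j * osc f i) := by
    refine ENNReal.tsum_le_tsum fun j => ?_
    by_cases hj : j = i
    · subst hj; simp [B.osc_self]
    · rw [if_neg hj]
      calc a j * osc (gibbsAvg W (B.block i) f) j ≤ a j * (osc f j + B.c i j * osc f i) :=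
            mul_le_mul_right (hosc j hj) _
        _ = _ := by ring
  calc ℓ f ≤ ℓ (gibbsAvg W (B.block i) f) + s i * osc f i :=
        hℓ f i hf fun k hk hki => h0 k (hb k hk hki)
    _ ≤ ∑' j, ((if j = i then 0 else a j * osc f j) + B.c i j * a j * osc f i) +
        s i * osc f i := by gcongr; exact h1.trans h2
    _ = ∑' j, (if j = i then 0 else a j * osc f j) + (∑' j, B.c i j * a j + s i) * osc f i := by
        rw [ENNReal.tsum_add, ENNReal.tsum_mul_right, add_mul, add_assoc]
    _ ≤ ∑' j, (if j = i then 0 else a j * osc f j) + v * osc f i := by gcongr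
    _ = ∑' j, Function.update a i v j * osc f j := by
        rw [ENNReal.tsum_eq_add_tsum_ite (f := fun j => Function.update a i v j * osc f j) i,
          Function.update_self, add_comm]
        congr 1
        refine tsum_congr fun j => ?_
        by_cases hj : j = i
        · simp [hj]
        · simp [hj]

/-- Sites of `O` where the vector is a supersolution can be removed from `Z`. -/
lemma remove (hPγ : ∀ f i, P f → (∀ k ∈ B.block i, k ≠ i → osc f k = 0) →
      P (gibbsAvg W (B.block i) f))
    (hP : ∀ f, P f → ∑' i, osc f i ≠ ∞)
    (hℓ : ∀ f i, P f → (∀ k ∈ B.block i, k ≠ i → osc f k = 0) →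
      ℓ f ≤ ℓ (gibbsAvg W (B.block i) f) + s i * osc f i)
    {a : L → ℝ≥0∞} (ha : ∀ x ∈ B.O, ∑' j, B.c x j * a j + s x ≤ a x) (Z : Finset L)
    (hZO : ∀ z ∈ Z, z ∈ B.O) (h : EstimateOn P ℓ Z a) : EstimateOn P ℓ ∅ a := by
  induction Z using Finset.induction_on with
  | empty => exact h
  | insert x Z hx ih =>
    have hxO : x ∈ B.O := hZO x (by simp)
    refine ih (fun z hz => hZO z (by simp [hz])) ?_
    -- An update at `x` with the old value `a x`, allowed by `ha`, leaves the vector unchanged; only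
    -- the restriction at `x` disappears.
    have := B.step hPγ hP hℓ (Z' := Z) h hZO x (fun z hz hzx => by
      simpa [hzx] using hz) (fun k hk hkx => by
      rw [B.block_of_mem x hxO] at hk
      exact absurd (by simpa using hk) hkx) (ha x hxO)
    rwa [Function.update_eq_self] at this

/-- Updating the vector at a site off `O`. -/
lemma step_off (hPγ : ∀ f i, P f → (∀ k ∈ B.block i, k ≠ i → osc f k = 0) →
      P (gibbsAvg W (B.block i) f))
    (hP : ∀ f, P f → ∑' i, osc f i ≠ ∞)
    (hℓ : ∀ f i, P f → (∀ k ∈ B.block i, k ≠ i → osc f k = 0) →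
      ℓ f ≤ ℓ (gibbsAvg W (B.block i) f) + s i * osc f i)
    {a : L → ℝ≥0∞} (h : EstimateOn P ℓ ∅ a)
    (ha : ∀ x ∈ B.O, ∑' j, B.c x j * a j + s x ≤ a x) {i : L} (hi : i ∉ B.O) {v : ℝ≥0∞}
    (hv : ∑' j, B.c i j * a j + s i ≤ v) (hva : v ≤ a i) :
    EstimateOn P ℓ ∅ (Function.update a i v) := by
  -- A block average is controlled only on functions that ignore the other sites of the block. These
  -- sites lie in `O`, and `remove` lifts the restriction afterwards.
  have h1 := B.step hPγ hP hℓ (Z' := (B.block i).erase i) h (by simp) i (by simp)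
    (fun k hk hki => by simp [hk, hki]) hv
  refine B.remove hPγ hP hℓ (fun x hx => ?_) _ (fun z hz => ?_) h1
  · have hxi : x ≠ i := fun h => hi (h ▸ hx)
    rw [Function.update_of_ne hxi]
    refine le_trans ?_ (ha x hx)
    gcongr with j
    by_cases hj : j = i
    · subst hj; simpa using hva
    · rw [Function.update_of_ne hj]
  · rw [Finset.mem_erase] at hz
    exact B.mem_O i z hz.2 hz.1

/-- The Dobrushin condition for a block system, with respect to the weights `e`. -/
structure Contracts (B : BlockSystem W) (e : L → ℝ≥0∞) (R α : ℝ≥0∞) : Prop where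
  bound_ne_top : R ≠ ∞
  one_le : ∀ i, 1 ≤ e i
  le_bound : ∀ i, e i ≤ R
  lt_one : α < 1
  contract : ∀ i, i ∉ B.O → ∑' j, B.c i j * e j ≤ α * e i
  nonexpand : ∀ i, i ∈ B.O → ∑' j, B.c i j * e j ≤ e i

/-- The contraction argument: a supersolution estimates `ℓ`. -/
theorem estimate (hPγ : ∀ f i, P f → (∀ k ∈ B.block i, k ≠ i → osc f k = 0) →
      P (gibbsAvg W (B.block i) f))
    (hP : ∀ f, P f → ∑' i, osc f i ≠ ∞)
    (hℓ : ∀ f i, P f → (∀ k ∈ B.block i, k ≠ i → osc f k = 0) →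
      ℓ f ≤ ℓ (gibbsAvg W (B.block i) f) + s i * osc f i)
    {M : ℝ≥0∞} (hM : M ≠ ∞) (hℓM : ∀ f, P f → ℓ f ≤ M * ∑' i, osc f i)
    {e : L → ℝ≥0∞} {R α : ℝ≥0∞} (hB : B.Contracts e R α)
    {A : L → ℝ≥0∞} {C : ℝ≥0∞} (hC : C ≠ ∞) (hAC : ∀ i, A i ≤ C)
    (hA : ∀ i, ∑' j, B.c i j * A j + s i ≤ A i) {f : (L → E) → ℝ} (hf : P f) :
    ℓ f ≤ ∑' i, A i * osc f i := by
  classical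
  obtain ⟨hR, he1, heR, hα, heα, heO⟩ := hB
  have hsum : ∀ i ε, ∑' j, B.c i j * (A j + ε * e j) =
      ∑' j, B.c i j * A j + ε * ∑' j, B.c i j * e j := by
    intro i ε
    rw [← ENNReal.tsum_mul_left, ← ENNReal.tsum_add]
    exact tsum_congr fun j => by ring
  -- One sweep multiplies the excess over `A` by `α`: the sites off `O` are improved first, using
  -- `contract`, then those of `O`.
  have contract : ∀ ε : ℝ≥0∞, ε ≠ ∞ → EstimateOn P ℓ ∅ (fun i => A i + ε * e i) →
      EstimateOn P ℓ ∅ (fun i => A i + ε * α * e i) := by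
    intro ε hε h
    have hαe : ∀ j, ε * α * e j ≤ ε * e j := fun j => by
      calc ε * α * e j ≤ ε * 1 * e j := by gcongr
        _ = _ := by rw [mul_one]
    have hle : ∀ j, A j + ε * α * e j ≤ A j + ε * e j := fun j => add_le_add le_rfl (hαe j)
    let b : L → ℝ≥0∞ := fun i => if i ∈ B.O then A i + ε * e i else A i + ε * α * e i
    have hba : ∀ j, b j ≤ A j + ε * e j := fun j => by
      simp only [b]; split_ifs
      · exact le_rfl
      · exact hle j
    have hbound : ∀ i, A i + ε * e i ≤ C + ε * R := fun i => add_le_add (hAC i) (by gcongr; exact heR i)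
    have hfin : C + ε * R ≠ ∞ := ENNReal.add_ne_top.2 ⟨hC, ENNReal.mul_ne_top hε hR⟩
    have hb : EstimateOn P ℓ ∅ b := by
      refine EstimateOn.of_finset hfin hbound hP fun Λ => ?_
      induction Λ using Finset.induction_on with
      | empty => simpa using h
      | insert i Λ hi ih =>
        have hcur : ∀ j, (if j ∈ Λ then b j else A j + ε * e j) ≤ A j + ε * e j := fun j => by
          split_ifs
          · exact hba j
          · exact le_rfl
        have hsumle : ∀ k, ∑' j, B.c k j * (if j ∈ Λ then b j else A j + ε * e j) ≤
            ∑' j, B.c k j * A j + ε * ∑' j, B.c k j * e j := fun k => by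
          rw [← hsum]
          exact ENNReal.tsum_le_tsum fun j => mul_le_mul_right (hcur j) _
        by_cases hiO : i ∈ B.O
        · refine ih.mono fun j => ?_
          by_cases hj : j = i
          · subst hj; simp [hi, b, hiO]
          · simp [hj]
        · have h1 := B.step_off hPγ hP hℓ ih (fun x hx => ?_) hiO
            (v := A i + ε * α * e i) ?_ ?_
          · refine h1.mono fun j => ?_
            by_cases hj : j = i
            · subst hj; simp [b, hiO]
            · simp [hj]
          · have : (if x ∈ Λ then b x else A x + ε * e x) = A x + ε * e x := by
              simp [b, hx]
            rw [this]
            calc _ ≤ (∑' j, B.c x j * A j + ε * ∑' j, B.c x j * e j) + s x := by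
                  gcongr; exact hsumle x
              _ = (∑' j, B.c x j * A j + s x) + ε * ∑' j, B.c x j * e j := by ring
              _ ≤ A x + ε * e x := by gcongr; exacts [hA x, heO x hx]
          · calc _ ≤ (∑' j, B.c i j * A j + ε * ∑' j, B.c i j * e j) + s i := by
                  gcongr; exact hsumle i
              _ = (∑' j, B.c i j * A j + s i) + ε * ∑' j, B.c i j * e j := by ring
              _ ≤ A i + ε * (α * e i) := by gcongr; exacts [hA i, heα i hiO]
              _ = _ := by ring
          · simp only [hi, if_false]; exact hle i
    refine EstimateOn.of_finset hfin (fun i => (hba i).trans (hbound i)) hP fun Λ => ?_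
    induction Λ using Finset.induction_on with
    | empty => simpa using hb
    | insert i Λ hi ih =>
      by_cases hiO : i ∈ B.O
      · have h1 := B.step hPγ hP hℓ (Z' := ∅) ih (by simp) i (by simp) (fun k hk hki => by
          rw [B.block_of_mem i hiO] at hk
          exact absurd (by simpa using hk) hki) (v := A i + ε * α * e i) ?_
        · refine h1.mono fun j => ?_
          by_cases hj : j = i
          · subst hj; simp
          · simp [hj]
        -- The sum for a site of `O` involves only sites off `O`, which already carry the factor
        -- `α`; hence nonexpansion suffices here.
        · calc _ ≤ ∑' j, B.c i j * (A j + ε * α * e j) + s i := by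
                refine add_le_add (ENNReal.tsum_le_tsum fun j => ?_) le_rfl
                by_cases hj : j ∈ B.O
                · simp [B.c_eq_zero i j hj]
                · simp [b, hj]
            _ = (∑' j, B.c i j * A j + s i) + ε * α * ∑' j, B.c i j * e j := by
                rw [hsum]; ring
            _ ≤ _ := by gcongr; exacts [hA i, heO i hiO]
      · refine ih.mono fun j => ?_
        by_cases hj : j = i
        · subst hj; simp [hi, b, hiO]
        · simp [hj]
  have hiter : ∀ n : ℕ, EstimateOn P ℓ ∅ (fun i => A i + M * α ^ n * e i) := by
    intro n
    induction n with
    | zero =>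
      intro f hf _
      refine (hℓM f hf).trans ?_
      rw [← ENNReal.tsum_mul_left]
      refine ENNReal.tsum_le_tsum fun i => ?_
      gcongr
      calc M = M * 1 := (mul_one _).symm
        _ ≤ M * e i := by gcongr; exact he1 i
        _ ≤ _ := by simp
    | succ n ih =>
      have h1 := contract (M * α ^ n) (ENNReal.mul_ne_top hM
        (ENNReal.pow_ne_top (hα.trans ENNReal.one_lt_top).ne)) ih
      simpa only [pow_succ, mul_assoc] using h1
  have h2 : ∀ n : ℕ, ℓ f ≤ ∑' i, A i * osc f i + α ^ n * (M * R * ∑' i, osc f i) := by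
    intro n
    refine (hiter n f hf (by simp)).trans ?_
    rw [← ENNReal.tsum_mul_left, ← ENNReal.tsum_mul_left, ← ENNReal.tsum_add]
    refine ENNReal.tsum_le_tsum fun i => ?_
    calc (A i + M * α ^ n * e i) * osc f i ≤ (A i + M * α ^ n * R) * osc f i := by
          gcongr; exact heR i
      _ = _ := by ring
  have h3 : Filter.Tendsto (fun n : ℕ => ∑' i, A i * osc f i + α ^ n * (M * R * ∑' i, osc f i))
      Filter.atTop (nhds (∑' i, A i * osc f i + 0 * (M * R * ∑' i, osc f i))) :=
    (ENNReal.Tendsto.mul_const (ENNReal.tendsto_pow_atTop_nhds_zero_of_lt_one hα)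
      (Or.inr (ENNReal.mul_ne_top (ENNReal.mul_ne_top hM hR) (hP f hf)))).const_add _
  simpa using ge_of_tendsto' h3 h2

end BlockSystem

end Estimate

/-! ### Uniqueness and its consequences -/

section Uniqueness

variable {L E : Type} [DecidableEq L] [Countable L] [Fintype E] [MeasurableSpace E]
  [MeasurableSingletonClass E] {W : Finset L → (L → E) → ℝ} {B : BlockSystem W}
  {e : L → ℝ≥0∞} {R α : ℝ≥0∞} {μ ν : Measure (L → E)}

lemma osc_eq_zero_of_dependsOn {f : (L → E) → ℝ} {S : Finset L} (hf : DependsOn f (S : Set L))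
    {i : L} (hi : i ∉ S) : osc f i = 0 := by
  refine le_antisymm (osc_le fun σ σ' h => ?_) bot_le
  rw [hf fun k hk => h k fun hki => hi (hki ▸ hk)]
  simp

lemma osc_ne_top_of_bounded {f : (L → E) → ℝ} (hf : ∃ C, ∀ σ, |f σ| ≤ C) (i : L) :
    osc f i ≠ ∞ := by
  obtain ⟨C, hC⟩ := hf
  refine ne_top_of_le_ne_top (b := ENNReal.ofReal (C + C)) ENNReal.ofReal_ne_top
    (osc_le fun σ σ' _ => ENNReal.ofReal_le_ofReal ?_)
  exact (abs_sub _ _).trans (add_le_add (hC σ) (hC σ'))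

lemma tsum_osc_eq_sum {f : (L → E) → ℝ} {S : Finset L} (hf : DependsOn f (S : Set L)) :
    ∑' i, osc f i = ∑ i ∈ S, osc f i :=
  tsum_eq_sum fun _ hi => osc_eq_zero_of_dependsOn hf hi

lemma abs_sub_le_of_dependsOn {f : (L → E) → ℝ} {S : Finset L} (hf : DependsOn f (S : Set L))
    (σ σ' : L → E) : |f σ - f σ'| ≤ (∑' i, osc f i).toReal := by
  have hfin : ∑ i ∈ S, osc f i ≠ ∞ := ENNReal.sum_ne_top.2 fun i _ =>
    osc_ne_top_of_bounded (exists_bound_of_dependsOn hf) i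
  rw [tsum_osc_eq_sum hf, ← ENNReal.ofReal_le_iff_le_toReal hfin]
  have h1 : f σ = f (glue S (fun i => σ i) σ') := hf fun i hi => by
    rw [glue_of_mem (Finset.mem_coe.1 hi)]
  rw [h1]
  exact abs_sub_le_sum_osc f S fun k hk => glue_of_notMem hk _ _

lemma abs_integral_sub_le [IsProbabilityMeasure μ] {f : (L → E) → ℝ} (hf : Integrable f μ)
    {a C : ℝ} (h : ∀ᵐ σ ∂μ, |f σ - a| ≤ C) : |∫ σ, f σ ∂μ - a| ≤ C := by
  have h1 : ∫ σ, f σ ∂μ - a = ∫ σ, (f σ - a) ∂μ := by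
    rw [integral_sub hf (integrable_const a)]
    simp
  rw [h1]
  simpa using norm_integral_le_of_norm_le_const (μ := μ) (f := fun σ => f σ - a) h

/-- Dobrushin uniqueness. -/
theorem BlockSystem.Contracts.unique (hB : B.Contracts e R α) (hW : GoodWeight W)
    [IsProbabilityMeasure μ] [IsProbabilityMeasure ν] (hμ : Invariant W μ)
    (hν : Invariant W ν) : μ = ν := by
  have hb : ∀ f : (L → E) → ℝ, (∃ S : Finset L, DependsOn f (S : Set L)) →
      Measurable f ∧ ∃ C, ∀ σ, |f σ| ≤ C := fun f ⟨S, hS⟩ =>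
    ⟨measurable_of_dependsOn hS, exists_bound_of_dependsOn hS⟩
  refine ext_of_integral_dependsOn fun f S hf => ?_
  have key := B.estimate (P := fun f => ∃ S : Finset L, DependsOn f (S : Set L))
    (ℓ := fun f => ENNReal.ofReal |∫ σ, f σ ∂μ - ∫ σ, f σ ∂ν|) (s := 0)
    (fun f i ⟨S, hS⟩ _ => hW.exists_dependsOn_gibbsAvg _ hS)
    (fun f ⟨S, hS⟩ => by
      rw [tsum_osc_eq_sum hS]
      exact ENNReal.sum_ne_top.2 fun i _ => osc_ne_top_of_bounded (exists_bound_of_dependsOn hS) i)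
    (fun f i hf _ => by
      obtain ⟨hm, hbd⟩ := hb f hf
      simp only [hμ _ f hm hbd, hν _ f hm hbd, Pi.zero_apply, zero_mul, add_zero, le_refl])
    (M := 2) (by simp) (fun f hf => by
      obtain ⟨hm, hbd⟩ := hb f hf
      obtain ⟨S, hS⟩ := hf
      obtain ⟨σ₀⟩ := μ.nonempty_of_neZero
      have h1 := abs_integral_sub_le (μ := μ) (integrable_of_bounded hm hbd)
        (Filter.Eventually.of_forall fun σ => abs_sub_le_of_dependsOn hS σ σ₀)
      have h2 := abs_integral_sub_le (μ := ν) (integrable_of_bounded hm hbd)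
        (Filter.Eventually.of_forall fun σ => abs_sub_le_of_dependsOn hS σ σ₀)
      have hfin : ∑' i, osc f i ≠ ∞ := by
        rw [tsum_osc_eq_sum hS]
        exact ENNReal.sum_ne_top.2 fun i _ =>
          osc_ne_top_of_bounded (exists_bound_of_dependsOn hS) i
      rw [ENNReal.ofReal_le_iff_le_toReal (ENNReal.mul_ne_top (by simp) hfin), ENNReal.toReal_mul]
      rw [abs_sub_comm] at h2
      have h3 := abs_sub_le (∫ σ, f σ ∂μ) (f σ₀) (∫ σ, f σ ∂ν)
      simp only [ENNReal.toReal_ofNat]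
      linarith) hB (A := 0) (C := 0) (by simp) (by simp) (by simp) ⟨S, hf⟩
  simp only [Pi.zero_apply, zero_mul, tsum_zero, nonpos_iff_eq_zero, ENNReal.ofReal_eq_zero] at key
  exact sub_eq_zero.1 (abs_eq_zero.1 (le_antisymm key (abs_nonneg _)))

/-- If the invariant probability measure is unique, events which do not depend on any finite set
of spins are trivial. -/
lemma ae_mem_or_ae_notMem_of_unique [IsProbabilityMeasure μ] (hμ : Invariant W μ)
    (huniq : ∀ ν : Measure (L → E), IsProbabilityMeasure ν → Invariant W ν → ν = μ)
    {A : Set (L → E)} (hA : MeasurableSet A)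
    (htail : ∀ (Λ : Finset L) (ζ : Λ → E) σ, glue Λ ζ σ ∈ A ↔ σ ∈ A) :
    (∀ᵐ σ ∂μ, σ ∈ A) ∨ (∀ᵐ σ ∂μ, σ ∉ A) := by
  by_cases h0 : μ A = 0
  · exact Or.inr (measure_eq_zero_iff_ae_notMem.1 h0)
  left
  have hp : IsProbabilityMeasure (ProbabilityTheory.cond μ A) :=
    ProbabilityTheory.cond_isProbabilityMeasure h0
  have hinv : Invariant W (ProbabilityTheory.cond μ A) := by
    intro Λ f hf hb
    unfold ProbabilityTheory.cond
    rw [integral_smul_measure, integral_smul_measure, ← integral_indicator hA,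
      ← integral_indicator hA]
    congr 1
    -- The event does not see the spins in `Λ`, so its indicator commutes with the average and
    -- conditioning on it preserves invariance.
    have h1 : A.indicator (gibbsAvg W Λ f) = gibbsAvg W Λ (A.indicator f) := by
      funext ω
      have hfun : A.indicator f = fun σ => A.indicator (fun _ => (1 : ℝ)) σ * f σ := by
        funext σ
        by_cases hσ : σ ∈ A <;> simp [hσ]
      rw [hfun, gibbsAvg_mul_of_invariant]
      · by_cases hω : ω ∈ A <;> simp [hω]
      · intro ζ σ
        by_cases hσ : σ ∈ A
        · simp [hσ, (htail Λ ζ σ).2 hσ]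
        · simp [hσ, mt (htail Λ ζ σ).1 hσ]
    rw [h1]
    refine hμ Λ _ (hf.indicator hA) ?_
    obtain ⟨C, hC⟩ := hb
    refine ⟨C, fun σ => ?_⟩
    by_cases hσ : σ ∈ A
    · simpa [hσ] using hC σ
    · simpa [hσ] using (abs_nonneg _).trans (hC σ)
  have h1 := huniq _ hp hinv
  rw [← h1]
  exact ProbabilityTheory.ae_cond_mem hA

/-- If the invariant probability measure is unique, a measurable function is almost surely within
its total oscillation of a constant. -/
lemma exists_ae_abs_sub_le_of_unique [IsProbabilityMeasure μ] (hμ : Invariant W μ)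
    (huniq : ∀ ν : Measure (L → E), IsProbabilityMeasure ν → Invariant W ν → ν = μ)
    {f : (L → E) → ℝ} (hf : Measurable f) (hfin : ∑' i, osc f i ≠ ∞) :
    ∃ a : ℝ, ∀ᵐ σ ∂μ, |f σ - a| ≤ (∑' i, osc f i).toReal := by
  set D := (∑' i, osc f i).toReal with hD
  have hmod : ∀ (Λ : Finset L) (ζ : Λ → E) σ, |f (glue Λ ζ σ) - f σ| ≤ D := by
    intro Λ ζ σ
    rw [hD, ← ENNReal.ofReal_le_iff_le_toReal hfin]
    exact (abs_sub_le_sum_osc f Λ fun k hk => glue_of_notMem hk ζ σ).trans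
      (ENNReal.sum_le_tsum Λ)
  -- The infimum over all finite modifications is itself unaffected by finite modifications, hence
  -- almost surely constant by the triviality of tail events; it differs from `f` by at most the
  -- total oscillation.
  let g : (L → E) → ℝ := fun σ => ⨅ p : (Σ Λ : Finset L, (Λ → E)), f (glue p.1 p.2 σ)
  have hbdd : ∀ σ, BddBelow (Set.range fun p : (Σ Λ : Finset L, (Λ → E)) => f (glue p.1 p.2 σ)) := by
    intro σ
    refine ⟨f σ - D, ?_⟩
    rintro _ ⟨p, rfl⟩
    have := (abs_le.1 (hmod p.1 p.2 σ)).1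
    simp only
    linarith
  have hne : Nonempty (Σ Λ : Finset L, (Λ → E)) := ⟨⟨∅, fun i => (Finset.notMem_empty _ i.2).elim⟩⟩
  have hgm : Measurable g := Measurable.iInf fun p =>
    hf.comp ((measurable_glue p.1 p.2).mono cylinderEvents_le_pi le_rfl)
  have hle : ∀ σ τ : L → E, (∃ S : Finset L, ∀ k, k ∉ S → σ k = τ k) → g σ ≤ g τ := by
    rintro σ τ ⟨S, hS⟩
    refine le_ciInf fun p => ?_
    obtain ⟨ζ, hζ⟩ := exists_glue_eq (Λ := S ∪ p.1) (ω := σ) (ω' := glue p.1 p.2 τ) (by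
      intro k hk
      rw [Finset.mem_union, not_or] at hk
      rw [glue_of_notMem hk.2, hS k hk.1])
    rw [← hζ]
    exact ciInf_le (hbdd σ) ⟨S ∪ p.1, ζ⟩
  have hgtail : ∀ (Λ : Finset L) (ζ : Λ → E) σ, g (glue Λ ζ σ) = g σ := fun Λ ζ σ =>
    le_antisymm (hle _ _ ⟨Λ, fun k hk => glue_of_notMem hk ζ σ⟩)
      (hle _ _ ⟨Λ, fun k hk => (glue_of_notMem hk ζ σ).symm⟩)
  obtain ⟨a, ha⟩ := Filter.exists_eventuallyEq_const_of_forall_separating (l := ae μ) (f := g)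
    MeasurableSet fun U hU => ae_mem_or_ae_notMem_of_unique (A := g ⁻¹' U) hμ huniq (hgm hU)
      fun Λ ζ σ => by rw [Set.mem_preimage, Set.mem_preimage, hgtail]
  refine ⟨a, ha.mono fun σ hσ => ?_⟩
  simp only [Function.const_apply] at hσ
  rw [← hσ, abs_sub_le_iff]
  constructor
  · have : f σ - D ≤ g σ := le_ciInf fun p => by
      have := (abs_le.1 (hmod p.1 p.2 σ)).1
      linarith
    linarith
  · have : g σ ≤ f σ := by
      refine (ciInf_le (hbdd σ) ⟨∅, fun i => (Finset.notMem_empty _ i.2).elim⟩).trans (le_of_eq ?_)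
      congr 1
    have hD0 : 0 ≤ D := ENNReal.toReal_nonneg
    linarith

end Uniqueness

/-! ### Decay of correlations -/

section Decay

variable {L E : Type} [DecidableEq L] [Countable L] [Fintype E] [MeasurableSpace E]
  [MeasurableSingletonClass E] {W : Finset L → (L → E) → ℝ} {B : BlockSystem W}
  {e : L → ℝ≥0∞} {R α : ℝ≥0∞} {μ : Measure (L → E)}

/-- Replacing a function by a bounded one that is almost surely equal. -/
lemma exists_bounded_ae_eq [IsProbabilityMeasure μ] {f : (L → E) → ℝ} (hf : Measurable f)
    {a D : ℝ} (h : ∀ᵐ σ ∂μ, |f σ - a| ≤ D) :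
    ∃ f' : (L → E) → ℝ, Measurable f' ∧ (∃ C, ∀ σ, |f' σ| ≤ C) ∧ (∀ i, osc f' i ≤ osc f i) ∧
      f =ᵐ[μ] f' := by
  have hD : 0 ≤ D := by
    obtain ⟨σ, hσ⟩ := h.exists
    exact (abs_nonneg _).trans hσ
  refine ⟨fun σ => max (min (f σ) (a + D)) (a - D), (hf.min measurable_const).max measurable_const,
    ⟨|a| + D, fun σ => ?_⟩, fun i => ?_, ?_⟩
  · have h1 : max (min (f σ) (a + D)) (a - D) ≤ a + D :=
      max_le (min_le_right _ _) (by linarith)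
    have h2 : a - D ≤ max (min (f σ) (a + D)) (a - D) := le_max_right _ _
    have h3 := le_abs_self a
    have h4 := neg_abs_le a
    rw [abs_le]
    constructor <;> linarith
  · refine osc_le fun σ σ' hσ => le_trans (ENNReal.ofReal_le_ofReal ?_) (le_osc f hσ)
    refine (abs_max_sub_max_le_abs _ _ _).trans ?_
    refine (abs_min_sub_min_le_max _ _ _ _).trans ?_
    simp
  · filter_upwards [h] with σ hσ
    rw [abs_le] at hσ
    rw [min_eq_left (by linarith), max_eq_left (by linarith)]

/-- The change of a covariance when one function is averaged over a block. -/
lemma Invariant.covariance_step [IsProbabilityMeasure μ] (hμ : Invariant W μ) (hW : GoodWeight W)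
    (Λ : Finset L) {f g : (L → E) → ℝ} (hf : Measurable f) (hfb : ∃ C, ∀ σ, |f σ| ≤ C)
    (hg : Measurable g) (hgb : ∃ C, ∀ σ, |g σ| ≤ C) :
    (∫ σ, f σ * g σ ∂μ) - (∫ σ, f σ ∂μ) * (∫ σ, g σ ∂μ) =
      ((∫ σ, gibbsAvg W Λ f σ * g σ ∂μ) - (∫ σ, gibbsAvg W Λ f σ ∂μ) * (∫ σ, g σ ∂μ)) +
        ∫ σ, (f σ - gibbsAvg W Λ f σ) * (g σ - gibbsAvg W Λ g σ) ∂μ := by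
  have hbmul : ∀ {u v : (L → E) → ℝ}, (∃ C, ∀ σ, |u σ| ≤ C) → (∃ C, ∀ σ, |v σ| ≤ C) →
      ∃ C, ∀ σ, |u σ * v σ| ≤ C := by
    rintro u v ⟨C, hC⟩ ⟨C', hC'⟩
    refine ⟨C * C', fun σ => ?_⟩
    rw [abs_mul]
    exact mul_le_mul (hC σ) (hC' σ) (abs_nonneg _) ((abs_nonneg _).trans (hC σ))
  have hav : ∀ {u : (L → E) → ℝ}, (∃ C, ∀ σ, |u σ| ≤ C) → ∃ C, ∀ σ, |gibbsAvg W Λ u σ| ≤ C :=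
    fun ⟨C, hC⟩ => ⟨C, fun σ => hW.abs_gibbsAvg_le hC σ⟩
  have hfm := hW.measurable_gibbsAvg hf Λ
  have hgm := hW.measurable_gibbsAvg hg Λ
  -- Invariance applied to the product, with the factor already averaged pulled out of the second
  -- average.
  have h1 : ∫ σ, gibbsAvg W Λ f σ * g σ ∂μ = ∫ σ, gibbsAvg W Λ f σ * gibbsAvg W Λ g σ ∂μ := by
    rw [← hμ Λ (fun σ => gibbsAvg W Λ f σ * g σ) (hfm.mul hg) (hbmul (hav hfb) hgb)]
    simp only [gibbsAvg_mul_of_invariant (fun ζ σ => gibbsAvg_glue Λ f ζ σ)]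
  have h2 : ∫ σ, f σ * gibbsAvg W Λ g σ ∂μ = ∫ σ, gibbsAvg W Λ f σ * gibbsAvg W Λ g σ ∂μ := by
    simp only [mul_comm (f _), mul_comm (gibbsAvg W Λ f _)]
    rw [← hμ Λ (fun σ => gibbsAvg W Λ g σ * f σ) (hgm.mul hf) (hbmul (hav hgb) hfb)]
    simp only [gibbsAvg_mul_of_invariant (fun ζ σ => gibbsAvg_glue Λ g ζ σ)]
  have i1 : Integrable (fun σ => f σ * g σ) μ :=
    integrable_of_bounded (μ := μ) (hf.mul hg) (hbmul hfb hgb)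
  have i2 : Integrable (fun σ => gibbsAvg W Λ f σ * g σ) μ :=
    integrable_of_bounded (μ := μ) (hfm.mul hg) (hbmul (hav hfb) hgb)
  have i3 : Integrable (fun σ => f σ * gibbsAvg W Λ g σ) μ :=
    integrable_of_bounded (μ := μ) (hf.mul hgm) (hbmul hfb (hav hgb))
  have i4 : Integrable (fun σ => gibbsAvg W Λ f σ * gibbsAvg W Λ g σ) μ :=
    integrable_of_bounded (μ := μ) (hfm.mul hgm) (hbmul (hav hfb) (hav hgb))
  have i12 : Integrable (fun σ => f σ * g σ - gibbsAvg W Λ f σ * g σ) μ := i1.sub i2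
  have i34 : Integrable (fun σ => f σ * gibbsAvg W Λ g σ -
      gibbsAvg W Λ f σ * gibbsAvg W Λ g σ) μ := i3.sub i4
  have h3 : ∫ σ, (f σ - gibbsAvg W Λ f σ) * (g σ - gibbsAvg W Λ g σ) ∂μ =
      (∫ σ, f σ * g σ ∂μ - ∫ σ, gibbsAvg W Λ f σ * g σ ∂μ) -
        (∫ σ, f σ * gibbsAvg W Λ g σ ∂μ - ∫ σ, gibbsAvg W Λ f σ * gibbsAvg W Λ g σ ∂μ) := by
    rw [← integral_sub i1 i2, ← integral_sub i3 i4]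
    rw [← integral_sub i12 i34]
    refine integral_congr_ae (Filter.Eventually.of_forall fun σ => ?_)
    ring
  rw [h3, hμ Λ f hf hfb, h1, h2]
  ring

lemma BlockSystem.Contracts.tsum_c_ne_top (hB : B.Contracts e R α) (i : L) :
    ∑' j, B.c i j ≠ ∞ := by
  refine ne_top_of_le_ne_top hB.bound_ne_top ?_
  calc ∑' j, B.c i j ≤ ∑' j, B.c i j * e j := ENNReal.tsum_le_tsum fun j => by
        calc B.c i j = B.c i j * 1 := (mul_one _).symm
          _ ≤ _ := by gcongr; exact hB.one_le j
    _ ≤ e i := by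
        by_cases hi : i ∈ B.O
        · exact hB.nonexpand i hi
        · refine (hB.contract i hi).trans ?_
          calc α * e i ≤ 1 * e i := by gcongr; exact hB.lt_one.le
            _ = e i := one_mul _
    _ ≤ R := hB.le_bound i

/-- The covariance estimate for bounded functions, in terms of a supersolution. -/
lemma BlockSystem.Contracts.covariance_le (hB : B.Contracts e R α) (hW : GoodWeight W)
    [IsProbabilityMeasure μ] (hμ : Invariant W μ)
    {f g : (L → E) → ℝ} (hf : Measurable f) (hfb : ∃ C, ∀ σ, |f σ| ≤ C)
    (hff : ∑' i, osc f i ≠ ∞) (hg : Measurable g) (hgb : ∃ C, ∀ σ, |g σ| ≤ C)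
    {A : L → ℝ≥0∞} {C : ℝ≥0∞} (hC : C ≠ ∞) (hAC : ∀ i, A i ≤ C)
    (hA : ∀ i, ∑' j, B.c i j * A j + ∑ k ∈ B.block i, osc g k ≤ A i) :
    ENNReal.ofReal |(∫ σ, f σ * g σ ∂μ) - (∫ σ, f σ ∂μ) * (∫ σ, g σ ∂μ)| ≤
      ∑' i, A i * osc f i := by
  have huniq : ∀ ν : Measure (L → E), IsProbabilityMeasure ν → Invariant W ν → ν = μ :=
    fun ν hν hν' => hB.unique hW hν' hμ
  obtain ⟨G, hG⟩ := hgb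
  have hgo : ∀ i, osc g i ≠ ∞ := osc_ne_top_of_bounded ⟨G, hG⟩
  refine B.estimate (P := fun f => Measurable f ∧ (∃ C, ∀ σ, |f σ| ≤ C) ∧ ∑' i, osc f i ≠ ∞)
    (ℓ := fun f => ENNReal.ofReal |(∫ σ, f σ * g σ ∂μ) - (∫ σ, f σ ∂μ) * (∫ σ, g σ ∂μ)|)
    (s := fun i => ∑ k ∈ B.block i, osc g k) ?_ (fun f hf => hf.2.2) ?_
    (M := ENNReal.ofReal (2 * G)) ENNReal.ofReal_ne_top ?_ hB hC hAC hA ⟨hf, hfb, hff⟩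
  · rintro f i ⟨hf, ⟨C, hC⟩, hff⟩ h0
    refine ⟨hW.measurable_gibbsAvg hf _, ⟨C, fun σ => hW.abs_gibbsAvg_le hC σ⟩, ?_⟩
    have hi : osc f i ≠ ∞ := ENNReal.ne_top_of_tsum_ne_top hff i
    refine ne_top_of_le_ne_top (b := ∑' j, osc f j + (∑' j, B.c i j) * osc f i)
      (ENNReal.add_ne_top.2 ⟨hff, ENNReal.mul_ne_top (hB.tsum_c_ne_top i) hi⟩) ?_
    rw [← ENNReal.tsum_mul_right, ← ENNReal.tsum_add]
    refine ENNReal.tsum_le_tsum fun j => ?_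
    by_cases hj : j = i
    · subst hj; simp [B.osc_self]
    · exact B.osc_le i f hi h0 j hj
  · rintro f i ⟨hf, hfb, hff⟩ h0
    have hfo : ∀ i, osc f i ≠ ∞ := fun i => ENNReal.ne_top_of_tsum_ne_top hff i
    have hsum : ∑ k ∈ B.block i, osc f k = osc f i := by
      rw [Finset.sum_eq_single_of_mem i (B.mem_block i) fun k hk hki => h0 k hk hki]
    rw [hμ.covariance_step hW (B.block i) hf hfb hg ⟨G, hG⟩]
    refine (ENNReal.ofReal_le_ofReal (abs_add_le _ _)).trans (ENNReal.ofReal_add_le.trans ?_)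
    refine add_le_add le_rfl ?_
    have hsg : ∑ k ∈ B.block i, osc g k ≠ ∞ := ENNReal.sum_ne_top.2 fun k _ => hgo k
    rw [ENNReal.ofReal_le_iff_le_toReal (ENNReal.mul_ne_top hsg (hfo i)), ENNReal.toReal_mul]
    have hbd : ∀ σ, ‖(f σ - gibbsAvg W (B.block i) f σ) * (g σ - gibbsAvg W (B.block i) g σ)‖ ≤
        (∑ k ∈ B.block i, osc g k).toReal * (osc f i).toReal := by
      intro σ
      rw [norm_mul, mul_comm]
      have h1 := hW.abs_sub_gibbsAvg_le hfo (B.block i) σ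
      rw [hsum] at h1
      exact mul_le_mul (hW.abs_sub_gibbsAvg_le hgo (B.block i) σ) h1 (norm_nonneg _)
        ENNReal.toReal_nonneg
    simpa using norm_integral_le_of_norm_le_const (μ := μ) (Filter.Eventually.of_forall hbd)
  · rintro f ⟨hf, hfb, hff⟩
    -- The initial bound must be linear in the total oscillation of `f`, with a constant independent
    -- of `f`; a sup norm bound on `f` would not do. Centring `f` at `a` and `g` at its mean gives
    -- the constant `2 * G`.
    obtain ⟨a, ha⟩ := exists_ae_abs_sub_le_of_unique hμ huniq hf hff
    have hgi := integrable_of_bounded (μ := μ) hg ⟨G, hG⟩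
    have hfi := integrable_of_bounded (μ := μ) hf hfb
    have hfgi : Integrable (fun σ => f σ * g σ) μ := hfi.mul_bdd hg.aestronglyMeasurable
      (Filter.Eventually.of_forall hG)
    have hIg : |∫ σ, g σ ∂μ| ≤ G := by
      simpa using abs_integral_sub_le (μ := μ) hgi (a := 0) (C := G)
        (Filter.Eventually.of_forall fun σ => by simpa using hG σ)
    have h1 : (∫ σ, f σ * g σ ∂μ) - (∫ σ, f σ ∂μ) * (∫ σ, g σ ∂μ) =
        ∫ σ, (f σ - a) * (g σ - ∫ τ, g τ ∂μ) ∂μ := by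
      have h2 : ∀ σ, (f σ - a) * (g σ - ∫ τ, g τ ∂μ) =
          (f σ * g σ - f σ * ∫ τ, g τ ∂μ) - (a * g σ - a * ∫ τ, g τ ∂μ) := fun σ => by ring
      have j1 : Integrable (fun σ => f σ * g σ - f σ * ∫ τ, g τ ∂μ) μ :=
        hfgi.sub (hfi.mul_const _)
      have j2 : Integrable (fun σ => a * g σ - a * ∫ τ, g τ ∂μ) μ :=
        (hgi.const_mul a).sub (integrable_const _)
      simp only [h2]
      rw [integral_sub j1 j2,
        integral_sub hfgi (hfi.mul_const _), integral_sub (hgi.const_mul a) (integrable_const _),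
        integral_mul_const, integral_const_mul]
      simp
    rw [ENNReal.ofReal_le_iff_le_toReal (ENNReal.mul_ne_top ENNReal.ofReal_ne_top hff),
      ENNReal.toReal_mul]
    have hG0 : 0 ≤ G := (abs_nonneg _).trans hIg
    rw [ENNReal.toReal_ofReal (by positivity), h1]
    have hbd : ∀ᵐ σ ∂μ, ‖(f σ - a) * (g σ - ∫ τ, g τ ∂μ)‖ ≤
        2 * G * (∑' i, osc f i).toReal := by
      filter_upwards [ha] with σ hσ
      rw [norm_mul, mul_comm]
      refine mul_le_mul ?_ hσ (norm_nonneg _) (by positivity)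
      calc |g σ - ∫ τ, g τ ∂μ| ≤ |g σ| + |∫ τ, g τ ∂μ| := abs_sub _ _
        _ ≤ 2 * G := by linarith [hG σ]
    simpa using norm_integral_le_of_norm_le_const (μ := μ) hbd

end Decay

/-! ### Exponentially weighted supersolutions -/

section ExponentialDecay

variable {L E : Type} [DecidableEq L] [Countable L] [PseudoMetricSpace L] [Fintype E]
  [MeasurableSpace E] [MeasurableSingletonClass E] {W : Finset L → (L → E) → ℝ}
  {B : BlockSystem W} {e : L → ℝ≥0∞} {R α : ℝ≥0∞} {μ : Measure (L → E)}

/-- For a contracting system of finite range, the exponentially weighted oscillations of a function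
give a supersolution. -/
lemma BlockSystem.Contracts.exists_supersolution (hB : B.Contracts e R α)
    (hc : ∀ i j, B.c i j ≠ 0 → dist i j ≤ 2) (hblock : ∀ i, ∀ k ∈ B.block i, dist i k ≤ 1) :
    ∃ K : ℝ≥0∞, K ≠ ∞ ∧ ∃ m : ℝ, 0 < m ∧ ∀ b : L → ℝ≥0∞, ∃ A : L → ℝ≥0∞,
      (∀ i, A i ≤ K * ∑' j, ENNReal.ofReal (Real.exp (-m * dist i j)) * b j) ∧
      ∀ i, ∑' j, B.c i j * A j + ∑ k ∈ B.block i, b k ≤ A i := by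
  classical
  have hαtop : α ≠ ∞ := (hB.lt_one.trans ENNReal.one_lt_top).ne
  obtain ⟨α', hα', rfl⟩ : ∃ α' : ℝ, 0 ≤ α' ∧ α = ENNReal.ofReal α' :=
    ⟨α.toReal, ENNReal.toReal_nonneg, (ENNReal.ofReal_toReal hαtop).symm⟩
  have hα1 : α' < 1 := by simpa using hB.lt_one
  -- Here `2` is the range of `c`: the weight changes by at most `exp (2 * m)` along one
  -- interaction, and this must not destroy the contraction.
  obtain ⟨m, hm, hmα⟩ : ∃ m : ℝ, 0 < m ∧ Real.exp (2 * m) * α' < 1 := by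
    have hcont : Filter.Tendsto (fun t : ℝ => Real.exp (2 * t) * α') (nhdsWithin 0 (Set.Ioi 0))
        (nhds (Real.exp (2 * 0) * α')) :=
      (Continuous.tendsto (by fun_prop) 0).mono_left nhdsWithin_le_nhds
    have h1 := hcont.eventually (gt_mem_nhds (show Real.exp (2 * 0) * α' < 1 by simpa using hα1))
    obtain ⟨m, h2, h3⟩ := (h1.and self_mem_nhdsWithin).exists
    exact ⟨m, h3, h2⟩
  set ρ := Real.exp (2 * m) * α' with hρ
  have hρ0 : 0 ≤ ρ := by positivity
  -- The solution of `k * ρ + exp m = k`, with `exp m` accounting for blocks of radius one.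
  let k : ℝ := Real.exp m / (1 - ρ)
  have hk0 : 0 ≤ k := div_nonneg (Real.exp_pos _).le (by linarith)
  have hk : k * ρ + Real.exp m = k := by
    simp only [k]
    field_simp [(by linarith : (1 : ℝ) - ρ ≠ 0)]
    ring
  let K := ENNReal.ofReal k
  let E1 := ENNReal.ofReal (Real.exp m)
  let E2 := ENNReal.ofReal (Real.exp (2 * m))
  -- Sites of `O` gain no factor `α` and need a larger constant. It never feeds back, because no
  -- coefficient points towards `O`.
  let K' := K * E2 + E1
  have hKeq : K * (E2 * ENNReal.ofReal α') + E1 = K := by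
    simp only [K, E1, E2]
    rw [← ENNReal.ofReal_mul (Real.exp_pos _).le, ← ENNReal.ofReal_mul hk0,
      ← ENNReal.ofReal_add (by positivity) (Real.exp_pos _).le, hk]
  have hKtop : K ≠ ∞ := ENNReal.ofReal_ne_top
  have hK'top : K' ≠ ∞ := ENNReal.add_ne_top.2
    ⟨ENNReal.mul_ne_top hKtop ENNReal.ofReal_ne_top, ENNReal.ofReal_ne_top⟩
  refine ⟨(K + K') * R, ENNReal.mul_ne_top (ENNReal.add_ne_top.2 ⟨hKtop, hK'top⟩)
    hB.bound_ne_top, m, hm, fun b => ?_⟩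
  let w : L → L → ℝ≥0∞ := fun i j => ENNReal.ofReal (Real.exp (-m * dist i j))
  let S : L → ℝ≥0∞ := fun i => ∑' j, w i j * b j
  have hS2 : ∀ i j, dist i j ≤ 2 → S j ≤ E2 * S i := by
    intro i j hij
    simp only [S]
    rw [← ENNReal.tsum_mul_left]
    refine ENNReal.tsum_le_tsum fun l => ?_
    rw [← mul_assoc]
    gcongr
    simp only [E2, w]
    rw [← ENNReal.ofReal_mul (Real.exp_pos _).le, ← Real.exp_add]
    refine ENNReal.ofReal_le_ofReal (Real.exp_le_exp.2 ?_)
    have := dist_triangle i j l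
    nlinarith
  have hS1 : ∀ i, ∑ l ∈ B.block i, b l ≤ E1 * S i := by
    intro i
    calc ∑ l ∈ B.block i, b l ≤ ∑ l ∈ B.block i, E1 * (w i l * b l) := by
          refine Finset.sum_le_sum fun l hl => ?_
          rw [← mul_assoc]
          have h1 : 1 ≤ E1 * w i l := by
            simp only [E1, w]
            rw [← ENNReal.ofReal_mul (Real.exp_pos _).le, ← Real.exp_add, ← ENNReal.ofReal_one]
            refine ENNReal.ofReal_le_ofReal (Real.one_le_exp ?_)
            have := hblock i l hl
            nlinarith
          calc b l = 1 * b l := (one_mul _).symm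
            _ ≤ _ := by gcongr
      _ ≤ ∑' l, E1 * (w i l * b l) := ENNReal.sum_le_tsum _
      _ = E1 * S i := ENNReal.tsum_mul_left
  refine ⟨fun i => (if i ∈ B.O then K' else K) * e i * S i, fun i => ?_, fun i => ?_⟩
  · change (if i ∈ B.O then K' else K) * e i * S i ≤ (K + K') * R * S i
    gcongr
    · split_ifs
      · exact le_add_self
      · exact le_self_add
    · exact hB.le_bound i
  · have h1 : ∑' j, B.c i j * ((if j ∈ B.O then K' else K) * e j * S j) ≤
        K * E2 * S i * ∑' j, B.c i j * e j := by
      rw [← ENNReal.tsum_mul_left]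
      refine ENNReal.tsum_le_tsum fun j => ?_
      by_cases hj : j ∈ B.O
      · simp [B.c_eq_zero i j hj]
      by_cases hcj : B.c i j = 0
      · simp [hcj]
      rw [if_neg hj]
      calc B.c i j * (K * e j * S j) ≤ B.c i j * (K * e j * (E2 * S i)) := by
            gcongr; exact hS2 i j (hc i j hcj)
        _ = _ := by ring
    have h2 : E1 * S i ≤ E1 * e i * S i := by
      calc E1 * S i = E1 * 1 * S i := by rw [mul_one]
        _ ≤ _ := by gcongr; exact hB.one_le i
    refine (add_le_add h1 ((hS1 i).trans h2)).trans ?_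
    change _ ≤ (if i ∈ B.O then K' else K) * e i * S i
    by_cases hi : i ∈ B.O
    · rw [if_pos hi]
      calc _ ≤ K * E2 * S i * e i + E1 * e i * S i := by gcongr; exact hB.nonexpand i hi
        _ = K' * e i * S i := by simp only [K']; ring
    · rw [if_neg hi]
      calc _ ≤ K * E2 * S i * (ENNReal.ofReal α' * e i) + E1 * e i * S i := by
            gcongr; exact hB.contract i hi
        _ = (K * (E2 * ENNReal.ofReal α') + E1) * e i * S i := by ring
        _ = K * e i * S i := by rw [hKeq]

/-- Exponential decay of correlations for a contracting system of finite range. -/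
theorem BlockSystem.Contracts.hasExponentialDecay (hB : B.Contracts e R α) (hW : GoodWeight W)
    [IsProbabilityMeasure μ] (hμ : Invariant W μ)
    (hc : ∀ i j, B.c i j ≠ 0 → dist i j ≤ 2) (hblock : ∀ i, ∀ k ∈ B.block i, dist i k ≤ 1) :
    HasExponentialDecay μ := by
  have huniq : ∀ ν : Measure (L → E), IsProbabilityMeasure ν → Invariant W ν → ν = μ :=
    fun ν hν hν' => hB.unique hW hν' hμ
  obtain ⟨K, hK, m, hm, hA⟩ := hB.exists_supersolution hc hblock
  refine ⟨K.toReal, m, hm, fun f g hf hg hff hgg => ?_⟩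
  -- The functions may be unbounded; they are replaced by truncations that agree with them almost
  -- surely and have no larger oscillations.
  obtain ⟨a, ha⟩ := exists_ae_abs_sub_le_of_unique hμ huniq hf hff.ne
  obtain ⟨a', ha'⟩ := exists_ae_abs_sub_le_of_unique hμ huniq hg hgg.ne
  obtain ⟨f', hf'm, hf'b, hf'o, hff'⟩ := exists_bounded_ae_eq hf ha
  obtain ⟨g', hg'm, hg'b, hg'o, hgg'⟩ := exists_bounded_ae_eq hg ha'
  have hfi := (integrable_of_bounded (μ := μ) hf'm hf'b)
  have hgi := (integrable_of_bounded (μ := μ) hg'm hg'b)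
  have hfgi : Integrable (fun σ => f' σ * g' σ) μ :=
    let ⟨G, hG⟩ := hg'b
    hfi.mul_bdd hg'm.aestronglyMeasurable (Filter.Eventually.of_forall hG)
  have hfg : (fun σ => f σ * g σ) =ᵐ[μ] fun σ => f' σ * g' σ := by
    filter_upwards [hff', hgg'] with σ h1 h2
    rw [h1, h2]
  refine ⟨hfi.congr hff'.symm, hgi.congr hgg'.symm, hfgi.congr hfg.symm, ?_⟩
  rw [integral_congr_ae hfg, integral_congr_ae hff', integral_congr_ae hgg',
    ENNReal.ofReal_toReal hK]
  obtain ⟨A, hAK, hAs⟩ := hA (osc g')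
  have hf'f : ∑' i, osc f' i ≠ ∞ := ne_top_of_le_ne_top hff.ne (ENNReal.tsum_le_tsum hf'o)
  have hg'f : ∑' i, osc g' i ≠ ∞ := ne_top_of_le_ne_top hgg.ne (ENNReal.tsum_le_tsum hg'o)
  refine (hB.covariance_le hW hμ hf'm hf'b hf'f hg'm hg'b (C := K * ∑' i, osc g' i)
    (ENNReal.mul_ne_top hK hg'f) (fun i => (hAK i).trans ?_) hAs).trans ?_
  · gcongr with j
    calc ENNReal.ofReal (Real.exp (-m * dist i j)) * osc g' j ≤ 1 * osc g' j := by
          gcongr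
          rw [ENNReal.ofReal_le_one, Real.exp_le_one_iff]
          have := dist_nonneg (x := i) (y := j)
          nlinarith
      _ = _ := one_mul _
  · rw [← ENNReal.tsum_mul_left]
    refine ENNReal.tsum_le_tsum fun i => ?_
    calc A i * osc f' i
        ≤ (K * ∑' j, ENNReal.ofReal (Real.exp (-m * dist i j)) * osc g' j) * osc f' i := by
          gcongr; exact hAK i
      _ = K * ∑' j, osc f' i * ENNReal.ofReal (Real.exp (-m * dist i j)) * osc g' j := by
          rw [mul_assoc, ← ENNReal.tsum_mul_right]
          congr 1
          exact tsum_congr fun j => by ring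
      _ ≤ _ := by
          gcongr with j
          · exact hf'o i
          · exact hg'o j

end ExponentialDecay

/-! ### The two lattice systems -/

section Lattice

lemma mem_nbrs {x y : ℤ × ℤ} : y ∈ nbrs x ↔ y = (x.1 + 1, x.2) ∨ y = (x.1 - 1, x.2) ∨
    y = (x.1, x.2 + 1) ∨ y = (x.1, x.2 - 1) := by
  simp [nbrs]

lemma nbrs_symm {x y : ℤ × ℤ} (h : y ∈ nbrs x) : x ∈ nbrs y := by
  rw [mem_nbrs] at h ⊢
  rcases x with ⟨a, b⟩
  rcases h with rfl | rfl | rfl | rfl <;> simp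

lemma ne_of_mem_nbrs {x y : ℤ × ℤ} (h : y ∈ nbrs x) : x ≠ y := by
  rw [mem_nbrs] at h
  rcases x with ⟨a, b⟩
  rcases h with rfl | rfl | rfl | rfl <;> simp <;> omega

lemma even_iff_of_mem_nbrs {x y : ℤ × ℤ} (h : y ∈ nbrs x) :
    Even (y.1 + y.2) ↔ ¬ Even (x.1 + x.2) := by
  rw [mem_nbrs] at h
  rcases x with ⟨a, b⟩
  rcases h with rfl | rfl | rfl | rfl <;> simp only [Int.even_iff] <;> omega

lemma card_nbrs_le (x : ℤ × ℤ) : (nbrs x).card ≤ 4 := Finset.card_le_four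

lemma mem_plaquette {x : ℤ × ℤ} {y : EvenSite} : y ∈ plaquette x ↔ y.1 ∈ nbrs x :=
  Finset.mem_subtype

lemma mem_centers {Λ : Finset EvenSite} {x : ℤ × ℤ} :
    x ∈ centers Λ ↔ ∃ y ∈ Λ, x ∈ nbrs y.1 := by
  simp [centers]

lemma not_even_of_mem_centers {Λ : Finset EvenSite} {x : ℤ × ℤ} (h : x ∈ centers Λ) :
    ¬ Even (x.1 + x.2) := by
  obtain ⟨y, -, hy⟩ := mem_centers.1 h
  rw [even_iff_of_mem_nbrs hy]
  simpa using y.2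

variable {q : ℕ}

lemma numColors_le (x : ℤ × ℤ) (t : EvenSite → Fin q) : numColors x t ≤ 4 := by
  refine Finset.card_image_le.trans (le_trans ?_ (card_nbrs_le x))
  rw [plaquette, Finset.card_subtype]
  exact Finset.card_filter_le _ _

lemma numColors_congr {x : ℤ × ℤ} {t t' : EvenSite → Fin q}
    (h : ∀ y ∈ plaquette x, t y = t' y) : numColors x t = numColors x t' := by
  unfold numColors
  rw [Finset.image_congr fun y hy => h y hy]

lemma sub_numColors_pos (hq : 5 ≤ q) (x : ℤ × ℤ) (t : EvenSite → Fin q) :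
    (0 : ℝ) < (q : ℝ) - numColors x t := by
  have h1 : (numColors x t : ℝ) ≤ 4 := by exact_mod_cast numColors_le x t
  have h2 : (5 : ℝ) ≤ q := by exact_mod_cast hq
  linarith

lemma decimatedWeight_pos (hq : 5 ≤ q) (Λ : Finset EvenSite) (t : EvenSite → Fin q) :
    0 < decimatedWeight q Λ t :=
  Finset.prod_pos fun x _ => sub_numColors_pos hq x t

lemma goodWeight_decimated (hq : 5 ≤ q) : GoodWeight (decimatedWeight q) where
  nonneg Λ t := (decimatedWeight_pos hq Λ t).le
  pos Λ t := by
    have : NeZero q := ⟨by omega⟩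
    exact Finset.sum_pos (fun ζ _ => decimatedWeight_pos hq Λ _) Finset.univ_nonempty
  local_dep Λ := by
    refine ⟨(centers Λ).biUnion plaquette, fun t t' h => ?_⟩
    refine Finset.prod_congr rfl fun x hx => ?_
    rw [numColors_congr fun y hy => h y (Finset.mem_coe.2 (Finset.mem_biUnion.2 ⟨x, hx, hy⟩))]
  factor Λ Δ h := by
    have hsub : centers Λ ⊆ centers Δ := Finset.biUnion_subset_biUnion_of_subset_left _ h
    refine ⟨fun t => ∏ x ∈ centers Δ \ centers Λ, ((q : ℝ) - (numColors x t : ℝ)),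
      fun t => ?_, fun ζ t => ?_⟩
    · rw [mul_comm]
      exact (Finset.prod_sdiff hsub).symm
    · refine Finset.prod_congr rfl fun x hx => ?_
      rw [numColors_congr fun y hy => glue_of_notMem (fun hyΛ => ?_) ζ t]
      exact (Finset.mem_sdiff.1 hx).2 (mem_centers.2 ⟨y, hyΛ, nbrs_symm (mem_plaquette.1 hy)⟩)

/-- Greedy colouring: four neighbours never exhaust five colours. -/
lemma exists_proper (hq : 5 ≤ q) (Λ : Finset (ℤ × ℤ)) (ω : ℤ × ℤ → Fin q) :
    ∃ σ : ℤ × ℤ → Fin q, (∀ x, x ∉ Λ → ω x = σ x) ∧ ∀ x ∈ Λ, ∀ y ∈ nbrs x, σ x ≠ σ y := by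
  induction Λ using Finset.induction_on with
  | empty => exact ⟨ω, by simp, by simp⟩
  | insert x Λ hx ih =>
    obtain ⟨σ, h1, h2⟩ := ih
    obtain ⟨s, hs⟩ : ∃ s : Fin q, s ∉ (nbrs x).image σ := by
      by_contra! h
      have h3 : Finset.univ ⊆ (nbrs x).image σ := fun s _ => h s
      have h4 := (Finset.card_le_card h3).trans (Finset.card_image_le.trans (card_nbrs_le x))
      simp at h4
      omega
    have hs' : ∀ y ∈ nbrs x, s ≠ σ y := fun y hy h => hs (Finset.mem_image.2 ⟨y, hy, h.symm⟩)
    refine ⟨Function.update σ x s, fun z hz => ?_, fun z hz y hy => ?_⟩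
    · rw [Finset.mem_insert, not_or] at hz
      rw [Function.update_of_ne hz.1, h1 z hz.2]
    · by_cases hzx : z = x
      · subst hzx
        rw [Function.update_self, Function.update_of_ne (ne_of_mem_nbrs hy).symm]
        exact hs' y hy
      · rw [Function.update_of_ne hzx]
        by_cases hyx : y = x
        · subst hyx
          rw [Function.update_self]
          exact (hs' z (nbrs_symm hy)).symm
        · rw [Function.update_of_ne hyx]
          exact h2 z ((Finset.mem_insert.1 hz).resolve_left hzx) y hy

lemma goodWeight_potts (hq : 5 ≤ q) : GoodWeight (pottsWeight q) where
  nonneg Λ σ := by unfold pottsWeight; split_ifs <;> norm_num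
  pos Λ ω := by
    obtain ⟨σ, h1, h2⟩ := exists_proper hq Λ ω
    obtain ⟨ζ, hζ⟩ := exists_glue_eq h1
    refine Finset.sum_pos' (fun ζ _ => ?_) ⟨ζ, Finset.mem_univ _, ?_⟩
    · unfold pottsWeight; split_ifs <;> norm_num
    · rw [hζ, pottsWeight, if_pos h2]
      exact one_pos
  local_dep Λ := by
    refine ⟨Λ ∪ Λ.biUnion nbrs, fun σ σ' h => ?_⟩
    unfold pottsWeight
    refine if_congr (forall₂_congr fun x hx => forall₂_congr fun y hy => ?_) rfl rfl
    rw [h x (by simp [hx]), h y (Finset.mem_coe.2 (Finset.mem_union_right _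
      (Finset.mem_biUnion.2 ⟨x, hx, hy⟩)))]
  factor Λ Δ h := by
    classical
    -- The remaining factor collects the bonds that meet `Δ` and avoid `Λ`.
    refine ⟨fun σ => if ∀ x ∈ Δ \ Λ, ∀ y ∈ nbrs x, y ∉ Λ → σ x ≠ σ y then 1 else 0,
      fun σ => ?_, fun ζ σ => ?_⟩
    · unfold pottsWeight
      rw [ite_mul, one_mul, zero_mul, ← ite_and]
      refine if_congr ⟨fun hσ => ⟨fun x hx => hσ x (h hx), fun x hx y hy _ =>
        hσ x (Finset.mem_sdiff.1 hx).1 y hy⟩, fun ⟨h1, h2⟩ x hx y hy => ?_⟩ rfl rfl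
      by_cases hxΛ : x ∈ Λ
      · exact h1 x hxΛ y hy
      · by_cases hyΛ : y ∈ Λ
        · exact (h1 y hyΛ x (nbrs_symm hy)).symm
        · exact h2 x (Finset.mem_sdiff.2 ⟨hx, hxΛ⟩) y hy hyΛ
    · refine if_congr (forall₂_congr fun x hx => forall₂_congr fun y hy =>
        forall_congr' fun hyΛ => ?_) rfl rfl
      rw [glue_of_notMem (Finset.mem_sdiff.1 hx).2, glue_of_notMem hyΛ]

/-! ### Decimation -/

lemma sum_prod_plaquette (x : ℤ × ℤ) (t : EvenSite → Fin q) :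
    ∑ s : Fin q, ∏ y ∈ plaquette x, (1 - (if s = t y then (1 : ℝ) else 0)) =
      (q : ℝ) - (numColors x t : ℝ) := by
  have h1 : ∀ s : Fin q, ∏ y ∈ plaquette x, (1 - (if s = t y then (1 : ℝ) else 0)) =
      1 - if s ∈ (plaquette x).image t then 1 else 0 := by
    intro s
    by_cases hs : s ∈ (plaquette x).image t
    · obtain ⟨y, hy, hys⟩ := Finset.mem_image.1 hs
      rw [if_pos hs, Finset.prod_eq_zero hy (by rw [if_pos hys.symm, sub_self])]
      simp
    · rw [if_neg hs, Finset.prod_eq_one fun y hy => ?_]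
      · simp
      · rw [if_neg fun h => hs (Finset.mem_image.2 ⟨y, hy, h.symm⟩), sub_zero]
  simp only [h1, Finset.sum_sub_distrib]
  simp [numColors]

/-- The even sites of `Λ`, as sites of the square lattice. -/
def evenPart (Λ : Finset EvenSite) : Finset (ℤ × ℤ) := Λ.map (Function.Embedding.subtype _)

lemma mem_evenPart {Λ : Finset EvenSite} {x : ℤ × ℤ} :
    x ∈ evenPart Λ ↔ ∃ y ∈ Λ, y.1 = x := by
  simp [evenPart]

lemma val_mem_evenPart {Λ : Finset EvenSite} {y : EvenSite} : y.1 ∈ evenPart Λ ↔ y ∈ Λ := by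
  rw [mem_evenPart]
  exact ⟨fun ⟨z, hz, h⟩ => Subtype.ext h ▸ hz, fun h => ⟨y, h, rfl⟩⟩

lemma disjoint_evenPart_centers (Λ : Finset EvenSite) : Disjoint (evenPart Λ) (centers Λ) := by
  rw [Finset.disjoint_left]
  intro x hx hx'
  obtain ⟨y, -, rfl⟩ := mem_evenPart.1 hx
  exact not_even_of_mem_centers hx' y.2

/-- Every bond from an even site of `Λ` ends at a centre, so the bonds of the volume are those of
the centres. Two centres are never adjacent, so the constraint factorizes over them. -/
lemma pottsWeight_glue_centers (Λ : Finset EvenSite) (η : centers Λ → Fin q)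
    (τ : ℤ × ℤ → Fin q) :
    pottsWeight q (evenPart Λ ∪ centers Λ) (glue (centers Λ) η τ) =
      ∏ x : centers Λ, ∏ y ∈ plaquette x,
        (1 - (if η x = restrictEven τ y then (1 : ℝ) else 0)) := by
  have hev : ∀ y : EvenSite, glue (centers Λ) η τ y.1 = restrictEven τ y := fun y =>
    glue_of_notMem (fun h => not_even_of_mem_centers h y.2) η τ
  have key : (∀ x ∈ evenPart Λ ∪ centers Λ, ∀ y ∈ nbrs x,
      glue (centers Λ) η τ x ≠ glue (centers Λ) η τ y) ↔
      ∀ x : centers Λ, ∀ y ∈ plaquette x, η x ≠ restrictEven τ y := by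
    constructor
    · intro h x y hy
      have := h x (Finset.mem_union_right _ x.2) y.1 (mem_plaquette.1 hy)
      rwa [hev, glue_of_mem x.2] at this
    · intro h
      have h1 : ∀ x ∈ centers Λ, ∀ y ∈ nbrs x,
          glue (centers Λ) η τ x ≠ glue (centers Λ) η τ y := by
        intro x hx y hy
        have hye : Even (y.1 + y.2) := (even_iff_of_mem_nbrs hy).2 (not_even_of_mem_centers hx)
        have := h ⟨x, hx⟩ ⟨y, hye⟩ (mem_plaquette.2 hy)
        rwa [← hev, ← glue_of_mem hx η τ] at this
      intro x hx y hy
      rcases Finset.mem_union.1 hx with hx | hx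
      · obtain ⟨z, hz, rfl⟩ := mem_evenPart.1 hx
        exact (h1 y (mem_centers.2 ⟨z, hz, hy⟩) z.1 (nbrs_symm hy)).symm
      · exact h1 x hx y hy
  unfold pottsWeight
  by_cases h : ∀ x : centers Λ, ∀ y ∈ plaquette x, η x ≠ restrictEven τ y
  · rw [if_pos (key.2 h), Finset.prod_eq_one fun x _ => Finset.prod_eq_one fun y hy => ?_]
    rw [if_neg (h x y hy), sub_zero]
  · rw [if_neg (mt key.1 h)]
    push Not at h
    obtain ⟨x, y, hy, hxy⟩ := h
    refine (Finset.prod_eq_zero (Finset.mem_univ x) (Finset.prod_eq_zero hy ?_)).symm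
    rw [if_pos hxy, sub_self]

lemma sumOver_centers_pottsWeight (Λ : Finset EvenSite) (τ : ℤ × ℤ → Fin q) :
    sumOver (centers Λ) (pottsWeight q (evenPart Λ ∪ centers Λ)) τ =
      decimatedWeight q Λ (restrictEven τ) := by
  unfold sumOver decimatedWeight
  simp only [pottsWeight_glue_centers]
  rw [← Finset.prod_coe_sort]
  simp only [← sum_prod_plaquette]
  rw [Finset.prod_univ_sum, Fintype.piFinset_univ]

/-- Averaging over the removed spins around `Λ` turns the kernel of the Potts antiferromagnet into
the one of the decimated system. -/
lemma gibbsAvg_potts_eq (Λ : Finset EvenSite) {f : (ℤ × ℤ → Fin q) → ℝ}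
    (hf : ∀ (η : centers Λ → Fin q) σ, f (glue (centers Λ) η σ) = f σ) (σ : ℤ × ℤ → Fin q) :
    gibbsAvg (pottsWeight q) (evenPart Λ ∪ centers Λ) f σ =
      sumOver (evenPart Λ) (fun τ => decimatedWeight q Λ (restrictEven τ) * f τ) σ /
        sumOver (evenPart Λ) (fun τ => decimatedWeight q Λ (restrictEven τ)) σ := by
  unfold gibbsAvg
  rw [sumOver_union (disjoint_evenPart_centers Λ), sumOver_union (disjoint_evenPart_centers Λ)]
  have h1 : sumOver (centers Λ) (pottsWeight q (evenPart Λ ∪ centers Λ)) =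
      fun τ => decimatedWeight q Λ (restrictEven τ) :=
    funext fun τ => sumOver_centers_pottsWeight Λ τ
  have h2 : sumOver (centers Λ) (fun τ => pottsWeight q (evenPart Λ ∪ centers Λ) τ * f τ) =
      fun τ => decimatedWeight q Λ (restrictEven τ) * f τ := by
    funext τ
    rw [sumOver_mul_right hf, sumOver_centers_pottsWeight]
  rw [h1, h2]

lemma sumOver_evenPart (Λ : Finset EvenSite) (G : (EvenSite → Fin q) → ℝ) (σ : ℤ × ℤ → Fin q) :
    sumOver (evenPart Λ) (fun τ => G (restrictEven τ)) σ = sumOver Λ G (restrictEven σ) := by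
  unfold sumOver
  refine Fintype.sum_bijective (fun ζ : evenPart Λ → Fin q => fun i : Λ =>
    ζ ⟨i.1.1, val_mem_evenPart.2 i.2⟩) ⟨?_, ?_⟩ _ _ ?_
  · intro ζ ζ' h
    funext i
    obtain ⟨y, hy, hyi⟩ := mem_evenPart.1 i.2
    have := congrFun h ⟨y, hy⟩
    simp only at this
    convert this using 2 <;> exact Subtype.ext hyi.symm
  · intro ξ
    have hev : ∀ i : evenPart Λ, Even (i.1.1 + i.1.2) := fun i => by
      obtain ⟨y, -, hy⟩ := mem_evenPart.1 i.2
      rw [← hy]; exact y.2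
    exact ⟨fun i => ξ ⟨⟨i.1, hev i⟩, by
      have := i.2
      rwa [← val_mem_evenPart]⟩, rfl⟩
  · intro ζ
    refine congrArg G (funext fun y => ?_)
    by_cases hy : y ∈ Λ
    · simp [restrictEven, glue, hy, val_mem_evenPart]
    · simp [restrictEven, glue, hy, val_mem_evenPart]

lemma gibbsAvg_potts_restrictEven (Λ : Finset EvenSite) (g : (EvenSite → Fin q) → ℝ)
    (σ : ℤ × ℤ → Fin q) :
    gibbsAvg (pottsWeight q) (evenPart Λ ∪ centers Λ) (fun τ => g (restrictEven τ)) σ =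
      gibbsAvg (decimatedWeight q) Λ g (restrictEven σ) := by
  rw [gibbsAvg_potts_eq]
  · unfold gibbsAvg
    rw [← sumOver_evenPart Λ (fun t => decimatedWeight q Λ t * g t), ← sumOver_evenPart]
  · intro η σ
    congr 1
    funext y
    exact glue_of_notMem (fun h => not_even_of_mem_centers h y.2) η σ

lemma measurable_restrictEven : Measurable (restrictEven : (ℤ × ℤ → Fin q) → EvenSite → Fin q) :=
  measurable_pi_lambda _ fun y => measurable_pi_apply y.1

/-- Decimation maps Gibbs measures to Gibbs measures. -/
theorem isGibbsMeasure_map_restrictEven (hq : 5 ≤ q) {μ : Measure (ℤ × ℤ → Fin q)}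
    (hμ : IsGibbsMeasure (pottsSpec q) μ) :
    IsGibbsMeasure (decimatedSpec q) (μ.map restrictEven) := by
  have := hμ.1
  have hp : IsProbabilityMeasure (μ.map (restrictEven (q := q))) :=
    Measure.isProbabilityMeasure_map measurable_restrictEven.aemeasurable
  have hinv := (goodWeight_potts hq).invariant_of_isGibbsMeasure hμ
  refine (goodWeight_decimated hq).isGibbsMeasure_of_invariant fun Λ g hg ⟨C, hC⟩ => ?_
  rw [integral_map measurable_restrictEven.aemeasurable
      ((goodWeight_decimated hq).measurable_gibbsAvg hg Λ).aestronglyMeasurable,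
    integral_map measurable_restrictEven.aemeasurable hg.aestronglyMeasurable,
    ← hinv (evenPart Λ ∪ centers Λ) (fun τ => g (restrictEven τ))
      (hg.comp measurable_restrictEven) ⟨C, fun σ => hC _⟩]
  simp only [gibbsAvg_potts_restrictEven]

end Lattice

/-! ### Comparison of two finite probability distributions given by weights -/

section TotalVariation

variable {E : Type} [Fintype E] [DecidableEq E]

/-- The normalized weights satisfy `p'(A) - p(A) ≤ c` for all `A`. -/
def TVLe (w w' : E → ℝ) (c : ℝ) : Prop :=
  ∀ A : Finset E, (∑ s ∈ A, w' s) / (∑ s, w' s) - (∑ s ∈ A, w s) / (∑ s, w s) ≤ c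

lemma TVLe.mono {w w' : E → ℝ} {c d : ℝ} (h : TVLe w w' c) (hcd : c ≤ d) : TVLe w w' d :=
  fun A => (h A).trans hcd

lemma TVLe.trans {w w' w'' : E → ℝ} {c d : ℝ} (h : TVLe w w' c) (h' : TVLe w' w'' d) :
    TVLe w w'' (c + d) := fun A => by
  linarith [h A, h' A]

lemma TVLe.refl (w : E → ℝ) {c : ℝ} (hc : 0 ≤ c) : TVLe w w c := fun A => by
  rwa [sub_self]

/-- A loss on `A` is a gain on the complement of `A`. -/
lemma TVLe.symm {w w' : E → ℝ} {c : ℝ} (h : TVLe w w' c) (hw : 0 < ∑ s, w s)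
    (hw' : 0 < ∑ s, w' s) : TVLe w' w c := fun A => by
  have h1 := h Aᶜ
  have e1 : (∑ s ∈ Aᶜ, w s) / (∑ s, w s) = 1 - (∑ s ∈ A, w s) / (∑ s, w s) := by
    rw [eq_sub_iff_add_eq, ← add_div, Finset.sum_compl_add_sum, div_self hw.ne']
  have e2 : (∑ s ∈ Aᶜ, w' s) / (∑ s, w' s) = 1 - (∑ s ∈ A, w' s) / (∑ s, w' s) := by
    rw [eq_sub_iff_add_eq, ← add_div, Finset.sum_compl_add_sum, div_self hw'.ne']
  rw [e1, e2] at h1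
  linarith

/-- It suffices to consider the set on which the probability increases. -/
lemma tvLe_of_gain {w w' : E → ℝ} {c : ℝ} (G : Finset E)
    (hG : ∀ s ∈ G, w s / (∑ s, w s) ≤ w' s / (∑ s, w' s))
    (hG' : ∀ s, s ∉ G → w' s / (∑ s, w' s) ≤ w s / (∑ s, w s))
    (hc : (∑ s ∈ G, w' s) / (∑ s, w' s) - (∑ s ∈ G, w s) / (∑ s, w s) ≤ c) : TVLe w w' c := by
  intro A
  refine le_trans ?_ hc
  simp only [Finset.sum_div, ← Finset.sum_sub_distrib]
  rw [← Finset.sum_inter_add_sum_sdiff A G, ← Finset.sum_inter_add_sum_sdiff G A,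
    Finset.inter_comm]
  refine add_le_add le_rfl (le_trans (b := 0) ?_ ?_)
  · exact Finset.sum_nonpos fun s hs => sub_nonpos.2 (hG' s (Finset.mem_sdiff.1 hs).2)
  · exact Finset.sum_nonneg fun s hs => sub_nonneg.2 (hG s (Finset.mem_sdiff.1 hs).1)

/-- The sign of the gain at the remaining point is immaterial. -/
lemma tvLe_of_gain_singleton {w w' : E → ℝ} {c : ℝ} (γ : E) (hc0 : 0 ≤ c)
    (hG' : ∀ s, s ≠ γ → w' s / (∑ s, w' s) ≤ w s / (∑ s, w s))
    (hc : w' γ / (∑ s, w' s) - w γ / (∑ s, w s) ≤ c) : TVLe w w' c := by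
  by_cases h : w γ / (∑ s, w s) ≤ w' γ / (∑ s, w' s)
  · refine tvLe_of_gain {γ} (fun s hs => ?_) (fun s hs => hG' s ?_) ?_
    · rwa [Finset.mem_singleton.1 hs]
    · rwa [Finset.mem_singleton] at hs
    · simpa using hc
  · refine tvLe_of_gain ∅ (by simp) (fun s _ => ?_) (by simpa using hc0)
    by_cases hs : s = γ
    · rw [hs]; exact (not_le.1 h).le
    · exact hG' s hs

lemma sum_eq_add_add_sum_sdiff {α β : E} (h : α ≠ β) (w : E → ℝ) :
    ∑ s, w s = w α + w β + ∑ s ∈ Finset.univ \ {α, β}, w s := by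
  rw [← Finset.sum_pair h, add_comm, Finset.sum_sdiff (Finset.subset_univ _)]

/-- The probability lost at `α` when the factor `1 + Δ` moves to `β`; `M` is the weight of the other
colours. The bound is an equality for `a = b = F` and `M = m * F`. -/
lemma exchange_aux {a b F M m Δ : ℝ} (ha : 0 < a) (hb : 0 < b) (hΔ : 0 ≤ Δ)
    (haF : a ≤ F) (hm : 0 ≤ m) (hM : m * F ≤ M) :
    a * (1 + Δ) / (a * (1 + Δ) + b + M) - a / (a + b * (1 + Δ) + M) ≤ Δ / (m + 2 + Δ) := by
  have hM0 : 0 ≤ M := le_trans (mul_nonneg hm (ha.le.trans haF)) hM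
  have hZ : 0 < a * (1 + Δ) + b + M := by positivity
  have hZ' : 0 < a + b * (1 + Δ) + M := by positivity
  have hma : m * a ≤ M := (mul_le_mul_of_nonneg_left haF hm).trans hM
  calc a * (1 + Δ) / (a * (1 + Δ) + b + M) - a / (a + b * (1 + Δ) + M)
      = a * Δ * (b * (2 + Δ) + M) / ((a * (1 + Δ) + b + M) * (a + b * (1 + Δ) + M)) := by
        field_simp; ring
    _ ≤ a * Δ * (b * (2 + Δ) + M) / ((a * (2 + Δ) + M) * (b * (2 + Δ) + M)) := by
        refine div_le_div_of_nonneg_left (by positivity) (by positivity) ?_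
        -- The two denominators differ by exactly `(1 + Δ) * (a - b) ^ 2`.
        nlinarith [mul_nonneg (sq_nonneg (a - b)) (by linarith : (0:ℝ) ≤ 1 + Δ)]
    _ = a * Δ / (a * (2 + Δ) + M) := by
        rw [mul_div_mul_right _ _ (by positivity)]
    _ ≤ Δ / (m + 2 + Δ) := by
        rw [div_le_div_iff₀ (by positivity) (by positivity)]
        nlinarith [mul_le_mul_of_nonneg_left hma hΔ]

/-- The case `b ≤ a` of `tvLe_exchange`; the other case follows by interchanging the two colours and
the two laws. -/
lemma exchange_half {w w' : E → ℝ} {α β : E} (hαβ : α ≠ β) {a b F Δ m : ℝ} (ha : 0 < a)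
    (hb : 0 < b) (hΔ : 0 ≤ Δ) (haF : a ≤ F) (hm : 0 ≤ m)
    (hw0 : ∀ s, 0 ≤ w s)
    (hwα : w α = a * (1 + Δ)) (hwβ : w β = b) (hwα' : w' α = a) (hwβ' : w' β = b * (1 + Δ))
    (h : ∀ s, s ≠ α → s ≠ β → w' s = w s)
    (hM : m * F ≤ ∑ s ∈ Finset.univ \ {α, β}, w s) (hba : b ≤ a) :
    TVLe w w' (Δ / (m + 2 + Δ)) := by
  have hS' : ∑ s ∈ Finset.univ \ {α, β}, w' s = ∑ s ∈ Finset.univ \ {α, β}, w s :=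
    Finset.sum_congr rfl fun s hs => h s (by simp at hs; tauto) (by simp at hs; tauto)
  have hM0 : 0 ≤ ∑ s ∈ Finset.univ \ {α, β}, w s := Finset.sum_nonneg fun s _ => hw0 s
  have hZ := sum_eq_add_add_sum_sdiff hαβ w
  have hZ' := sum_eq_add_add_sum_sdiff hαβ w'
  rw [hS', hwα', hwβ'] at hZ'
  rw [hwα, hwβ] at hZ
  set M := ∑ s ∈ Finset.univ \ {α, β}, w s
  have hZ'Z : ∑ s, w' s ≤ ∑ s, w s := by
    rw [hZ, hZ']; nlinarith
  have hZ'0 : 0 < ∑ s, w' s := by rw [hZ']; positivity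
  -- For `b ≤ a` the total weight does not grow, so `α` is the only colour whose probability can
  -- decrease from `w` to `w'`.
  refine TVLe.symm ?_ hZ'0 (hZ'0.trans_le hZ'Z)
  refine tvLe_of_gain_singleton α (by positivity) (fun s hs => ?_) ?_
  · have : w s ≤ w' s := by
      by_cases hsβ : s = β
      · rw [hsβ, hwβ, hwβ']; nlinarith
      · rw [h s hs hsβ]
    exact div_le_div₀ ((hw0 s).trans this) this hZ'0 hZ'Z
  · rw [hZ, hZ', hwα, hwα']
    exact exchange_aux ha hb hΔ haF hm hM

/-- A factor `1 + Δ` is moved from `α` to `β`. -/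
lemma tvLe_exchange {w w' : E → ℝ} {α β : E} (hαβ : α ≠ β) {a b F Δ m : ℝ} (ha : 0 < a)
    (hb : 0 < b) (hΔ : 0 ≤ Δ) (haF : a ≤ F) (hbF : b ≤ F) (hm : 0 ≤ m) (hw0 : ∀ s, 0 ≤ w s)
    (hwα : w α = a * (1 + Δ)) (hwβ : w β = b) (hwα' : w' α = a) (hwβ' : w' β = b * (1 + Δ))
    (h : ∀ s, s ≠ α → s ≠ β → w' s = w s)
    (hM : m * F ≤ ∑ s ∈ Finset.univ \ {α, β}, w s) :
    TVLe w w' (Δ / (m + 2 + Δ)) := by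
  rcases le_total b a with hba | hab
  · exact exchange_half hαβ ha hb hΔ haF hm hw0 hwα hwβ hwα' hwβ' h hM hba
  · have hw0' : ∀ s, 0 ≤ w' s := fun s => by
      by_cases hsα : s = α
      · rw [hsα, hwα']; exact ha.le
      by_cases hsβ : s = β
      · rw [hsβ, hwβ']; positivity
      · rw [h s hsα hsβ]; exact hw0 s
    have hM' : m * F ≤ ∑ s ∈ Finset.univ \ {β, α}, w' s := by
      rw [Finset.pair_comm]
      refine hM.trans_eq (Finset.sum_congr rfl fun s hs => (h s ?_ ?_).symm) <;>
        · simp at hs; tauto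
    refine (exchange_half hαβ.symm hb ha hΔ hbF hm hw0' hwβ' hwα' hwβ hwα
      (fun s h1 h2 => (h s h2 h1).symm) hM' hab).symm ?_ ?_
    · exact Finset.sum_pos' (fun s _ => hw0' s) ⟨α, Finset.mem_univ _, by rw [hwα']; exact ha⟩
    · exact Finset.sum_pos' (fun s _ => hw0 s) ⟨β, Finset.mem_univ _, by rw [hwβ]; exact hb⟩

/-- `S` is the probability of a set on which the weight grows, and `1 + y * t` is the factor by
which the total weight grows. -/
lemma step_loss_le {y t S : ℝ} (hy : 0 < y) (ht : 0 ≤ t) (hS : t ≤ S) :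
    (S + y * t) / (1 + y * t) - S ≤ t * (1 - t) / (1 / y + t) := by
  have h1 : 0 < 1 + y * t := by positivity
  calc (S + y * t) / (1 + y * t) - S = y * t * (1 - S) / (1 + y * t) := by
        field_simp; ring
    _ ≤ y * t * (1 - t) / (1 + y * t) := by gcongr
    _ = t * (1 - t) / (1 / y + t) := by field_simp

/-- Adding the point `β` to the set `D` on which the weight is enhanced. -/
lemma exists_tvLe_insert {g : E → ℝ} (hg : ∀ s, 0 < g s) {D : Finset E} {β : E} (hβ : β ∉ D)
    {x y N : ℝ} (hx : 0 ≤ x) (hy : 0 < y) (hN : 1 ≤ N) (hxy : 1 + y = (1 + y / N) * (1 + x)) :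
    ∃ t, 0 ≤ t ∧ t ≤ 1 ∧
      t ≤ max (g β / ∑ s, g s * (1 + if s ∈ D then x else 0)) (1 / N) ∧
      TVLe (fun s => g s * (1 + if s ∈ D then x else 0))
        (fun s => g s * (1 + if s ∈ insert β D then y else 0)) (t * (1 - t) / (1 / y + t)) := by
  set w : E → ℝ := fun s => g s * (1 + if s ∈ D then x else 0) with hw
  set w' : E → ℝ := fun s => g s * (1 + if s ∈ insert β D then y else 0) with hw'
  have hw0 : ∀ s, 0 < w s := fun s => mul_pos (hg s) (by split_ifs <;> linarith)
  have hw0' : ∀ s, 0 < w' s := fun s => mul_pos (hg s) (by split_ifs <;> linarith)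
  have hN0 : 0 < N := by linarith
  have hwβ : w β = g β := by simp [hw, hβ]
  have hwβ' : w' β = (1 + y) * w β := by simp [hw, hw', hβ, mul_comm]
  have hwD' : ∀ s ∈ D, w' s = (1 + y / N) * w s := fun s hs => by
    simp [hw, hw', hs, hxy]; ring
  have hwO' : ∀ s, s ∉ insert β D → w' s = w s := fun s hs => by
    have : s ∉ D := fun h => hs (Finset.mem_insert_of_mem h)
    simp only [hw, hw', if_neg hs, if_neg this]
  have hZ : 0 < ∑ s, w s := Finset.sum_pos (fun s _ => hw0 s) ⟨β, Finset.mem_univ _⟩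
  have hZ' : 0 < ∑ s, w' s := Finset.sum_pos (fun s _ => hw0' s) ⟨β, Finset.mem_univ _⟩
  set Z := ∑ s, w s
  set Z' := ∑ s, w' s
  set P := w β / Z with hP
  set Y := (∑ s ∈ D, w s) / Z with hY
  have hP0 : 0 < P := div_pos (hw0 β) hZ
  have hY0 : 0 ≤ Y := div_nonneg (Finset.sum_nonneg fun s _ => (hw0 s).le) hZ.le
  have hins : ∑ s ∈ insert β D, w s = (P + Y) * Z := by
    rw [Finset.sum_insert hβ, hP, hY]; field_simp
  have hins' : ∑ s ∈ insert β D, w' s = ((1 + y) * P + (1 + y / N) * Y) * Z := by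
    rw [Finset.sum_insert hβ, hwβ', Finset.sum_congr rfl hwD', ← Finset.mul_sum, hP, hY]
    field_simp
  have hsplit : ∑ s ∈ insert β D, w s + ∑ s ∈ (insert β D)ᶜ, w s = Z :=
    Finset.sum_add_sum_compl _ _
  have hsplit' : ∑ s ∈ insert β D, w' s + ∑ s ∈ (insert β D)ᶜ, w' s = Z' :=
    Finset.sum_add_sum_compl _ _
  have hcompl : ∑ s ∈ (insert β D)ᶜ, w' s = ∑ s ∈ (insert β D)ᶜ, w s :=
    Finset.sum_congr rfl fun s hs => hwO' s (Finset.mem_compl.1 hs)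
  have hPY : P + Y ≤ 1 := by
    have : 0 ≤ ∑ s ∈ (insert β D)ᶜ, w s := Finset.sum_nonneg fun s _ => (hw0 s).le
    rw [hins] at hsplit
    by_contra hcon
    nlinarith
  have hYN : Y / N ≤ Y := div_le_self hY0 hN
  have hZ'Z : Z' = (1 + y * (P + Y / N)) * Z := by
    rw [← hsplit', hins', hcompl]
    rw [hins] at hsplit
    have : ∑ s ∈ (insert β D)ᶜ, w s = Z - (P + Y) * Z := by linarith
    rw [this]; ring
  have hYN0 : 0 ≤ Y / N := by positivity
  have hZZ' : Z ≤ Z' := by rw [hZ'Z]; nlinarith [mul_nonneg hy.le (add_nonneg hP0.le hYN0)]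
  have hgβ : g β / Z = P := by rw [← hwβ]
  rw [hgβ]
  -- The total grows by `1 + y * (P + Y / N)`, the weight on `D` by `1 + y / N`, the weight of `β`
  -- by `1 + y`. Hence either `D` does not gain and `t` is the probability of `β`, or all of `insert
  -- β D` gains and `t = P + Y / N` is below `1 / N`.
  by_cases hθ : 1 / N ≤ P + Y / N
  · refine ⟨P, hP0.le, by linarith, le_max_left _ _, ?_⟩
    refine tvLe_of_gain_singleton β (by
      have : 0 ≤ 1 - P := by linarith
      positivity) (fun s hs => ?_) ?_
    · change w' s / Z' ≤ w s / Z
      rw [div_le_div_iff₀ hZ' hZ, hZ'Z]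
      by_cases hsD : s ∈ D
      · rw [hwD' s hsD]
        have : y / N ≤ y * (P + Y / N) := by
          rw [div_eq_mul_one_div]; exact mul_le_mul_of_nonneg_left hθ hy.le
        have := mul_nonneg (sub_nonneg.2 this) (mul_nonneg (hw0 s).le hZ.le)
        nlinarith
      · rw [hwO' s (by simp [hs, hsD])]
        have := mul_nonneg (mul_nonneg hy.le (add_nonneg hP0.le hYN0)) (mul_nonneg (hw0 s).le hZ.le)
        nlinarith
    · change w' β / Z' - w β / Z ≤ _
      have e1 : w' β / Z' = (1 + y) * P / (1 + y * (P + Y / N)) := by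
        rw [hwβ', hZ'Z, hP]; field_simp
      rw [e1, ← hP]
      calc (1 + y) * P / (1 + y * (P + Y / N)) - P ≤ (1 + y) * P / (1 + y * P) - P := by
            gcongr; linarith
        _ = P * (1 - P) / (1 / y + P) := by field_simp; ring
  · rw [not_le] at hθ
    have ht1 : P + Y / N ≤ 1 := by linarith
    refine ⟨P + Y / N, by positivity, ht1, hθ.le.trans (le_max_right _ _), ?_⟩
    refine tvLe_of_gain (insert β D) (fun s hs => ?_) (fun s hs => ?_) ?_
    · change w s / Z ≤ w' s / Z'
      rw [div_le_div_iff₀ hZ hZ', hZ'Z]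
      have hkey : y * (P + Y / N) ≤ y / N := by
        rw [div_eq_mul_one_div y N]; exact mul_le_mul_of_nonneg_left hθ.le hy.le
      have hws := mul_pos (hw0 s) hZ
      rcases Finset.mem_insert.1 hs with rfl | hsD
      · rw [hwβ']
        have : y * (P + Y / N) ≤ y := hkey.trans (div_le_self hy.le hN)
        nlinarith
      · rw [hwD' s hsD]
        nlinarith
    · change w' s / Z' ≤ w s / Z
      rw [hwO' s hs]
      exact div_le_div_of_nonneg_left (hw0 s).le hZ hZZ'
    · change (∑ s ∈ insert β D, w' s) / Z' - (∑ s ∈ insert β D, w s) / Z ≤ _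
      rw [hins, hins', hZ'Z, mul_div_mul_right _ _ hZ.ne', mul_div_cancel_right₀ _ hZ.ne']
      obtain ⟨t, ht⟩ : ∃ t, t = P + Y / N := ⟨_, rfl⟩
      rw [← ht]
      have ht0 : 0 ≤ t := by rw [ht]; positivity
      have e : (1 + y) * P + (1 + y / N) * Y = P + Y + y * t := by rw [ht]; ring
      rw [e]
      exact step_loss_le hy ht0 (ht.trans_le (add_le_add le_rfl hYN))

end TotalVariation

/-! ### The values of the coefficients and some rational inequalities -/

section Values

/-- The relative enhancement of the plaquette weight at the `n` colours that occur already. -/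
def exc (Q : ℝ) (n : ℕ) : ℝ := 1 / (Q - 1 - n)

/-- The Dobrushin coefficient of nearest neighbours. -/
def nnCoeff (Q : ℝ) : ℝ :=
  if Q = 5 then 3 / 8 else
    (Q - 3) ^ 2 * (2 * Q - 7) /
      (Q ^ 5 - 16 * Q ^ 4 + 108 * Q ^ 3 - 391 * Q ^ 2 + 764 * Q - 639)

/-- The Dobrushin coefficient of next-to-nearest neighbours. -/
def nnnCoeff (Q : ℝ) : ℝ :=
  (Q - 3) ^ 3 / (Q ^ 5 - 16 * Q ^ 4 + 108 * Q ^ 3 - 389 * Q ^ 2 + 749 * Q - 611)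

/-- In the variable `m = q - 6 ≥ 0` all coefficients are positive. The inequalities below are
treated in the same way: after clearing denominators they say that a polynomial in `m` with
nonnegative coefficients is nonnegative. -/
lemma nnCoeff_add_six {m : ℝ} (hm : 0 ≤ m) : nnCoeff (m + 6) =
    (m + 3) ^ 2 * (2 * m + 5) / (m ^ 5 + 14 * m ^ 4 + 84 * m ^ 3 + 257 * m ^ 2 + 392 * m + 237) := by
  rw [nnCoeff, if_neg (by linarith)]
  congr 1 <;> ring

lemma nnCoeff_five : nnCoeff 5 = 3 / 8 := if_pos rfl

lemma nnnCoeff_add_five (m : ℝ) : nnnCoeff (m + 5) =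
    (m + 2) ^ 3 / (m ^ 5 + 9 * m ^ 4 + 38 * m ^ 3 + 81 * m ^ 2 + 84 * m + 34) := by
  rw [nnnCoeff]
  congr 1 <;> ring

lemma exists_eq_add_six {q : ℕ} (hq : 6 ≤ q) : ∃ m : ℝ, 0 ≤ m ∧ (q : ℝ) = m + 6 :=
  ⟨q - 6, by have : (6:ℝ) ≤ q := by exact_mod_cast hq
             linarith, by ring⟩

lemma exists_eq_add_five {q : ℕ} (hq : 5 ≤ q) : ∃ m : ℝ, 0 ≤ m ∧ (q : ℝ) = m + 5 :=
  ⟨q - 5, by have : (5:ℝ) ≤ q := by exact_mod_cast hq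
             linarith, by ring⟩

lemma exc_add_six (m : ℝ) :
    exc (m + 6) 1 = 1 / (m + 4) ∧ exc (m + 6) 2 = 1 / (m + 3) ∧ exc (m + 6) 3 = 1 / (m + 2) := by
  unfold exc
  refine ⟨?_, ?_, ?_⟩ <;> · congr 1; push_cast; ring

lemma exc_add_five (m : ℝ) :
    exc (m + 5) 1 = 1 / (m + 3) ∧ exc (m + 5) 2 = 1 / (m + 2) ∧ exc (m + 5) 3 = 1 / (m + 1) := by
  unfold exc
  refine ⟨?_, ?_, ?_⟩ <;> · congr 1; push_cast; ring

lemma exc_pos {q : ℕ} (hq : 5 ≤ q) {n : ℕ} (hn : n ≤ 3) : 0 < exc q n := by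
  have h1 : (5:ℝ) ≤ q := by exact_mod_cast hq
  have h2 : (n:ℝ) ≤ 3 := by exact_mod_cast hn
  exact one_div_pos.2 (by linarith)

lemma exc_le_exc {q : ℕ} (hq : 5 ≤ q) {n k : ℕ} (hnk : n ≤ k) (hk : k ≤ 3) :
    exc q n ≤ exc q k := by
  have h1 : (5:ℝ) ≤ q := by exact_mod_cast hq
  have h2 : (k:ℝ) ≤ 3 := by exact_mod_cast hk
  have h3 : (n:ℝ) ≤ k := by exact_mod_cast hnk
  exact one_div_le_one_div_of_le (by linarith) (by linarith)

/-- `(Q - 1 + 4 x + n₁ x₁ + n₂ x₂) / (1 + x)²` -/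
def excRatio (Q : ℝ) (n₁ n₂ : ℕ) : ℝ :=
  (Q - 1 + 4 * exc Q 3 + n₁ * exc Q (n₁ + 1) + n₂ * exc Q (n₂ + 1)) / (1 + exc Q 3) ^ 2

/-- Hypothesis `h1` of `gain_le` in the mixed case: `n₁` and `n₂` are the sizes of `D₁` and `D₂`,
`κ` is `excRatio`, `v` is the enhancement acquired by `β`, and `ξ` is the relative loss of `α`. -/
lemma mixed_gain_le {q : ℕ} (hq : 5 ≤ q) {n₁ n₂ : ℕ} (h1 : n₁ = 1 ∨ n₁ = 2)
    (h2 : n₂ = 1 ∨ n₂ = 2) :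
    excRatio q n₁ n₂ * ((1 + exc q (n₁ + 1)) * (1 + exc q (n₂ + 1)) - 1) +
      ((1 + exc q (n₁ + 1)) * (1 + exc q (n₂ + 1))) *
        ((1 + exc q (n₁ + 1)) * (1 + exc q n₂) - (1 + exc q (n₂ + 1))) ≤
    nnCoeff q * ((excRatio q n₁ n₂ + (1 + exc q (n₁ + 1)) * (1 + exc q (n₂ + 1))) *
      (excRatio q n₁ n₂ + 1 + ((1 + exc q (n₁ + 1)) * (1 + exc q n₂) - (1 + exc q (n₂ + 1))))) := by
  rcases hq.eq_or_lt with rfl | hq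
  · rcases h1 with rfl | rfl <;> rcases h2 with rfl | rfl <;>
      norm_num [nnCoeff, excRatio, exc]
  · obtain ⟨m, hm, hQ⟩ := exists_eq_add_six hq
    rw [hQ, nnCoeff_add_six hm]
    rcases h1 with rfl | rfl <;> rcases h2 with rfl | rfl <;>
    · simp only [excRatio, exc_add_six, Nat.reduceAdd]
      push_cast
      field_simp
      rw [← sub_nonneg]
      ring_nf
      positivity

/-- Hypothesis `h2` of `gain_le`, which carries `mixed_gain_le` over to larger weights of the other
colours. -/
lemma mixed_gain_mono {q : ℕ} (hq : 5 ≤ q) {n₁ n₂ : ℕ} (h1 : n₁ = 1 ∨ n₁ = 2)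
    (h2 : n₂ = 1 ∨ n₂ = 2) :
    (1 + exc q (n₁ + 1)) * (1 + exc q (n₂ + 1)) - 1 ≤
    nnCoeff q * (2 * excRatio q n₁ n₂ + 1 + (1 + exc q (n₁ + 1)) * (1 + exc q (n₂ + 1)) +
      ((1 + exc q (n₁ + 1)) * (1 + exc q n₂) - (1 + exc q (n₂ + 1)))) := by
  rcases hq.eq_or_lt with rfl | hq
  · rcases h1 with rfl | rfl <;> rcases h2 with rfl | rfl <;>
      norm_num [nnCoeff, excRatio, exc]
  · obtain ⟨m, hm, hQ⟩ := exists_eq_add_six hq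
    rw [hQ, nnCoeff_add_six hm]
    rcases h1 with rfl | rfl <;> rcases h2 with rfl | rfl <;>
    · simp only [excRatio, exc_add_six, Nat.reduceAdd]
      push_cast
      field_simp
      rw [← sub_nonneg]
      ring_nf
      positivity

/-- Hypothesis `hvκ` of `gain_le`. -/
lemma le_excRatio_sq {q : ℕ} (hq : 5 ≤ q) {n₁ n₂ : ℕ} (h1 : n₁ = 1 ∨ n₁ = 2)
    (h2 : n₂ = 1 ∨ n₂ = 2) :
    (1 + exc q (n₁ + 1)) * (1 + exc q (n₂ + 1)) ≤ excRatio q n₁ n₂ ^ 2 := by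
  obtain ⟨m, hm, hQ⟩ := exists_eq_add_five hq
  rw [hQ]
  rcases h1 with rfl | rfl <;> rcases h2 with rfl | rfl <;>
  · simp only [excRatio, exc_add_five, Nat.reduceAdd]
    push_cast
    field_simp
    rw [← sub_nonneg]
    ring_nf
    positivity

/-- Used when the total weight does not grow and `α` alone loses: the left side is its loss, and the
bracket on the right bounds the total weight from below, both divided by the factor of `α` from the
two unaffected plaquettes. -/
lemma mixed_loss_le {q : ℕ} (hq : 5 ≤ q) {n₁ n₂ : ℕ} (h1 : n₁ = 1 ∨ n₁ = 2)
    (h2 : n₂ = 1 ∨ n₂ = 2) :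
    (1 + exc q (n₁ + 1)) * (1 + exc q n₂) - (1 + exc q (n₂ + 1)) ≤
    nnCoeff q * ((1 + exc q (n₁ + 1)) * (1 + exc q n₂) +
      (q - 1 + 4 * exc q 3) / (1 + exc q 3) ^ 2) := by
  rcases hq.eq_or_lt with rfl | hq
  · rcases h1 with rfl | rfl <;> rcases h2 with rfl | rfl <;>
      norm_num [nnCoeff, exc]
  · obtain ⟨m, hm, hQ⟩ := exists_eq_add_six hq
    rw [hQ, nnCoeff_add_six hm]
    rcases h1 with rfl | rfl <;> rcases h2 with rfl | rfl <;>
    · simp only [exc_add_six, Nat.reduceAdd]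
      field_simp
      rw [← sub_nonneg]
      ring_nf
      positivity

/-- The last hypothesis of `double_gain_le`, when the second plaquette has two other colours; `exc q
1 * exc q 3` plays the part of `ε` there. -/
lemma mixed_double_gain_le {q : ℕ} (hq : 5 ≤ q) {n₁ : ℕ} (h1 : n₁ = 1 ∨ n₁ = 2) :
    (1 + exc q 3) ^ 2 * (((1 + exc q (n₁ + 1)) * (1 + exc q 2) - (1 + exc q 3)) -
      ((1 + exc q 1 * exc q 3) * nnCoeff q - exc q 1 * exc q 3) *
        ((1 + exc q (n₁ + 1)) * (1 + exc q 2) +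
          (q - 1 + 4 * exc q 3 + n₁ * exc q (n₁ + 1) + exc q 2) / (1 + exc q 3) ^ 2)) ≤
    2 * (exc q 1 * exc q 3) := by
  rcases hq.eq_or_lt with rfl | hq
  · rcases h1 with rfl | rfl <;> norm_num [nnCoeff, exc]
  · obtain ⟨m, hm, hQ⟩ := exists_eq_add_six hq
    rw [hQ, nnCoeff_add_six hm]
    rcases h1 with rfl | rfl <;>
    · simp only [exc_add_six, Nat.reduceAdd]
      push_cast
      rw [← sub_nonneg]
      field_simp
      ring_nf
      positivity

/-- Only one plaquette changes here, and counting each of the other `q - 2` colours with weight one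
is enough. -/
lemma exchange_one_le {q : ℕ} (hq : 5 ≤ q) :
    exc q 3 / ((q - 2) / (1 + exc q 3) ^ 3 + 2 + exc q 3) ≤ nnCoeff q := by
  rcases hq.eq_or_lt with rfl | hq
  · norm_num [nnCoeff, exc]
  · obtain ⟨m, hm, hQ⟩ := exists_eq_add_six hq
    rw [hQ, nnCoeff_add_six hm, (exc_add_six m).2.2]
    have : m + 6 - 2 = m + 4 := by ring
    rw [this]
    field_simp
    rw [← sub_nonneg]
    ring_nf
    positivity

/-- The exchange bound for two plaquettes, with equality for `n₁ = n₂ = 2` and `ε = 0` when `q ≥ 6`.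
At `q = 5` the extremal case would exceed `3 / 8` without the extra weight `ε ≥ 1`. -/
lemma exchange_two_le {q : ℕ} (hq : 5 ≤ q) {n₁ n₂ : ℕ} (h1 : n₁ = 1 ∨ n₁ = 2)
    (h2 : n₂ = 1 ∨ n₂ = 2) {ε : ℝ} (hε : 0 ≤ ε)
    (hε5 : q = 5 → n₁ = 2 → n₂ = 2 → 1 ≤ ε) :
    ((1 + exc q (n₁ + 1)) * (1 + exc q (n₂ + 1)) - 1) /
      ((q - 2 + n₁ * exc q (n₁ + 1) + n₂ * exc q (n₂ + 1) + exc q 3 * (1 + exc q (n₁ + 1)) +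
        exc q 3 * (1 + exc q (n₂ + 1)) + ε) / (1 + exc q 3) ^ 2 + 2 +
          ((1 + exc q (n₁ + 1)) * (1 + exc q (n₂ + 1)) - 1)) ≤ nnCoeff q := by
  have key : ((1 + exc q (n₁ + 1)) * (1 + exc q (n₂ + 1)) - 1) /
      ((q - 2 + n₁ * exc q (n₁ + 1) + n₂ * exc q (n₂ + 1) + exc q 3 * (1 + exc q (n₁ + 1)) +
        exc q 3 * (1 + exc q (n₂ + 1)) + if q = 5 ∧ n₁ = 2 ∧ n₂ = 2 then 1 else 0) /
          (1 + exc q 3) ^ 2 + 2 +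
          ((1 + exc q (n₁ + 1)) * (1 + exc q (n₂ + 1)) - 1)) ≤ nnCoeff q := by
    rcases hq.eq_or_lt with rfl | hq
    · rcases h1 with rfl | rfl <;> rcases h2 with rfl | rfl <;>
        norm_num [nnCoeff, exc]
    · rw [if_neg (by omega)]
      obtain ⟨m, hm, hQ⟩ := exists_eq_add_six hq
      rw [hQ, nnCoeff_add_six hm]
      have : m + 6 - 2 = m + 4 := by ring
      rw [this]
      rcases h1 with rfl | rfl <;> rcases h2 with rfl | rfl <;>
      · simp only [exc_add_six, Nat.reduceAdd]
        push_cast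
        have h0 : ∀ k : ℝ, 0 ≤ k → 0 ≤ (1 + 1 / (m + 3)) * (1 + k) - 1 := fun k hk => by
          have : 0 ≤ 1 / (m + 3) := by positivity
          nlinarith
        rw [div_le_div_iff₀ _ (by positivity)]
        · field_simp
          rw [← sub_nonneg]
          ring_nf
          positivity
        · field_simp
          ring_nf
          positivity
  have hx1 : 0 < exc q (n₁ + 1) := exc_pos hq (by omega)
  have hx2 : 0 < exc q (n₂ + 1) := exc_pos hq (by omega)
  have hx : 0 < exc q 3 := exc_pos hq le_rfl
  have hq' : (5:ℝ) ≤ q := by exact_mod_cast hq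
  have hQ : 0 ≤ (q:ℝ) - 2 := by linarith
  have hD : 0 ≤ (1 + exc q (n₁ + 1)) * (1 + exc q (n₂ + 1)) - 1 := by nlinarith
  refine le_trans (div_le_div_of_nonneg_left hD ?_ ?_) key
  · split_ifs <;> positivity
  · gcongr
    split_ifs with h
    · exact hε5 h.1 h.2.1 h.2.2
    · exact hε

/-- The exchange bound for one plaquette, with equality for `n = 2`. -/
lemma exchange_diagonal_le {q : ℕ} (hq : 5 ≤ q) {n : ℕ} (hn : n = 1 ∨ n = 2) :
    exc q (n + 1) / ((q - 2 + n * exc q (n + 1) + 2 * exc q 3 * (1 + exc q (n + 1)) + exc q 3) /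
      (1 + exc q 3) ^ 3 + 2 + exc q (n + 1)) ≤ nnnCoeff q := by
  obtain ⟨m, hm, hQ⟩ := exists_eq_add_five hq
  rw [hQ, nnnCoeff_add_five]
  have : m + 5 - 2 = m + 3 := by ring
  rw [this]
  rcases hn with rfl | rfl <;>
  · simp only [exc_add_five, Nat.reduceAdd]
    push_cast
    field_simp
    rw [← sub_nonneg]
    ring_nf
    positivity

/-- The largest probability of the colour added to a single plaquette. -/
def stepProb (Q : ℝ) : ℝ := (1 + exc Q 3) ^ 3 / ((1 + exc Q 3) ^ 3 + Q - 1 + 6 * exc Q 3)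

/-- The effect of adding or removing a colour of a single plaquette. -/
def stepBound (Q : ℝ) : ℝ :=
  if Q = 5 then 3 / 16 else stepProb Q * (1 - stepProb Q) / (Q - 4 + stepProb Q)

/-- Covers the alternative `1 / N` in `exists_tvLe_insert`, where `N = q - |D|` is at least `q - 2`.
-/
lemma exc_one_le_stepProb {q : ℕ} (hq : 5 ≤ q) : exc q 1 ≤ stepProb q := by
  obtain ⟨m, hm, hQ⟩ := exists_eq_add_five hq
  rw [hQ]
  simp only [stepProb, exc_add_five]
  have : (1 + 1 / (m + 1)) ^ 3 + (m + 5) - 1 + 6 * (1 / (m + 1)) =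
    (1 + 1 / (m + 1)) ^ 3 + (m + 4) + 6 * (1 / (m + 1)) := by ring
  rw [this]
  field_simp
  rw [← sub_nonneg]
  ring_nf
  positivity

lemma stepProb_add_six {m : ℝ} (hm : 0 ≤ m) : stepProb (m + 6) =
    (m + 3) ^ 3 / (m ^ 4 + 12 * m ^ 3 + 57 * m ^ 2 + 119 * m + 91) := by
  simp only [stepProb, exc_add_six]
  have : (1 + 1 / (m + 2)) ^ 3 + (m + 6) - 1 + 6 * (1 / (m + 2)) =
    (1 + 1 / (m + 2)) ^ 3 + (m + 5) + 6 * (1 / (m + 2)) := by ring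
  rw [this]
  field_simp
  ring

/-- For `q ≥ 6` the function of `t` increases up to `stepProb`. For `q = 5` it does not, but its
maximum `3 - 2√2` is below `3 / 16`, which is half of the coefficient `3 / 8`. -/
lemma step_le_stepBound {q : ℕ} (hq : 5 ≤ q) {t : ℝ} (ht0 : 0 ≤ t) (ht : t ≤ stepProb q) :
    t * (1 - t) / (q - 4 + t) ≤ stepBound q := by
  rcases hq.eq_or_lt with rfl | hq
  · rw [stepBound, if_pos (by norm_num)]
    push_cast
    rw [div_le_div_iff₀ (by linarith) (by norm_num)]
    -- The vertex of `16 * t ^ 2 - 13 * t + 3`, whose discriminant is negative.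
    nlinarith [sq_nonneg (t - 13 / 32)]
  · obtain ⟨m, hm, hQ⟩ := exists_eq_add_six hq
    have hq' : (6:ℝ) ≤ q := by exact_mod_cast hq
    rw [stepBound, if_neg (by linarith)]
    -- The derivative of the function is nonnegative at the right end point.
    have hmono : stepProb q ^ 2 ≤ (q - 4) * (1 - 2 * stepProb q) := by
      rw [hQ, stepProb_add_six hm, ← sub_nonneg]
      field_simp
      ring_nf
      positivity
    have hT0 : 0 ≤ stepProb q := ht0.trans ht
    generalize stepProb (q : ℝ) = T at *
    rw [div_le_div_iff₀ (by linarith) (by linarith)]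
    -- Multiplied by `T - t`, this is the difference of the two sides after cross-multiplication.
    have h1 : 0 ≤ (q - 4) * (1 - t - T) - t * T := by
      nlinarith [mul_le_mul_of_nonneg_right ht hT0]
    nlinarith [mul_nonneg (sub_nonneg.2 ht) h1]

/-- A nearest neighbour lies in two plaquettes; when neither has both colours new, they are changed
one at a time. -/
lemma two_mul_stepBound_le {q : ℕ} (hq : 5 ≤ q) : 2 * stepBound q ≤ nnCoeff q := by
  rcases hq.eq_or_lt with rfl | hq
  · norm_num [stepBound, nnCoeff]
  · obtain ⟨m, hm, hQ⟩ := exists_eq_add_six hq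
    rw [hQ, nnCoeff_add_six hm, stepBound, if_neg (by linarith), stepProb_add_six hm]
    have : m + 6 - 4 = m + 2 := by ring
    rw [this, ← sub_nonneg]
    field_simp
    ring_nf
    positivity

lemma stepBound_le_nnnCoeff {q : ℕ} (hq : 5 ≤ q) : stepBound q ≤ nnnCoeff q := by
  rcases hq.eq_or_lt with rfl | hq
  · norm_num [stepBound, nnnCoeff]
  · obtain ⟨m, hm, hQ⟩ := exists_eq_add_six hq
    rw [hQ, stepBound, if_neg (by linarith), stepProb_add_six hm]
    have h2 : m + 6 - 4 = m + 2 := by ring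
    have h3 : m + 6 = (m + 1) + 5 := by ring
    rw [h2, h3, nnnCoeff_add_five, ← sub_nonneg]
    field_simp
    ring_nf
    positivity

lemma nnCoeff_nonneg {q : ℕ} (hq : 5 ≤ q) : 0 ≤ nnCoeff q := by
  rcases hq.eq_or_lt with rfl | hq
  · norm_num [nnCoeff]
  · obtain ⟨m, hm, hQ⟩ := exists_eq_add_six hq
    rw [hQ, nnCoeff_add_six hm]
    positivity

lemma nnnCoeff_nonneg {q : ℕ} (hq : 5 ≤ q) : 0 ≤ nnnCoeff q := by
  obtain ⟨m, hm, hQ⟩ := exists_eq_add_five hq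
  rw [hQ, nnnCoeff_add_five]
  positivity

lemma four_mul_coeff_lt_one {q : ℕ} (hq : 7 ≤ q) : 4 * nnCoeff q + 4 * nnnCoeff q < 1 := by
  obtain ⟨m, hm, hQ⟩ : ∃ m : ℝ, 0 ≤ m ∧ (q : ℝ) = m + 7 :=
    ⟨q - 7, by have : (7:ℝ) ≤ q := by exact_mod_cast hq
               linarith, by ring⟩
  have h6 : m + 7 = (m + 1) + 6 := by ring
  have h5 : (m + 1) + 6 = (m + 2) + 5 := by ring
  rw [hQ, h6, nnCoeff_add_six (by linarith), h5, nnnCoeff_add_five, ← sub_pos]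
  field_simp
  ring_nf
  positivity

end Values

/-! ### The effect of one colour on a product of four plaquette weights -/

section Plaquettes

variable {q : ℕ}

/-- The relative enhancement of the weight of a plaquette with the other colours `B`. -/
def enh (B : Finset (Fin q)) (s : Fin q) : ℝ := if s ∈ B then exc q B.card else 0

lemma enh_of_mem {B : Finset (Fin q)} {s : Fin q} (h : s ∈ B) : enh B s = exc q B.card := if_pos h

lemma enh_of_notMem {B : Finset (Fin q)} {s : Fin q} (h : s ∉ B) : enh B s = 0 := if_neg h

lemma enh_nonneg (hq : 5 ≤ q) {B : Finset (Fin q)} (hB : B.card ≤ 3) (s : Fin q) :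
    0 ≤ enh B s := by
  unfold enh
  split_ifs
  · exact (exc_pos hq hB).le
  · exact le_rfl

lemma enh_le (hq : 5 ≤ q) {B : Finset (Fin q)} (hB : B.card ≤ 3) (s : Fin q) :
    enh B s ≤ exc q B.card := by
  unfold enh
  split_ifs
  · exact le_rfl
  · exact (exc_pos hq hB).le

lemma sum_enh (S B : Finset (Fin q)) : ∑ s ∈ S, enh B s = (S ∩ B).card * exc q B.card := by
  unfold enh
  rw [Finset.sum_ite_mem, Finset.sum_const, nsmul_eq_mul]

lemma card_mul_exc_le_sum_enh (hq : 5 ≤ q) {S B : Finset (Fin q)} (hB : B.card ≤ 3) {n : ℕ}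
    (hn : n ≤ (S ∩ B).card) : n * exc q B.card ≤ ∑ s ∈ S, enh B s := by
  rw [sum_enh]
  exact mul_le_mul_of_nonneg_right (by exact_mod_cast hn) (exc_pos hq hB).le

/-- The difference of the two sides is `(A - b) * (x - y)`. It serves to replace the enhancement of
a plaquette by the largest possible one in lower bounds for relative weights. -/
lemma shift_le {A b x y : ℝ} (hb : b ≤ A) (hxy : y ≤ x) :
    (A + x * b) * (1 + y) ≤ (A + y * b) * (1 + x) := by
  nlinarith [mul_nonneg (sub_nonneg.2 hb) (sub_nonneg.2 hxy)]

lemma cast_five_le (hq : 5 ≤ q) : (5 : ℝ) ≤ q := by exact_mod_cast hq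

/-- The weight of the other colours relative to the largest factor of a distinguished colour is
smallest when the plaquette has three distinct other colours. One of its `n` colours may be the
distinguished one, hence `n - 1`. -/
lemma exc_three_reduce (hq : 5 ≤ q) {n : ℕ} (h1 : 1 ≤ n) (h3 : n ≤ 3) {R : ℝ}
    (hR : (q : ℝ) - 1 ≤ R) :
    (R + 2 * exc q 3) * (1 + exc q n) ≤ (R + (n - 1 : ℕ) * exc q n) * (1 + exc q 3) := by
  obtain ⟨m, hm, hQ⟩ := exists_eq_add_five hq
  obtain ⟨r, hr, hRr⟩ : ∃ r : ℝ, 0 ≤ r ∧ R = m + 4 + r := ⟨R - (m + 4), by linarith, by ring⟩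
  rw [hQ, hRr]
  interval_cases n <;>
  · simp only [exc_add_five]
    push_cast
    field_simp
    rw [← sub_nonneg]
    ring_nf
    positivity

/-- The same with two distinguished colours; the truncated `n - 2` is zero for a single colour, as
it should be. -/
lemma exc_three_reduce_pair (hq : 5 ≤ q) {n : ℕ} (h1 : 1 ≤ n) (h3 : n ≤ 3) {R : ℝ}
    (hR : (q : ℝ) - 2 ≤ R) :
    (R + exc q 3) * (1 + exc q n) ≤ (R + (n - 2 : ℕ) * exc q n) * (1 + exc q 3) := by
  obtain ⟨m, hm, hQ⟩ := exists_eq_add_five hq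
  obtain ⟨r, hr, hRr⟩ : ∃ r : ℝ, 0 ≤ r ∧ R = m + 3 + r := ⟨R - (m + 3), by linarith, by ring⟩
  rw [hQ, hRr]
  interval_cases n <;>
  · simp only [exc_add_five]
    push_cast
    field_simp
    rw [← sub_nonneg]
    ring_nf
    positivity

lemma enh_reduce (hq : 5 ≤ q) {B : Finset (Fin q)} (hB : B.card ≤ 3) (hB' : B.Nonempty)
    (β : Fin q) {R : ℝ} (hR : (q : ℝ) - 1 ≤ R) :
    (R + 2 * exc q 3) * (1 + exc q B.card) ≤
      (R + ∑ s ∈ Finset.univ.erase β, enh B s) * (1 + exc q 3) := by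
  refine (exc_three_reduce hq hB'.card_pos hB hR).trans ?_
  have h1 := exc_pos hq (le_refl 3)
  refine mul_le_mul_of_nonneg_right (add_le_add le_rfl ?_) (by linarith)
  refine card_mul_exc_le_sum_enh hq hB ?_
  rw [Finset.erase_inter, Finset.univ_inter]
  exact Finset.pred_card_le_card_erase

/-- The product of four relative plaquette weights. -/
def plaqProd (B₁ B₂ B₃ B₄ : Finset (Fin q)) (s : Fin q) : ℝ :=
  (1 + enh B₁ s) * (1 + enh B₂ s) * ((1 + enh B₃ s) * (1 + enh B₄ s))

lemma plaqProd_pos (hq : 5 ≤ q) {B₁ B₂ B₃ B₄ : Finset (Fin q)} (h1 : B₁.card ≤ 3)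
    (h2 : B₂.card ≤ 3) (h3 : B₃.card ≤ 3) (h4 : B₄.card ≤ 3) (s : Fin q) :
    0 < plaqProd B₁ B₂ B₃ B₄ s := by
  have e1 := enh_nonneg hq h1 s
  have e2 := enh_nonneg hq h2 s
  have e3 := enh_nonneg hq h3 s
  have e4 := enh_nonneg hq h4 s
  unfold plaqProd
  positivity

lemma plaqProd_swap (B₁ B₂ B₃ B₄ : Finset (Fin q)) :
    plaqProd B₁ B₂ B₃ B₄ = plaqProd B₂ B₁ B₄ B₃ := by
  funext s; unfold plaqProd; ring

lemma one_add_sum_le_mul {a b c d : ℝ} (ha : 0 ≤ a) (hb : 0 ≤ b) (hc : 0 ≤ c) (hd : 0 ≤ d) :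
    1 + a + b + c + d ≤ (1 + a) * (1 + b) * ((1 + c) * (1 + d)) := by
  have h1 : 1 + (a + b) ≤ (1 + a) * (1 + b) := by nlinarith [mul_nonneg ha hb]
  have h2 : 1 + (c + d) ≤ (1 + c) * (1 + d) := by nlinarith [mul_nonneg hc hd]
  have h3 := mul_le_mul h1 h2 (by linarith) (by positivity)
  nlinarith [mul_nonneg (add_nonneg ha hb) (add_nonneg hc hd)]

lemma card_add_sum_enh_le (hq : 5 ≤ q) {B₁ B₂ B₃ B₄ : Finset (Fin q)} (h1 : B₁.card ≤ 3)
    (h2 : B₂.card ≤ 3) (h3 : B₃.card ≤ 3) (h4 : B₄.card ≤ 3) (S : Finset (Fin q)) :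
    S.card + ∑ s ∈ S, enh B₁ s + ∑ s ∈ S, enh B₂ s + ∑ s ∈ S, enh B₃ s + ∑ s ∈ S, enh B₄ s ≤
      ∑ s ∈ S, plaqProd B₁ B₂ B₃ B₄ s := by
  have : (S.card : ℝ) = ∑ s ∈ S, 1 := by simp
  rw [this, ← Finset.sum_add_distrib, ← Finset.sum_add_distrib, ← Finset.sum_add_distrib,
    ← Finset.sum_add_distrib]
  exact Finset.sum_le_sum fun s _ => one_add_sum_le_mul (enh_nonneg hq h1 s) (enh_nonneg hq h2 s)
    (enh_nonneg hq h3 s) (enh_nonneg hq h4 s)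

lemma card_erase_univ (β : Fin q) : (((Finset.univ.erase β).card : ℕ) : ℝ) = q - 1 := by
  rw [Finset.card_erase_of_mem (Finset.mem_univ _), Finset.card_univ, Fintype.card_fin,
    Nat.cast_pred (Fin.pos β)]

lemma card_univ_sdiff_pair {α β : Fin q} (h : α ≠ β) :
    (((Finset.univ \ {α, β} : Finset (Fin q)).card : ℕ) : ℝ) = q - 2 := by
  have h2 : ({α, β} : Finset (Fin q)).card = 2 := Finset.card_pair h
  have h3 := Finset.card_sdiff_add_card_eq_card (Finset.subset_univ ({α, β} : Finset (Fin q)))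
  rw [h2, Finset.card_univ, Fintype.card_fin] at h3
  have h4 : (((Finset.univ \ {α, β} : Finset (Fin q)).card + 2 : ℕ) : ℝ) = q := by rw [h3]
  push_cast at h4
  linarith

/-- The new colour gets at most three enhancements, and the total is smallest relative to it when
each of those plaquettes has three distinct other colours. Contributions of `D` to the total are
dropped. -/
lemma prob_le_stepProb (hq : 5 ≤ q) {D B₂ B₃ B₄ : Finset (Fin q)} (hD : D.card ≤ 3)
    (h2 : B₂.card ≤ 3) (h3 : B₃.card ≤ 3) (h4 : B₄.card ≤ 3) (n2 : B₂.Nonempty)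
    (n3 : B₃.Nonempty) (n4 : B₄.Nonempty) {β : Fin q} (hβ : β ∉ D) :
    plaqProd D B₂ B₃ B₄ β / ∑ s, plaqProd D B₂ B₃ B₄ s ≤ stepProb q := by
  have hx := exc_pos hq (le_refl 3)
  have hq' := cast_five_le hq
  have hlow := card_add_sum_enh_le hq hD h2 h3 h4 (Finset.univ.erase β)
  have e1 : 0 ≤ ∑ s ∈ Finset.univ.erase β, enh D s :=
    Finset.sum_nonneg fun s _ => enh_nonneg hq hD s
  have p2 : 0 ≤ ∑ s ∈ Finset.univ.erase β, enh B₂ s :=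
    Finset.sum_nonneg fun s _ => enh_nonneg hq h2 s
  have p3 : 0 ≤ ∑ s ∈ Finset.univ.erase β, enh B₃ s :=
    Finset.sum_nonneg fun s _ => enh_nonneg hq h3 s
  rw [card_erase_univ] at hlow
  -- The three plaquettes are made extremal one at a time; `R` carries the current contributions of
  -- the others.
  have r2 := enh_reduce hq h2 n2 β (R := q - 1 + 2 * exc q 3 + 2 * exc q 3) (by linarith)
  have r3 := enh_reduce hq h3 n3 β
    (R := q - 1 + 2 * exc q 3 + ∑ s ∈ Finset.univ.erase β, enh B₂ s) (by linarith)
  have r4 := enh_reduce hq h4 n4 β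
    (R := q - 1 + ∑ s ∈ Finset.univ.erase β, enh B₂ s + ∑ s ∈ Finset.univ.erase β, enh B₃ s)
    (by linarith)
  have g2 := enh_le hq h2 β
  have g3 := enh_le hq h3 β
  have g4 := enh_le hq h4 β
  have k2 := enh_nonneg hq h2 β
  have k3 := enh_nonneg hq h3 β
  have k4 := enh_nonneg hq h4 β
  have hval : plaqProd D B₂ B₃ B₄ β = (1 + enh B₂ β) * ((1 + enh B₃ β) * (1 + enh B₄ β)) := by
    rw [plaqProd, enh_of_notMem hβ]; ring
  have hZ := Finset.add_sum_erase Finset.univ (plaqProd D B₂ B₃ B₄) (Finset.mem_univ β)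
  have hP := plaqProd_pos hq hD h2 h3 h4 β
  have hle : plaqProd D B₂ B₃ B₄ β ≤ (1 + exc q B₂.card) * ((1 + exc q B₃.card) *
      (1 + exc q B₄.card)) := by
    have := k2.trans g2
    have := k3.trans g3
    rw [hval]; gcongr
  set x := exc q 3
  set u2 := exc q B₂.card
  set u3 := exc q B₃.card
  set u4 := exc q B₄.card
  set E2 := ∑ s ∈ Finset.univ.erase β, enh B₂ s
  set E3 := ∑ s ∈ Finset.univ.erase β, enh B₃ s
  set E4 := ∑ s ∈ Finset.univ.erase β, enh B₄ s
  have hu3 : 0 ≤ u3 := k3.trans g3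
  have hu4 : 0 ≤ u4 := k4.trans g4
  have key : (q - 1 + 6 * x) * ((1 + u2) * ((1 + u3) * (1 + u4))) ≤
      (q - 1 + E2 + E3 + E4) * (1 + x) ^ 3 := by
    calc (q - 1 + 6 * x) * ((1 + u2) * ((1 + u3) * (1 + u4)))
        = (q - 1 + 2 * x + 2 * x + 2 * x) * (1 + u2) * ((1 + u3) * (1 + u4)) := by ring
      _ ≤ (q - 1 + 2 * x + 2 * x + E2) * (1 + x) * ((1 + u3) * (1 + u4)) := by gcongr
      _ = (q - 1 + 2 * x + E2 + 2 * x) * (1 + u3) * ((1 + x) * (1 + u4)) := by ring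
      _ ≤ (q - 1 + 2 * x + E2 + E3) * (1 + x) * ((1 + x) * (1 + u4)) := by gcongr
      _ = (q - 1 + E2 + E3 + 2 * x) * (1 + u4) * (1 + x) ^ 2 := by ring
      _ ≤ (q - 1 + E2 + E3 + E4) * (1 + x) * (1 + x) ^ 2 := by gcongr
      _ = _ := by ring
  rw [stepProb, ← hZ]
  have hx3 : 0 < (1 + x) ^ 3 := by positivity
  have hrest : q - 1 + E2 + E3 + E4 ≤
      ∑ s ∈ Finset.univ.erase β, plaqProd D B₂ B₃ B₄ s := by linarith
  have hR0 : 0 ≤ ∑ s ∈ Finset.univ.erase β, plaqProd D B₂ B₃ B₄ s :=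
    Finset.sum_nonneg fun s _ => (plaqProd_pos hq hD h2 h3 h4 s).le
  rw [div_le_div_iff₀ (by linarith) (by linarith)]
  have k1 : (q - 1 + 6 * x) * plaqProd D B₂ B₃ B₄ β ≤
      (q - 1 + 6 * x) * ((1 + u2) * ((1 + u3) * (1 + u4))) :=
    mul_le_mul_of_nonneg_left hle (by linarith)
  have k2 := mul_le_mul_of_nonneg_right hrest hx3.le
  linarith

lemma card_insert_le_three {D : Finset (Fin q)} (hD : D.card ≤ 2) (α : Fin q) :
    (insert α D).card ≤ 3 := (Finset.card_insert_le _ _).trans (by omega)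

/-- With `n` colours in `D`, the enhancements `1 / (q - 1 - n)` before and `1 / (q - 2 - n)` after
fit `exists_tvLe_insert` with `N = q - n`: the old colours gain only the factor `1 + y / N`. -/
lemma tvLe_add_colour (hq : 5 ≤ q) {D B₂ B₃ B₄ : Finset (Fin q)} (hD : D.card ≤ 2)
    (h2 : B₂.card ≤ 3) (h3 : B₃.card ≤ 3) (h4 : B₄.card ≤ 3) (n2 : B₂.Nonempty)
    (n3 : B₃.Nonempty) (n4 : B₄.Nonempty) {β : Fin q} (hβ : β ∉ D) :
    TVLe (plaqProd D B₂ B₃ B₄) (plaqProd (insert β D) B₂ B₃ B₄) (stepBound q) := by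
  have hq' := cast_five_le hq
  have hn : (D.card : ℝ) ≤ 2 := by exact_mod_cast hD
  have hcard : (insert β D).card = D.card + 1 := Finset.card_insert_of_notMem hβ
  have hy : 0 < exc q (D.card + 1) := exc_pos hq (by omega)
  obtain ⟨t, ht0, ht1, ht, h⟩ := exists_tvLe_insert
    (g := fun s => (1 + enh B₂ s) * ((1 + enh B₃ s) * (1 + enh B₄ s)))
    (fun s => by
      have e2 := enh_nonneg hq h2 s
      have e3 := enh_nonneg hq h3 s
      have e4 := enh_nonneg hq h4 s
      positivity) hβ (exc_pos hq (by omega : D.card ≤ 3)).le hy (N := q - D.card) (by linarith) (by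
      have k1 : (q:ℝ) - 1 - D.card ≠ 0 := by linarith
      have k2 : (q:ℝ) - 1 - (D.card + 1) ≠ 0 := by linarith
      have k3 : (q:ℝ) - D.card ≠ 0 := by linarith
      unfold exc
      push_cast
      field_simp
      ring)
  have w1 : (fun s => (1 + enh B₂ s) * ((1 + enh B₃ s) * (1 + enh B₄ s)) *
      (1 + if s ∈ D then exc q D.card else 0)) = plaqProd D B₂ B₃ B₄ := by
    funext s; unfold plaqProd enh; ring
  have w2 : (fun s => (1 + enh B₂ s) * ((1 + enh B₃ s) * (1 + enh B₄ s)) *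
      (1 + if s ∈ insert β D then exc q (D.card + 1) else 0)) =
      plaqProd (insert β D) B₂ B₃ B₄ := by
    funext s; rw [plaqProd, show enh (insert β D) s = if s ∈ insert β D then exc q (D.card + 1) else 0 by
      rw [enh, hcard]]
    ring
  have w3 : (1 + enh B₂ β) * ((1 + enh B₃ β) * (1 + enh B₄ β)) = plaqProd D B₂ B₃ B₄ β := by
    rw [plaqProd, enh_of_notMem hβ]; ring
  simp only [w1, w2, w3] at h ht
  have htT : t ≤ stepProb q := by
    refine ht.trans (max_le (prob_le_stepProb hq (by omega) h2 h3 h4 n2 n3 n4 hβ) ?_)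
    refine le_trans ?_ (exc_one_le_stepProb hq)
    unfold exc
    push_cast
    exact one_div_le_one_div_of_le (by linarith) (by linarith)
  refine h.mono (le_trans ?_ (step_le_stepBound hq ht0 htT))
  refine div_le_div_of_nonneg_left (mul_nonneg ht0 (by linarith)) (by linarith) ?_
  rw [exc, one_div_one_div]
  push_cast
  linarith

/-- Changing one colour of a plaquette that contains the old or the new one anyway. -/
lemma tvLe_change_colour (hq : 5 ≤ q) {D B₂ B₃ B₄ : Finset (Fin q)} (hD : D.card ≤ 2)
    (h2 : B₂.card ≤ 3) (h3 : B₃.card ≤ 3) (h4 : B₄.card ≤ 3) (n2 : B₂.Nonempty)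
    (n3 : B₃.Nonempty) (n4 : B₄.Nonempty) {α β : Fin q} (h : α ∈ D ∨ β ∈ D) :
    TVLe (plaqProd (insert α D) B₂ B₃ B₄) (plaqProd (insert β D) B₂ B₃ B₄) (stepBound q) := by
  have hsum : ∀ γ, 0 < ∑ s, plaqProd (insert γ D) B₂ B₃ B₄ s := fun γ =>
    Finset.sum_pos (fun s _ => plaqProd_pos hq (card_insert_le_three hD γ) h2 h3 h4 s)
      ⟨γ, Finset.mem_univ _⟩
  have hpos : 0 ≤ stepBound q := by
    have := step_le_stepBound hq le_rfl
      ((exc_pos hq (by norm_num : 1 ≤ 3)).le.trans (exc_one_le_stepProb hq))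
    simpa using this
  by_cases hα : α ∈ D
  · by_cases hβ : β ∈ D
    · rw [Finset.insert_eq_of_mem hα, Finset.insert_eq_of_mem hβ]
      exact TVLe.refl _ hpos
    · rw [Finset.insert_eq_of_mem hα]
      exact tvLe_add_colour hq hD h2 h3 h4 n2 n3 n4 hβ
  · have hβ := h.resolve_left hα
    have h1 := tvLe_add_colour hq hD h2 h3 h4 n2 n3 n4 hα
    have h2 := h1.symm (by simpa [hβ] using hsum β) (hsum α)
    rwa [Finset.insert_eq_of_mem hβ]

end Plaquettes

/-! ### Upper bounds for the two coefficients -/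

section UpperBounds

variable {q : ℕ}

lemma enh_insert_self {D : Finset (Fin q)} {α : Fin q} (h : α ∉ D) :
    enh (insert α D) α = exc q (D.card + 1) := by
  rw [enh_of_mem (Finset.mem_insert_self _ _), Finset.card_insert_of_notMem h]

lemma enh_insert_of_mem {D : Finset (Fin q)} {α s : Fin q} (h : α ∉ D) (hs : s ∈ D) :
    enh (insert α D) s = exc q (D.card + 1) := by
  rw [enh_of_mem (Finset.mem_insert_of_mem hs), Finset.card_insert_of_notMem h]

lemma enh_insert_of_notMem {D : Finset (Fin q)} {α s : Fin q} (hs : s ∉ D) (h : s ≠ α) :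
    enh (insert α D) s = 0 :=
  enh_of_notMem (by simp [hs, h])

lemma enh_insert_eq {D : Finset (Fin q)} {α β s : Fin q} (hα : α ∉ D) (hβ : β ∉ D)
    (h1 : s ≠ α) (h2 : s ≠ β) : enh (insert β D) s = enh (insert α D) s := by
  by_cases hs : s ∈ D
  · rw [enh_insert_of_mem hα hs, enh_insert_of_mem hβ hs]
  · rw [enh_insert_of_notMem hs h1, enh_insert_of_notMem hs h2]

lemma card_mul_exc_le_sum_enh_insert (hq : 5 ≤ q) {D S : Finset (Fin q)} {α : Fin q}
    (hD : D.card ≤ 2) (hα : α ∉ D) (hDS : D ⊆ S) :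
    D.card * exc q (D.card + 1) ≤ ∑ s ∈ S, enh (insert α D) s := by
  have h := card_mul_exc_le_sum_enh hq (card_insert_le_three hD α) (S := S) (n := D.card)
    (Finset.card_le_card fun s hs => Finset.mem_inter.2 ⟨hDS hs, Finset.mem_insert_of_mem hs⟩)
  rwa [Finset.card_insert_of_notMem hα] at h

lemma card_eq_one_or_two {D : Finset (Fin q)} (hD : D.card ≤ 2) (h : D.Nonempty) :
    D.card = 1 ∨ D.card = 2 := by
  have := h.card_pos
  omega

lemma exc_le_exc_three (hq : 5 ≤ q) {B : Finset (Fin q)} (hB : B.card ≤ 3) :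
    exc q B.card ≤ exc q 3 := exc_le_exc hq hB le_rfl

lemma exc_three_le_one (hq : 5 ≤ q) : exc q 3 ≤ 1 := by
  have := cast_five_le hq
  unfold exc
  rw [div_le_one] <;> push_cast <;> linarith

/-- Two pairs among the three colours other than `α` and `β` must meet. This is where five colours
differ from six or more. -/
lemma exists_mem_inter_of_card_two {α β : Fin 5} (hαβ : α ≠ β) {D₁ D₂ : Finset (Fin 5)}
    (h1 : D₁.card = 2) (h2 : D₂.card = 2) (hα1 : α ∉ D₁) (hβ1 : β ∉ D₁) (hα2 : α ∉ D₂)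
    (hβ2 : β ∉ D₂) : (D₁ ∩ D₂).Nonempty := by
  rw [← Finset.card_pos]
  have h3 := Finset.card_union_add_card_inter D₁ D₂
  have h4 : (D₁ ∪ D₂) ⊆ Finset.univ \ {α, β} := fun s hs => by
    rw [Finset.mem_union] at hs
    simp only [Finset.mem_sdiff, Finset.mem_univ, true_and, Finset.mem_insert,
      Finset.mem_singleton, not_or]
    refine ⟨?_, ?_⟩ <;> rintro rfl <;> tauto
  have h5 := Finset.card_le_card h4
  have h6 : (Finset.univ \ {α, β} : Finset (Fin 5)).card = 3 := by
    rw [Finset.card_sdiff_of_subset (Finset.subset_univ _), Finset.card_pair hαβ,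
      Finset.card_univ, Fintype.card_fin]
  omega

/-- `shift_le` applied to two plaquettes in turn. -/
lemma mul_le_of_two_shifts {A b₁ b₂ x y₁ y₂ : ℝ} (hb1 : 0 ≤ b₁) (hb2 : 0 ≤ b₂)
    (h1 : b₁ ≤ A) (h2 : b₂ ≤ A) (hy1 : 0 ≤ y₁) (hy2 : 0 ≤ y₂) (hx1 : y₁ ≤ x) (hx2 : y₂ ≤ x) :
    (A + x * b₁ + x * b₂) * ((1 + y₁) * (1 + y₂)) ≤ (A + y₁ * b₁ + y₂ * b₂) * (1 + x) ^ 2 := by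
  have hx : 0 ≤ x := hy1.trans hx1
  have s1 := shift_le (A := A + x * b₂) (b := b₁) (x := x) (y := y₁)
    (by nlinarith [mul_nonneg hx hb2]) hx1
  have s2 := shift_le (A := A + y₁ * b₁) (b := b₂) (x := x) (y := y₂)
    (by nlinarith [mul_nonneg hy1 hb1]) hx2
  calc (A + x * b₁ + x * b₂) * ((1 + y₁) * (1 + y₂))
      = (A + x * b₂ + x * b₁) * (1 + y₁) * (1 + y₂) := by ring
    _ ≤ (A + x * b₂ + y₁ * b₁) * (1 + x) * (1 + y₂) := by gcongr
    _ = (A + y₁ * b₁ + x * b₂) * (1 + y₂) * (1 + x) := by ring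
    _ ≤ (A + y₁ * b₁ + y₂ * b₂) * (1 + x) * (1 + x) := by gcongr
    _ = _ := by ring

lemma mul_le_of_mul_le_mul_sq {m M F G : ℝ} (hG : 0 < G) (h : m * F ≤ M * G) :
    m / G * F ≤ M := by
  rwa [div_mul_eq_mul_div, div_le_iff₀ hG]

/-- The colours `α`, `β` occur at no other site of the two plaquettes. -/
lemma tvLe_fresh_fresh (hq : 5 ≤ q) {D₁ D₂ B₃ B₄ : Finset (Fin q)} (h1 : D₁.card ≤ 2)
    (h2 : D₂.card ≤ 2) (h3 : B₃.card ≤ 3) (h4 : B₄.card ≤ 3) {e w : Fin q} (he1 : e ∈ D₁)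
    (he3 : e ∈ B₃) (hw2 : w ∈ D₂) (hw4 : w ∈ B₄) {α β : Fin q} (hαβ : α ≠ β) (hα1 : α ∉ D₁)
    (hβ1 : β ∉ D₁) (hα2 : α ∉ D₂) (hβ2 : β ∉ D₂) :
    TVLe (plaqProd (insert α D₁) (insert α D₂) B₃ B₄)
      (plaqProd (insert β D₁) (insert β D₂) B₃ B₄) (nnCoeff q) := by
  have hq' := cast_five_le hq
  have hx := exc_pos hq (le_refl 3)
  have hx1' := exc_three_le_one hq
  have p1 : 0 < exc q (D₁.card + 1) := exc_pos hq (by omega)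
  have p2 : 0 < exc q (D₂.card + 1) := exc_pos hq (by omega)
  have q1 : exc q (D₁.card + 1) ≤ exc q 3 := exc_le_exc hq (by omega) le_rfl
  have q2 : exc q (D₂.card + 1) ≤ exc q 3 := exc_le_exc hq (by omega) le_rfl
  have p3 := exc_pos hq h3
  have p4 := exc_pos hq h4
  have q3 := exc_le_exc_three hq h3
  have q4 := exc_le_exc_three hq h4
  have c1 := card_insert_le_three h1
  have c2 := card_insert_le_three h2
  set S : Finset (Fin q) := Finset.univ \ {α, β} with hS
  have hmemS : ∀ s, s ∈ S ↔ s ≠ α ∧ s ≠ β := fun s => by simp [hS]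
  have hD1S : D₁ ⊆ S := fun s hs => (hmemS s).2
    ⟨fun h => hα1 (h ▸ hs), fun h => hβ1 (h ▸ hs)⟩
  have hD2S : D₂ ⊆ S := fun s hs => (hmemS s).2
    ⟨fun h => hα2 (h ▸ hs), fun h => hβ2 (h ▸ hs)⟩
  have n1 : ∀ s, 0 ≤ enh (insert α D₁) s := enh_nonneg hq (c1 α)
  have n2 : ∀ s, 0 ≤ enh (insert α D₂) s := enh_nonneg hq (c2 α)
  have n3 : ∀ s, 0 ≤ enh B₃ s := enh_nonneg hq h3
  have n4 : ∀ s, 0 ≤ enh B₄ s := enh_nonneg hq h4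
  set ε := ∑ s ∈ S, enh (insert α D₁) s * enh (insert α D₂) s with hε
  have hε0 : 0 ≤ ε := Finset.sum_nonneg fun s _ => mul_nonneg (n1 s) (n2 s)
  -- The common colour is enhanced in both plaquettes, and `exc 5 3 = 1`.
  have hε5 : q = 5 → D₁.card = 2 → D₂.card = 2 → 1 ≤ ε := by
    rintro rfl k1 k2
    obtain ⟨s, hs⟩ := exists_mem_inter_of_card_two hαβ k1 k2 hα1 hβ1 hα2 hβ2
    rw [Finset.mem_inter] at hs
    have := Finset.single_le_sum (f := fun s => enh (insert α D₁) s * enh (insert α D₂) s)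
      (fun s _ => mul_nonneg (n1 s) (n2 s)) (hD1S hs.1)
    rw [enh_insert_of_mem hα1 hs.1, enh_insert_of_mem hα2 hs.2, k1, k2] at this
    norm_num [exc] at this
    exact this
  -- the total weight of the other colours
  have hM : (q - 2 + D₁.card * exc q (D₁.card + 1) + D₂.card * exc q (D₂.card + 1) + ε) +
      exc q B₃.card * (1 + exc q (D₁.card + 1)) + exc q B₄.card * (1 + exc q (D₂.card + 1)) ≤
      ∑ s ∈ S, plaqProd (insert α D₁) (insert α D₂) B₃ B₄ s := by
    -- Of the expanded product only those mixed terms are kept that are needed: the first plaquette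
    -- shares the colour `e` with the third, the second shares `w` with the fourth, and the first
    -- two may share a colour at `q = 5`.
    have hpt : ∀ s ∈ S, 1 + enh (insert α D₁) s + enh (insert α D₂) s +
        enh (insert α D₁) s * enh (insert α D₂) s + enh B₃ s * (1 + enh (insert α D₁) s) +
        enh B₄ s * (1 + enh (insert α D₂) s) ≤
        plaqProd (insert α D₁) (insert α D₂) B₃ B₄ s := fun s _ => by
      have a1 := n1 s
      have a2 := n2 s
      have a3 := n3 s
      have a4 := n4 s
      unfold plaqProd
      generalize enh (insert α D₁) s = a at *
      generalize enh (insert α D₂) s = b at *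
      generalize enh B₃ s = c at *
      generalize enh B₄ s = d at *
      have : 0 ≤ c * (b * (1 + a)) + d * (a * (1 + b)) + (1 + a) * (1 + b) * (c * d) := by
        positivity
      linarith
    refine le_trans ?_ (Finset.sum_le_sum hpt)
    simp only [Finset.sum_add_distrib]
    have t0 : ∑ s ∈ S, (1 : ℝ) = q - 2 := by
      rw [Finset.sum_const, nsmul_eq_mul, mul_one, hS, card_univ_sdiff_pair hαβ]
    have t1 := card_mul_exc_le_sum_enh_insert hq h1 hα1 hD1S
    have t2 := card_mul_exc_le_sum_enh_insert hq h2 hα2 hD2S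
    have t3 := Finset.single_le_sum (f := fun s => enh B₃ s * (1 + enh (insert α D₁) s))
      (fun s _ => mul_nonneg (n3 s) (add_nonneg zero_le_one (n1 s))) (hD1S he1)
    have t4 := Finset.single_le_sum (f := fun s => enh B₄ s * (1 + enh (insert α D₂) s))
      (fun s _ => mul_nonneg (n4 s) (add_nonneg zero_le_one (n2 s))) (hD2S hw2)
    rw [enh_of_mem he3, enh_insert_of_mem hα1 he1] at t3
    rw [enh_of_mem hw4, enh_insert_of_mem hα2 hw2] at t4
    linarith
  have hF := mul_le_of_two_shifts (A := q - 2 + D₁.card * exc q (D₁.card + 1) +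
      D₂.card * exc q (D₂.card + 1) + ε) (b₁ := 1 + exc q (D₁.card + 1))
      (b₂ := 1 + exc q (D₂.card + 1)) (x := exc q 3)
      (y₁ := exc q B₃.card) (y₂ := exc q B₄.card)
      (by positivity) (by positivity)
      (by nlinarith [mul_nonneg (Nat.cast_nonneg (α := ℝ) D₁.card) p1.le,
        mul_nonneg (Nat.cast_nonneg (α := ℝ) D₂.card) p2.le])
      (by nlinarith [mul_nonneg (Nat.cast_nonneg (α := ℝ) D₁.card) p1.le,
        mul_nonneg (Nat.cast_nonneg (α := ℝ) D₂.card) p2.le]) p3.le p4.le q3 q4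
  have hfac : ∀ s, 0 < (1 + enh B₃ s) * (1 + enh B₄ s) := fun s => by
    have a3 := n3 s
    have a4 := n4 s
    positivity
  have hfacle : ∀ s, (1 + enh B₃ s) * (1 + enh B₄ s) ≤
      (1 + exc q B₃.card) * (1 + exc q B₄.card) := fun s => by
    have a3 := n3 s
    have a4 := n4 s
    have b3 := enh_le hq h3 s
    have b4 := enh_le hq h4 s
    gcongr
  refine (tvLe_exchange hαβ (hfac α) (hfac β)
    (Δ := (1 + exc q (D₁.card + 1)) * (1 + exc q (D₂.card + 1)) - 1)
    (by nlinarith [mul_pos p1 p2]) (hfacle α) (hfacle β)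
    (m := (q - 2 + D₁.card * exc q (D₁.card + 1) + D₂.card * exc q (D₂.card + 1) +
      exc q 3 * (1 + exc q (D₁.card + 1)) + exc q 3 * (1 + exc q (D₂.card + 1)) + ε) /
        (1 + exc q 3) ^ 2) ?_ (fun s => (plaqProd_pos hq (c1 α) (c2 α) h3 h4 s).le)
    ?_ ?_ ?_ ?_ ?_ ?_).mono (exchange_two_le hq (card_eq_one_or_two h1 ⟨e, he1⟩)
      (card_eq_one_or_two h2 ⟨w, hw2⟩) hε0 hε5)
  · have : (0:ℝ) ≤ q - 2 := by linarith
    positivity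
  · rw [plaqProd, enh_insert_self hα1, enh_insert_self hα2]; ring
  · rw [plaqProd, enh_insert_of_notMem hβ1 hαβ.symm, enh_insert_of_notMem hβ2 hαβ.symm]; ring
  · rw [plaqProd, enh_insert_of_notMem hα1 hαβ, enh_insert_of_notMem hα2 hαβ]; ring
  · rw [plaqProd, enh_insert_self hβ1, enh_insert_self hβ2]; ring
  · intro s hsα hsβ
    rw [plaqProd, plaqProd, enh_insert_eq hα1 hβ1 hsα hsβ, enh_insert_eq hα2 hβ2 hsα hsβ]
  · refine mul_le_of_mul_le_mul_sq (by positivity) (le_trans (le_of_eq ?_)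
      (hF.trans (mul_le_mul_of_nonneg_right hM (by positivity))))
    ring

/-- The colours `α`, `β` are new in the first plaquette, and both occur in the second. -/
lemma tvLe_fresh_neutral (hq : 5 ≤ q) {D₁ B₂ B₃ B₄ : Finset (Fin q)} (h1 : D₁.card ≤ 2)
    (h2 : B₂.card ≤ 3) (h3 : B₃.card ≤ 3) (h4 : B₄.card ≤ 3) {α β : Fin q} (hαβ : α ≠ β)
    (hα1 : α ∉ D₁) (hβ1 : β ∉ D₁) :
    TVLe (plaqProd (insert α D₁) B₂ B₃ B₄) (plaqProd (insert β D₁) B₂ B₃ B₄) (nnCoeff q) := by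
  have hq' := cast_five_le hq
  have hx := exc_pos hq (le_refl 3)
  have p1 : 0 < exc q (D₁.card + 1) := exc_pos hq (by omega)
  have q1 : exc q (D₁.card + 1) ≤ exc q 3 := exc_le_exc hq (by omega) le_rfl
  have c1 := card_insert_le_three h1
  have n1 : ∀ s, 0 ≤ enh (insert α D₁) s := enh_nonneg hq (c1 α)
  have n2 : ∀ s, 0 ≤ enh B₂ s := enh_nonneg hq h2
  have n3 : ∀ s, 0 ≤ enh B₃ s := enh_nonneg hq h3
  have n4 : ∀ s, 0 ≤ enh B₄ s := enh_nonneg hq h4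
  have hfac : ∀ s, 0 < (1 + enh B₂ s) * ((1 + enh B₃ s) * (1 + enh B₄ s)) := fun s => by
    have a2 := n2 s
    have a3 := n3 s
    have a4 := n4 s
    positivity
  have hfacle : ∀ s, (1 + enh B₂ s) * ((1 + enh B₃ s) * (1 + enh B₄ s)) ≤
      (1 + exc q 3) ^ 3 := fun s => by
    have a2 := n2 s
    have a3 := n3 s
    have a4 := n4 s
    have b2 := (enh_le hq h2 s).trans (exc_le_exc_three hq h2)
    have b3 := (enh_le hq h3 s).trans (exc_le_exc_three hq h3)
    have b4 := (enh_le hq h4 s).trans (exc_le_exc_three hq h4)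
    rw [show (1 + exc q 3) ^ 3 = (1 + exc q 3) * ((1 + exc q 3) * (1 + exc q 3)) by ring]
    gcongr
  have hm : 0 ≤ ((q:ℝ) - 2) / (1 + exc q 3) ^ 3 := div_nonneg (by linarith) (by positivity)
  refine (tvLe_exchange hαβ (hfac α) (hfac β) (Δ := exc q (D₁.card + 1)) p1.le (hfacle α)
    (hfacle β) hm (fun s => (plaqProd_pos hq (c1 α) h2 h3 h4 s).le) ?_ ?_ ?_ ?_ ?_ ?_).mono
    (le_trans ?_ (exchange_one_le hq))
  · rw [plaqProd, enh_insert_self hα1]; ring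
  · rw [plaqProd, enh_insert_of_notMem hβ1 hαβ.symm]; ring
  · rw [plaqProd, enh_insert_of_notMem hα1 hαβ]; ring
  · rw [plaqProd, enh_insert_self hβ1]; ring
  · intro s hsα hsβ
    rw [plaqProd, plaqProd, enh_insert_eq hα1 hβ1 hsα hsβ]
  · rw [div_mul_cancel₀ _ (by positivity), ← card_univ_sdiff_pair hαβ]
    refine le_trans ?_ (card_add_sum_enh_le hq (c1 α) h2 h3 h4 _)
    have s1 := Finset.sum_nonneg fun s (_ : s ∈ Finset.univ \ {α, β}) => n1 s
    have s2 := Finset.sum_nonneg fun s (_ : s ∈ Finset.univ \ {α, β}) => n2 s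
    have s3 := Finset.sum_nonneg fun s (_ : s ∈ Finset.univ \ {α, β}) => n3 s
    have s4 := Finset.sum_nonneg fun s (_ : s ∈ Finset.univ \ {α, β}) => n4 s
    linarith
  -- `Δ / (m + 2 + Δ)` increases with `Δ`, and `Δ` is largest for three colours.
  · rw [div_le_div_iff₀ (by positivity) (by positivity)]
    nlinarith [mul_le_mul_of_nonneg_right q1 (add_nonneg hm zero_le_two)]

/-- The diagonal neighbour, when `α`, `β` occur at no other site of the plaquette. -/
lemma tvLe_fresh_diagonal (hq : 5 ≤ q) {D₁ B₂ B₃ B₄ : Finset (Fin q)} (h1 : D₁.card ≤ 2)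
    (h2 : B₂.card ≤ 3) (h3 : B₃.card ≤ 3) (h4 : B₄.card ≤ 3) (hB4 : B₄.Nonempty) {a b : Fin q}
    (ha1 : a ∈ D₁) (ha2 : a ∈ B₂) (hb1 : b ∈ D₁) (hb3 : b ∈ B₃) {α β : Fin q} (hαβ : α ≠ β)
    (hα1 : α ∉ D₁) (hβ1 : β ∉ D₁) :
    TVLe (plaqProd (insert α D₁) B₂ B₃ B₄) (plaqProd (insert β D₁) B₂ B₃ B₄) (nnnCoeff q) := by
  have hq' := cast_five_le hq
  have hx := exc_pos hq (le_refl 3)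
  have hx1' := exc_three_le_one hq
  have p1 : 0 < exc q (D₁.card + 1) := exc_pos hq (by omega)
  have q1 : exc q (D₁.card + 1) ≤ exc q 3 := exc_le_exc hq (by omega) le_rfl
  have p2 := exc_pos hq h2
  have p3 := exc_pos hq h3
  have p4 := exc_pos hq h4
  have q2 := exc_le_exc_three hq h2
  have q3 := exc_le_exc_three hq h3
  have c1 := card_insert_le_three h1
  have n1 : ∀ s, 0 ≤ enh (insert α D₁) s := enh_nonneg hq (c1 α)
  have n2 : ∀ s, 0 ≤ enh B₂ s := enh_nonneg hq h2
  have n3 : ∀ s, 0 ≤ enh B₃ s := enh_nonneg hq h3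
  have n4 : ∀ s, 0 ≤ enh B₄ s := enh_nonneg hq h4
  set S : Finset (Fin q) := Finset.univ \ {α, β} with hS
  have hmemS : ∀ s, s ∈ S ↔ s ≠ α ∧ s ≠ β := fun s => by simp [hS]
  have hD1S : D₁ ⊆ S := fun s hs => (hmemS s).2
    ⟨fun h => hα1 (h ▸ hs), fun h => hβ1 (h ▸ hs)⟩
  have hM : (q - 2 + D₁.card * exc q (D₁.card + 1) + (B₄.card - 2 : ℕ) * exc q B₄.card) +
      exc q B₂.card * (1 + exc q (D₁.card + 1)) + exc q B₃.card * (1 + exc q (D₁.card + 1)) ≤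
      ∑ s ∈ S, plaqProd (insert α D₁) B₂ B₃ B₄ s := by
    have hpt : ∀ s ∈ S, 1 + enh (insert α D₁) s + enh B₄ s +
        enh B₂ s * (1 + enh (insert α D₁) s) + enh B₃ s * (1 + enh (insert α D₁) s) ≤
        plaqProd (insert α D₁) B₂ B₃ B₄ s := fun s _ => by
      have a1 := n1 s
      have a2 := n2 s
      have a3 := n3 s
      have a4 := n4 s
      unfold plaqProd
      generalize enh (insert α D₁) s = a at *
      generalize enh B₂ s = b at *
      generalize enh B₃ s = c at *
      generalize enh B₄ s = d at *
      have : 0 ≤ (1 + a) * (b * c) + d * (a + b * (1 + a) + c * (1 + a) * (1 + b)) := by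
        positivity
      linarith
    refine le_trans ?_ (Finset.sum_le_sum hpt)
    simp only [Finset.sum_add_distrib]
    have t0 : ∑ s ∈ S, (1 : ℝ) = q - 2 := by
      rw [Finset.sum_const, nsmul_eq_mul, mul_one, hS, card_univ_sdiff_pair hαβ]
    have t1 := card_mul_exc_le_sum_enh_insert hq h1 hα1 hD1S
    have t2 := Finset.single_le_sum (f := fun s => enh B₂ s * (1 + enh (insert α D₁) s))
      (fun s _ => mul_nonneg (n2 s) (add_nonneg zero_le_one (n1 s))) (hD1S ha1)
    have t3 := Finset.single_le_sum (f := fun s => enh B₃ s * (1 + enh (insert α D₁) s))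
      (fun s _ => mul_nonneg (n3 s) (add_nonneg zero_le_one (n1 s))) (hD1S hb1)
    -- Up to two colours of `B₄` may be `α` and `β`, which are excluded from `S`.
    have t4 : ((B₄.card - 2 : ℕ) : ℝ) * exc q B₄.card ≤ ∑ s ∈ S, enh B₄ s := by
      refine card_mul_exc_le_sum_enh hq h4 ?_
      have : S ∩ B₄ = B₄ \ {α, β} := by ext s; simp [hS, and_comm]
      rw [this]
      have := Finset.le_card_sdiff ({α, β} : Finset (Fin q)) B₄
      rwa [Finset.card_pair hαβ] at this
    rw [enh_of_mem ha2, enh_insert_of_mem hα1 ha1] at t2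
    rw [enh_of_mem hb3, enh_insert_of_mem hα1 hb1] at t3
    linarith
  have hd1 : 0 ≤ (D₁.card : ℝ) * exc q (D₁.card + 1) := by positivity
  have hd4 : 0 ≤ ((B₄.card - 2 : ℕ) : ℝ) * exc q B₄.card := by positivity
  have hF1 := mul_le_of_two_shifts (A := q - 2 + D₁.card * exc q (D₁.card + 1) +
      (B₄.card - 2 : ℕ) * exc q B₄.card) (b₁ := 1 + exc q (D₁.card + 1))
      (b₂ := 1 + exc q (D₁.card + 1)) (x := exc q 3)
      (y₁ := exc q B₂.card) (y₂ := exc q B₃.card)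
      (by positivity) (by positivity) (by linarith) (by linarith)
      p2.le p3.le q2 q3
  have hF2 := exc_three_reduce_pair hq hB4.card_pos h4 (R := q - 2 +
      D₁.card * exc q (D₁.card + 1) + exc q 3 * (1 + exc q (D₁.card + 1)) +
      exc q 3 * (1 + exc q (D₁.card + 1)))
      (by nlinarith [mul_nonneg hx.le (add_nonneg zero_le_one p1.le)])
  have hfac : ∀ s, 0 < (1 + enh B₂ s) * (1 + enh B₃ s) * (1 + enh B₄ s) := fun s => by
    have a2 := n2 s
    have a3 := n3 s
    have a4 := n4 s
    positivity
  have hfacle : ∀ s, (1 + enh B₂ s) * (1 + enh B₃ s) * (1 + enh B₄ s) ≤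
      (1 + exc q B₂.card) * (1 + exc q B₃.card) * (1 + exc q B₄.card) := fun s => by
    have a2 := n2 s
    have a3 := n3 s
    have a4 := n4 s
    have b2 := enh_le hq h2 s
    have b3 := enh_le hq h3 s
    have b4 := enh_le hq h4 s
    gcongr
  refine (tvLe_exchange hαβ (hfac α) (hfac β) (Δ := exc q (D₁.card + 1)) p1.le (hfacle α)
    (hfacle β) (m := (q - 2 + D₁.card * exc q (D₁.card + 1) +
      2 * exc q 3 * (1 + exc q (D₁.card + 1)) + exc q 3) / (1 + exc q 3) ^ 3) ?_
    (fun s => (plaqProd_pos hq (c1 α) h2 h3 h4 s).le) ?_ ?_ ?_ ?_ ?_ ?_).mono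
    (exchange_diagonal_le hq (card_eq_one_or_two h1 ⟨a, ha1⟩))
  · have : (0:ℝ) ≤ q - 2 := by linarith
    positivity
  · rw [plaqProd, enh_insert_self hα1]; ring
  · rw [plaqProd, enh_insert_of_notMem hβ1 hαβ.symm]; ring
  · rw [plaqProd, enh_insert_of_notMem hα1 hαβ]; ring
  · rw [plaqProd, enh_insert_self hβ1]; ring
  · intro s hsα hsβ
    rw [plaqProd, plaqProd, enh_insert_eq hα1 hβ1 hsα hsβ]
  · refine mul_le_of_mul_le_mul_sq (by positivity) (le_trans ?_
      (mul_le_mul_of_nonneg_right hM (by positivity)))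
    calc _ = (q - 2 + D₁.card * exc q (D₁.card + 1) + exc q 3 * (1 + exc q (D₁.card + 1)) +
      exc q 3 * (1 + exc q (D₁.card + 1)) + exc q 3) * (1 + exc q B₄.card) *
        ((1 + exc q B₂.card) * (1 + exc q B₃.card)) := by ring
      _ ≤ _ := mul_le_mul_of_nonneg_right hF2 (by positivity)
      _ = (q - 2 + D₁.card * exc q (D₁.card + 1) + (B₄.card - 2 : ℕ) * exc q B₄.card +
        exc q 3 * (1 + exc q (D₁.card + 1)) + exc q 3 * (1 + exc q (D₁.card + 1))) *
        ((1 + exc q B₂.card) * (1 + exc q B₃.card)) * (1 + exc q 3) := by ring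
      _ ≤ _ := mul_le_mul_of_nonneg_right hF1 (by positivity)
      _ = _ := by ring

end UpperBounds

/-! ### The mixed case and the final bounds -/

section MixedCase

variable {q : ℕ}

/-- The gain at the new colour. -/
lemma gain_le {f F C R κ v ξ c : ℝ} (hf : 0 < f) (hfF : f ≤ F) (hκ : 0 < κ) (hv : 1 ≤ v)
    (hξ : 0 ≤ ξ) (hc : 0 ≤ c) (hC : κ * F ≤ C) (hR0 : 0 ≤ R) (hR : R ≤ C + F * ξ)
    (hvκ : v ≤ κ ^ 2)
    (h1 : κ * (v - 1) + v * ξ ≤ c * ((κ + v) * (κ + 1 + ξ)))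
    (h2 : v - 1 ≤ c * (2 * κ + 1 + v + ξ)) :
    v * f / (v * f + C) - f / (f + R) ≤ c := by
  have hF : 0 < F := hf.trans_le hfF
  obtain ⟨k, hk⟩ : ∃ k, C = k * F := ⟨C / F, by field_simp⟩
  have hkκ : κ ≤ k := by
    rw [hk] at hC
    exact le_of_mul_le_mul_right hC hF
  have hk0 : 0 < k := hκ.trans_le hkκ
  have hv0 : 0 < v := by linarith
  subst hk
  have hvk : v ≤ k * (k + ξ) := by nlinarith [mul_nonneg hk0.le hξ]
  -- The inequality `h1` passes from `κ` to the actual ratio `k ≥ κ`: `h2` controls the increment of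
  -- the quadratic in `k`.
  have hg : k * (v - 1) + v * ξ ≤ c * ((k + v) * (k + 1 + ξ)) := by
    have h3 : v - 1 ≤ c * (k + κ + 1 + v + ξ) :=
      h2.trans (mul_le_mul_of_nonneg_left (by linarith) hc)
    have := mul_le_mul_of_nonneg_left h3 (sub_nonneg.2 hkκ)
    nlinarith
  have hR' : f / (f + (k * F + F * ξ)) ≤ f / (f + R) :=
    div_le_div_of_nonneg_left hf.le (by positivity) (by linarith)
  have hnum : 0 ≤ v * (k + ξ) - k := by
    nlinarith [mul_nonneg hk0.le (sub_nonneg.2 hv), mul_nonneg hv0.le hξ]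
  calc v * f / (v * f + k * F) - f / (f + R)
      ≤ v * f / (v * f + k * F) - f / (f + (k * F + F * ξ)) := by linarith
    _ = f * F * (v * (k + ξ) - k) / ((v * f + k * F) * (f + F * (k + ξ))) := by
        rw [div_sub_div _ _ (by positivity) (by positivity)]
        congr 1 <;> ring
    _ ≤ (v * (k + ξ) - k) / ((v + k) * (1 + k + ξ)) := by
        rw [div_le_div_iff₀ (by positivity) (by positivity)]
        -- The worst case is `f = F`: the difference of the two sides is `(F - f) * (k * (k + ξ) * F
        -- - v * f)`.
        have : f * F * ((v + k) * (1 + k + ξ)) ≤ (v * f + k * F) * (f + F * (k + ξ)) := by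
          have h4 : v * f ≤ k * (k + ξ) * F :=
            mul_le_mul hvk hfF hf.le (by positivity)
          nlinarith [mul_nonneg (sub_nonneg.2 hfF) (sub_nonneg.2 h4)]
        nlinarith [mul_le_mul_of_nonneg_left this hnum]
    _ ≤ c := by
        rw [div_le_iff₀ (by positivity)]
        linarith

/-- The gain when one further colour profits. -/
lemma double_gain_le {Z Z' S N k ε c : ℝ} (hZ : 0 < Z) (hZZ' : Z ≤ Z')
    (hε : 0 ≤ ε) (hZ'ε : Z' ≤ (1 + ε) * Z) (hS : 2 ≤ S) (hkS : k ≤ Z - S)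
    (hN : N = S + Z' - Z + k)
    (h : k ≤ 2 * ε + ((1 + ε) * c - ε) * Z) :
    N / Z' - S / Z ≤ c := by
  have hZ' : 0 < Z' := hZ.trans_le hZZ'
  -- What is left outside the gaining set is `Z - S - k`, so the gain increases with `Z'` and may be
  -- estimated at `Z' = (1 + ε) * Z`.
  have e : N / Z' = 1 - (Z - S - k) / Z' := by rw [hN]; field_simp; ring
  have h1 : (Z - S - k) / ((1 + ε) * Z) ≤ (Z - S - k) / Z' :=
    div_le_div_of_nonneg_left (by linarith) hZ' hZ'ε
  have h2 : 1 - (Z - S - k) / ((1 + ε) * Z) - S / Z ≤ c := by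
    have e2 : 1 - (Z - S - k) / ((1 + ε) * Z) - S / Z =
        (ε * Z + k - ε * S) / ((1 + ε) * Z) := by field_simp; ring
    rw [e2, div_le_iff₀ (by positivity)]
    nlinarith [mul_le_mul_of_nonneg_left hS hε]
  rw [e]
  linarith

lemma one_le_plaqProd (hq : 5 ≤ q) {B₁ B₂ B₃ B₄ : Finset (Fin q)} (h1 : B₁.card ≤ 3)
    (h2 : B₂.card ≤ 3) (h3 : B₃.card ≤ 3) (h4 : B₄.card ≤ 3) (s : Fin q) :
    1 ≤ plaqProd B₁ B₂ B₃ B₄ s := by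
  have e1 := enh_nonneg hq h1 s
  have e2 := enh_nonneg hq h2 s
  have e3 := enh_nonneg hq h3 s
  have e4 := enh_nonneg hq h4 s
  have := one_add_sum_le_mul e1 e2 e3 e4
  unfold plaqProd
  linarith

lemma exc_mul_exc_le_nnCoeff (hq : 5 ≤ q) : exc q 1 * exc q 3 ≤ nnCoeff q := by
  rcases hq.eq_or_lt with rfl | hq
  · norm_num [nnCoeff, exc]
  · obtain ⟨m, hm, hQ⟩ := exists_eq_add_six hq
    rw [hQ, nnCoeff_add_six hm]
    simp only [exc_add_six]
    field_simp
    rw [← sub_nonneg]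
    ring_nf
    positivity

/-- `exc q 1 * exc q 3` is the relative gain of a colour already present when its plaquette passes
from two to three other colours. -/
lemma one_add_exc_three (hq : 5 ≤ q) :
    1 + exc q 3 = (1 + exc q 1 * exc q 3) * (1 + exc q 2) := by
  obtain ⟨m, hm, hQ⟩ := exists_eq_add_five hq
  rw [hQ]
  simp only [exc_add_five]
  field_simp
  ring

set_option maxHeartbeats 1000000 in
/-- `α`, `β` are new in the first plaquette; in the second one `α` is present and `β` is new. -/
lemma tvLe_fresh_mixed (hq : 5 ≤ q) {D₁ D₂ B₃ B₄ : Finset (Fin q)} (h1 : D₁.card ≤ 2)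
    (h2 : D₂.card ≤ 2) (h3 : B₃.card ≤ 3) (h4 : B₄.card ≤ 3) (hD1 : D₁.Nonempty)
    (hB3 : B₃.Nonempty) (hB4 : B₄.Nonempty) {α β : Fin q} (hα1 : α ∉ D₁)
    (hβ1 : β ∉ D₁) (hα2 : α ∈ D₂) (hβ2 : β ∉ D₂) :
    TVLe (plaqProd (insert α D₁) D₂ B₃ B₄)
      (plaqProd (insert β D₁) (insert β D₂) B₃ B₄) (nnCoeff q) := by
  have hαβ : α ≠ β := fun h => hβ2 (h ▸ hα2)
  have hq' := cast_five_le hq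
  have hc := nnCoeff_nonneg hq
  have hx := exc_pos hq (le_refl 3)
  have p1 : 0 < exc q (D₁.card + 1) := exc_pos hq (by omega)
  have p2 : 0 < exc q D₂.card := exc_pos hq (by omega)
  have p2' : 0 < exc q (D₂.card + 1) := exc_pos hq (by omega)
  have p22 : exc q D₂.card ≤ exc q (D₂.card + 1) := exc_le_exc hq (by omega) (by omega)
  have p3 := exc_pos hq h3
  have p4 := exc_pos hq h4
  have c1 := card_insert_le_three h1
  have c2 := card_insert_le_three h2
  have o1 := card_eq_one_or_two h1 hD1
  have o2 := card_eq_one_or_two h2 ⟨α, hα2⟩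
  have n3 : ∀ s, 0 ≤ enh B₃ s := enh_nonneg hq h3
  have n4 : ∀ s, 0 ≤ enh B₄ s := enh_nonneg hq h4
  have nx := mixed_loss_le hq o1 o2
  have ng := mixed_gain_le hq o1 o2
  have nm := mixed_gain_mono hq o1 o2
  have ns := le_excRatio_sq hq o1 o2
  have hξ0 : 0 ≤ (1 + exc q (D₁.card + 1)) * (1 + exc q D₂.card) - (1 + exc q (D₂.card + 1)) := by
    rcases o1 with o1 | o1 <;> rcases o2 with o2 | o2 <;> rw [o1, o2] <;>
    · obtain ⟨m, hm, hQ⟩ := exists_eq_add_five hq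
      rw [hQ]
      simp only [exc_add_five, Nat.reduceAdd]
      rw [sub_nonneg]
      field_simp
      rw [← sub_nonneg]
      ring_nf
      positivity
  set w := plaqProd (insert α D₁) D₂ B₃ B₄ with hw
  set w' := plaqProd (insert β D₁) (insert β D₂) B₃ B₄ with hw'
  have hw0 : ∀ s, 0 < w s := plaqProd_pos hq (c1 α) (by omega) h3 h4
  have hw0' : ∀ s, 0 < w' s := plaqProd_pos hq (c1 β) (c2 β) h3 h4
  set f : Fin q → ℝ := fun s => (1 + enh B₃ s) * (1 + enh B₄ s) with hf
  have hf1 : ∀ s, 1 ≤ f s := fun s => by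
    have a3 := n3 s
    have a4 := n4 s
    simp only [hf]
    nlinarith [mul_nonneg a3 a4]
  set F := (1 + exc q B₃.card) * (1 + exc q B₄.card) with hF
  have hfF : ∀ s, f s ≤ F := fun s => by
    have a3 := n3 s
    have a4 := n4 s
    have b3 := enh_le hq h3 s
    have b4 := enh_le hq h4 s
    simp only [hf, hF]
    gcongr
  have hFx : F ≤ (1 + exc q 3) ^ 2 := by
    rw [sq, hF]
    have b3 := exc_le_exc_three hq h3
    have b4 := exc_le_exc_three hq h4
    gcongr
  have hF0 : 0 < F := lt_of_lt_of_le zero_lt_one ((hf1 α).trans (hfF α))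
  set x₁ := exc q (D₁.card + 1) with hx1d
  set x₂ := exc q D₂.card with hx2d
  set y₂ := exc q (D₂.card + 1) with hy2d
  set ξ := (1 + x₁) * (1 + x₂) - (1 + y₂) with hξ
  -- values of the two weights
  have wα : w α = f α * ((1 + x₁) * (1 + x₂)) := by
    rw [hw, plaqProd, enh_insert_self hα1, enh_of_mem hα2]; ring
  have wα' : w' α = f α * (1 + y₂) := by
    rw [hw', plaqProd, enh_insert_of_notMem hα1 hαβ, enh_insert_of_mem hβ2 hα2]; ring
  have wβ : w β = f β := by
    rw [hw, plaqProd, enh_insert_of_notMem hβ1 hαβ.symm, enh_of_notMem hβ2]; ring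
  have wβ' : w' β = ((1 + x₁) * (1 + y₂)) * f β := by
    rw [hw', plaqProd, enh_insert_self hβ1, enh_insert_self hβ2]
  have wD' : ∀ s, s ≠ α → s ∈ D₂ → w' s * (1 + x₂) = w s * (1 + y₂) := fun s hsα hs => by
    have hsβ : s ≠ β := fun h => hβ2 (h ▸ hs)
    rw [hw, hw', plaqProd, plaqProd, enh_insert_of_mem hβ2 hs, enh_of_mem hs,
      enh_insert_eq hα1 hβ1 hsα hsβ]
    ring
  have wO' : ∀ s, s ≠ α → s ≠ β → s ∉ D₂ → w' s = w s := fun s hsα hsβ hs => by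
    rw [hw, hw', plaqProd, plaqProd, enh_insert_of_notMem hs hsβ, enh_of_notMem hs,
      enh_insert_eq hα1 hβ1 hsα hsβ]
  obtain ⟨κ, hκd⟩ : ∃ κ, κ = excRatio q D₁.card D₂.card := ⟨_, rfl⟩
  rw [← hκd] at ng nm ns
  clear_value ξ w w' f F x₁ x₂ y₂
  have hv1 : 1 ≤ (1 + x₁) * (1 + y₂) :=
    one_le_mul_of_one_le_of_one_le (by linarith only [p1]) (by linarith only [p2'])
  have hle : ∀ s, s ≠ α → w s ≤ w' s := fun s hsα => by
    by_cases hsβ : s = β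
    · rw [hsβ, wβ, wβ']
      exact le_mul_of_one_le_left (zero_le_one.trans (hf1 β)) hv1
    by_cases hs : s ∈ D₂
    · have := wD' s hsα hs
      refine le_of_mul_le_mul_right ?_ (by linarith : 0 < 1 + x₂)
      rw [this]
      exact mul_le_mul_of_nonneg_left (by linarith) (hw0 s).le
    · rw [wO' s hsα hsβ hs]
  have hαle : w' α ≤ w α := by
    rw [wα, wα']
    exact mul_le_mul_of_nonneg_left (by linarith) (by linarith [hf1 α])
  have hαdiff : w α - w' α = f α * ξ := by rw [wα, wα', hξ]; ring
  have hZ : 0 < ∑ s, w s := Finset.sum_pos (fun s _ => hw0 s) ⟨α, Finset.mem_univ _⟩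
  have hZ' : 0 < ∑ s, w' s := Finset.sum_pos (fun s _ => hw0' s) ⟨α, Finset.mem_univ _⟩
  have hZα := Finset.add_sum_erase Finset.univ w (Finset.mem_univ α)
  have hZβ := Finset.add_sum_erase Finset.univ w (Finset.mem_univ β)
  have hZβ' := Finset.add_sum_erase Finset.univ w' (Finset.mem_univ β)
  -- a lower bound for the total weight of the other colours
  have hlow : ∀ (γ : Fin q) (v : Fin q → ℝ) (r : ℝ), 0 ≤ r →
      q - 1 + r + ∑ s ∈ Finset.univ.erase γ, enh B₃ s + ∑ s ∈ Finset.univ.erase γ, enh B₄ s ≤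
        ∑ s ∈ Finset.univ.erase γ, v s →
      (q - 1 + 4 * exc q 3 + r) / (1 + exc q 3) ^ 2 * F ≤ ∑ s ∈ Finset.univ.erase γ, v s :=
    fun γ v r hr hv => by
      have r3 := enh_reduce hq h3 hB3 γ (R := q - 1 + r + 2 * exc q 3) (by linarith)
      have s3 : 0 ≤ ∑ s ∈ Finset.univ.erase γ, enh B₃ s := Finset.sum_nonneg fun s _ => n3 s
      have r4 := enh_reduce hq h4 hB4 γ (R := q - 1 + r + ∑ s ∈ Finset.univ.erase γ, enh B₃ s)
        (by linarith)
      refine mul_le_of_mul_le_mul_sq (by positivity) (le_trans ?_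
        (mul_le_mul_of_nonneg_right hv (by positivity)))
      rw [hF]
      calc (q - 1 + 4 * exc q 3 + r) * ((1 + exc q B₃.card) * (1 + exc q B₄.card))
          = (q - 1 + r + 2 * exc q 3 + 2 * exc q 3) * (1 + exc q B₃.card) *
              (1 + exc q B₄.card) := by ring
        _ ≤ (q - 1 + r + 2 * exc q 3 + ∑ s ∈ Finset.univ.erase γ, enh B₃ s) * (1 + exc q 3) *
              (1 + exc q B₄.card) := mul_le_mul_of_nonneg_right r3 (by positivity)
        _ = (q - 1 + r + ∑ s ∈ Finset.univ.erase γ, enh B₃ s + 2 * exc q 3) *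
              (1 + exc q B₄.card) * (1 + exc q 3) := by ring
        _ ≤ _ := mul_le_mul_of_nonneg_right r4 (by positivity)
        _ = _ := by ring
  have hsubα : D₁ ⊆ Finset.univ.erase α := fun s hs =>
    Finset.mem_erase.2 ⟨fun h => hα1 (h ▸ hs), Finset.mem_univ _⟩
  have hsubβ : D₁ ⊆ Finset.univ.erase β := fun s hs =>
    Finset.mem_erase.2 ⟨fun h => hβ1 (h ▸ hs), Finset.mem_univ _⟩
  have hsubβ2 : D₂ ⊆ Finset.univ.erase β := fun s hs =>
    Finset.mem_erase.2 ⟨fun h => hβ2 (h ▸ hs), Finset.mem_univ _⟩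
  have hrestα : (q - 1 + 4 * exc q 3 + (D₁.card * x₁ + (D₂.card - 1 : ℕ) * x₂)) /
      (1 + exc q 3) ^ 2 * F ≤ ∑ s ∈ Finset.univ.erase α, w s := by
    refine hlow α w _ (by positivity) (le_trans ?_ ((card_add_sum_enh_le hq (c1 α)
      (by omega : D₂.card ≤ 3) h3 h4 _).trans_eq (by rw [hw])))
    have t1 := card_mul_exc_le_sum_enh_insert hq h1 hα1 hsubα
    have t2 := card_mul_exc_le_sum_enh hq (S := Finset.univ.erase α) (B := D₂) (by omega)
      (n := D₂.card - 1) (by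
        rw [Finset.erase_inter, Finset.univ_inter]
        exact Finset.pred_card_le_card_erase)
    rw [card_erase_univ]
    rw [← hx1d] at t1
    rw [← hx2d] at t2
    linarith
  have hρ : (q - 1 + 4 * exc q 3) / (1 + exc q 3) ^ 2 * f α ≤
      ∑ s ∈ Finset.univ.erase α, w s := by
    refine le_trans (mul_le_mul ?_ (hfF α) (by linarith [hf1 α]) ?_) hrestα
    · refine div_le_div_of_nonneg_right ?_ (by positivity)
      have : 0 ≤ D₁.card * x₁ + (D₂.card - 1 : ℕ) * x₂ := by positivity
      linarith
    · refine div_nonneg ?_ (by positivity)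
      have : 0 ≤ D₁.card * x₁ + (D₂.card - 1 : ℕ) * x₂ := by positivity
      linarith
  by_cases hcase : ∑ s, w' s ≤ ∑ s, w s
  · -- only `α` loses
    refine TVLe.symm ?_ hZ' hZ
    refine tvLe_of_gain_singleton α hc (fun s hs => ?_) ?_
    · exact div_le_div₀ (hw0' s).le (hle s hs) hZ' hcase
    · have h5 : w' α / ∑ s, w s ≤ w' α / ∑ s, w' s :=
        div_le_div_of_nonneg_left (hw0' α).le hZ' hcase
      have h6 : w α / ∑ s, w s - w' α / ∑ s, w s ≤ nnCoeff q := by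
        rw [← sub_div, hαdiff, div_le_iff₀ hZ, ← hZα, wα]
        have h7 := mul_le_mul_of_nonneg_left nx (by linarith [hf1 α] : 0 ≤ f α)
        have h8 := mul_le_mul_of_nonneg_left hρ hc
        linarith
      linarith
  rw [not_le] at hcase
  by_cases hmore : ∃ y ∈ D₂, y ≠ α ∧ w y / ∑ s, w s < w' y / ∑ s, w' s
  · -- `β` and one further colour gain
    obtain ⟨y, hyD, hyα, hy⟩ := hmore
    have hyβ : y ≠ β := fun h => hβ2 (h ▸ hyD)
    have hcard : D₂.card = 2 := by
      refine o2.resolve_left fun h => hyα ?_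
      obtain ⟨z, hz⟩ := Finset.card_eq_one.1 h
      rw [hz, Finset.mem_singleton] at hyD hα2
      rw [hyD, hα2]
    have hD2eq : D₂ = {α, y} := by
      refine (Finset.eq_of_subset_of_card_le (fun s hs => ?_) ?_).symm
      · rcases Finset.mem_insert.1 hs with rfl | hs
        · exact hα2
        · rwa [Finset.mem_singleton.1 hs]
      · rw [hcard, Finset.card_pair hyα.symm]
    have hx2e : x₂ = exc q 2 := by rw [hx2d, hcard]
    have hy2e : y₂ = exc q 3 := by rw [hy2d, hcard]
    obtain ⟨ε, hε⟩ : ∃ ε, ε = exc q 1 * exc q 3 := ⟨_, rfl⟩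
    have hε0 : 0 ≤ ε := by
      rw [hε]
      exact mul_nonneg (exc_pos hq (by norm_num)).le hx.le
    have hεx : 1 + y₂ = (1 + ε) * (1 + x₂) := by
      rw [hx2e, hy2e, hε]; exact one_add_exc_three hq
    have wy' : w' y = (1 + ε) * w y := by
      refine mul_right_cancel₀ (by linarith : 1 + x₂ ≠ 0) ?_
      rw [wD' y hyα hyD, hεx]; ring
    -- The colour `y` gains probability although its weight grows only by `1 + ε`, so the total
    -- grows by less than that.
    have hZ'ε : ∑ s, w' s ≤ (1 + ε) * ∑ s, w s := by
      rw [div_lt_div_iff₀ hZ hZ', wy'] at hy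
      have : w y * ∑ s, w' s < w y * ((1 + ε) * ∑ s, w s) := by linarith
      exact (lt_of_mul_lt_mul_left this (hw0 y).le).le
    have hother : ∀ s, s ∉ ({β, y} : Finset (Fin q)) → s ≠ α → w' s = w s := fun s hs hsα => by
      simp only [Finset.mem_insert, Finset.mem_singleton, not_or] at hs
      exact wO' s hsα hs.1 (by rw [hD2eq]; simp [hsα, hs.2])
    have hvε : 1 + ε ≤ (1 + x₁) * (1 + y₂) := by
      refine le_trans ?_ (le_mul_of_one_le_left (by linarith only [p2'])
        (by linarith only [p1]))
      rw [hεx]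
      exact le_mul_of_one_le_right (by linarith only [hε0]) (by linarith only [p2])
    refine tvLe_of_gain {β, y} (fun s hs => ?_) (fun s hs => ?_) ?_
    · rcases Finset.mem_insert.1 hs with rfl | hs
      · rw [div_le_div_iff₀ hZ hZ', wβ, wβ']
        have h9 := mul_le_mul_of_nonneg_right hvε hZ.le
        have h10 := mul_le_mul_of_nonneg_left (hZ'ε.trans h9) (by linarith [hf1 s] : 0 ≤ f s)
        linarith
      · rw [Finset.mem_singleton.1 hs]; exact hy.le
    · by_cases hsα : s = α
      · rw [hsα]
        exact div_le_div₀ (hw0 α).le hαle hZ hcase.le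
      · rw [hother s hs hsα]
        exact div_le_div_of_nonneg_left (hw0 s).le hZ hcase.le
    · rw [Finset.sum_pair hyβ.symm, Finset.sum_pair hyβ.symm]
      have hdiff : ∑ s, w' s - ∑ s, w s = (w' β - w β) + (w' y - w y) + (w' α - w α) := by
        rw [← Finset.sum_sub_distrib, ← Finset.sum_subset (Finset.subset_univ {β, y, α})]
        · rw [Finset.sum_insert (by simp [hyβ.symm, hαβ.symm]), Finset.sum_pair hyα]; ring
        · intro s _ hs
          simp only [Finset.mem_insert, Finset.mem_singleton, not_or] at hs
          rw [hother s (by simp [hs.1, hs.2.1]) hs.2.2, sub_self]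
      have hpart : w β + w y + w α ≤ ∑ s, w s := by
        have : w β + w y + w α = ∑ s ∈ {β, y, α}, w s := by
          rw [Finset.sum_insert (by simp [hyβ.symm, hαβ.symm]), Finset.sum_pair hyα]; ring
        rw [this]
        exact Finset.sum_le_sum_of_subset_of_nonneg (Finset.subset_univ _)
          fun s _ _ => (hw0 s).le
      have hwy1 : 1 ≤ w y := by
        rw [hw]
        exact one_le_plaqProd hq (c1 α) (by omega) h3 h4 y
      refine double_gain_le (k := f α * ξ) (ε := ε) hZ hcase.le hε0 hZ'ε
        (by rw [wβ]; linarith [hf1 β]) ?_ ?_ ?_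
      · have := (hw0' α).le
        linarith
      · linarith
      · have nd := mixed_double_gain_le hq o1
        have hcε : 0 ≤ (1 + ε) * nnCoeff q - ε := by
          have := exc_mul_exc_le_nnCoeff hq
          rw [← hε] at this
          exact sub_nonneg.2 (this.trans (le_mul_of_one_le_left hc (by linarith only [hε0])))
        have hZlow : f α * ((1 + x₁) * (1 + x₂) + (q - 1 + 4 * exc q 3 + D₁.card * x₁ + x₂) /
            (1 + exc q 3) ^ 2) ≤ ∑ s, w s := by
          rw [← hZα, wα, mul_add]
          refine add_le_add le_rfl (le_trans ?_ hrestα)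
          rw [hcard]
          push_cast
          rw [one_mul, mul_comm, add_assoc (_ + _)]
          refine mul_le_mul_of_nonneg_left (hfF α) (div_nonneg ?_ (by positivity))
          have : 0 ≤ D₁.card * x₁ + x₂ := by positivity
          linarith
        have h11 := mul_le_mul_of_nonneg_left hZlow hcε
        rw [← hε, ← hx1d, ← hx2e, ← hy2e, ← hξ] at nd
        rw [← hy2e] at h11 hFx
        generalize (1 + x₁) * (1 + x₂) + (q - 1 + 4 * y₂ + D₁.card * x₁ + x₂) / (1 + y₂) ^ 2 = G
          at nd h11
        -- The bound on `f α` is useful only when the bracket is nonnegative; otherwise the left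
        -- side is nonpositive.
        have h12 : f α * (ξ - ((1 + ε) * nnCoeff q - ε) * G) ≤ 2 * ε := by
          rcases le_total 0 (ξ - ((1 + ε) * nnCoeff q - ε) * G) with hs | hs
          · exact (mul_le_mul_of_nonneg_right ((hfF α).trans hFx) hs).trans nd
          · exact (mul_nonpos_of_nonneg_of_nonpos (by linarith [hf1 α]) hs).trans (by linarith)
        linarith
  · -- only `β` gains
    push Not at hmore
    refine tvLe_of_gain_singleton β hc (fun s hsβ => ?_) ?_
    · by_cases hsα : s = α
      · rw [hsα]
        exact div_le_div₀ (hw0 α).le hαle hZ hcase.le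
      · by_cases hs : s ∈ D₂
        · exact hmore s hs hsα
        · rw [wO' s hsα hsβ hs]
          exact div_le_div_of_nonneg_left (hw0 s).le hZ hcase.le
    · rw [← hZβ, ← hZβ', wβ, wβ']
      have hC : κ * F ≤ ∑ s ∈ Finset.univ.erase β, w' s := by
        have e : κ =
            (q - 1 + 4 * exc q 3 + (D₁.card * x₁ + D₂.card * y₂)) / (1 + exc q 3) ^ 2 := by
          rw [hκd, excRatio, ← hx1d, ← hy2d, add_assoc (_ + _)]
        rw [e]
        refine hlow β w' _ (by positivity) (le_trans ?_ ((card_add_sum_enh_le hq (c1 β)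
          (c2 β) h3 h4 _).trans_eq (by rw [hw'])))
        have t1 := card_mul_exc_le_sum_enh_insert hq h1 hβ1 hsubβ
        have t2 := card_mul_exc_le_sum_enh_insert hq h2 hβ2 hsubβ2
        rw [← hx1d] at t1
        rw [← hy2d] at t2
        rw [card_erase_univ]
        linarith
      have hκ : 0 < κ := by
        rw [hκd, excRatio, ← hx1d, ← hy2d]
        refine div_pos ?_ (by positivity)
        have : 0 ≤ D₁.card * x₁ + D₂.card * y₂ := by positivity
        linarith
      have hRC : ∑ s ∈ Finset.univ.erase β, w s ≤
          ∑ s ∈ Finset.univ.erase β, w' s + F * ξ := by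
        have hαm : α ∈ Finset.univ.erase β := Finset.mem_erase.2 ⟨hαβ, Finset.mem_univ _⟩
        rw [← Finset.add_sum_erase _ w hαm, ← Finset.add_sum_erase _ w' hαm]
        have h13 : ∑ s ∈ (Finset.univ.erase β).erase α, w s ≤
            ∑ s ∈ (Finset.univ.erase β).erase α, w' s :=
          Finset.sum_le_sum fun s hs => hle s (Finset.ne_of_mem_erase hs)
        have h14 := mul_le_mul_of_nonneg_right (hfF α) hξ0
        linarith
      exact gain_le (lt_of_lt_of_le zero_lt_one (hf1 β)) (hfF β) hκ hv1 hξ0 hc hC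
        (Finset.sum_nonneg fun s _ => (hw0 s).le) hRC ns ng nm

end MixedCase

/-! ### Assembling the upper bounds for both kinds of neighbours -/

section FinalBounds

variable {q : ℕ}

lemma sum_plaqProd_pos (hq : 5 ≤ q) {B₁ B₂ B₃ B₄ : Finset (Fin q)} (h1 : B₁.card ≤ 3)
    (h2 : B₂.card ≤ 3) (h3 : B₃.card ≤ 3) (h4 : B₄.card ≤ 3) :
    0 < ∑ s, plaqProd B₁ B₂ B₃ B₄ s :=
  Finset.sum_pos (fun s _ => plaqProd_pos hq h1 h2 h3 h4 s) ⟨⟨0, by omega⟩, Finset.mem_univ _⟩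

/-- One neighbour that lies in two plaquettes, when its colours are new in the first one. -/
lemma tvLe_nearest_fresh (hq : 5 ≤ q) {D₁ D₂ B₃ B₄ : Finset (Fin q)} (h1 : D₁.card ≤ 2)
    (h2 : D₂.card ≤ 2) (h3 : B₃.card ≤ 3) (h4 : B₄.card ≤ 3) {e w : Fin q} (he1 : e ∈ D₁)
    (he3 : e ∈ B₃) (hw2 : w ∈ D₂) (hw4 : w ∈ B₄) {α β : Fin q} (hαβ : α ≠ β) (hα1 : α ∉ D₁)
    (hβ1 : β ∉ D₁) :
    TVLe (plaqProd (insert α D₁) (insert α D₂) B₃ B₄)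
      (plaqProd (insert β D₁) (insert β D₂) B₃ B₄) (nnCoeff q) := by
  by_cases hα2 : α ∈ D₂ <;> by_cases hβ2 : β ∈ D₂
  · rw [Finset.insert_eq_of_mem hα2, Finset.insert_eq_of_mem hβ2]
    exact tvLe_fresh_neutral hq h1 (by omega) h3 h4 hαβ hα1 hβ1
  · rw [Finset.insert_eq_of_mem hα2]
    exact tvLe_fresh_mixed hq h1 h2 h3 h4 ⟨e, he1⟩ ⟨e, he3⟩ ⟨w, hw4⟩ hα1 hβ1 hα2 hβ2
  · rw [Finset.insert_eq_of_mem hβ2]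
    exact (tvLe_fresh_mixed hq h1 h2 h3 h4 ⟨e, he1⟩ ⟨e, he3⟩ ⟨w, hw4⟩ hβ1 hα1 hβ2 hα2).symm
      (sum_plaqProd_pos hq (card_insert_le_three h1 β) (by omega) h3 h4)
      (sum_plaqProd_pos hq (card_insert_le_three h1 α) (card_insert_le_three h2 α) h3 h4)
  · exact tvLe_fresh_fresh hq h1 h2 h3 h4 he1 he3 hw2 hw4 hαβ hα1 hβ1 hα2 hβ2

/-- The effect of changing a site that lies in two of the four plaquettes. -/
lemma tvLe_nearest (hq : 5 ≤ q) {D₁ D₂ B₃ B₄ : Finset (Fin q)} (h1 : D₁.card ≤ 2)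
    (h2 : D₂.card ≤ 2) (h3 : B₃.card ≤ 3) (h4 : B₄.card ≤ 3) {e w : Fin q} (he1 : e ∈ D₁)
    (he3 : e ∈ B₃) (hw2 : w ∈ D₂) (hw4 : w ∈ B₄) (α β : Fin q) :
    TVLe (plaqProd (insert α D₁) (insert α D₂) B₃ B₄)
      (plaqProd (insert β D₁) (insert β D₂) B₃ B₄) (nnCoeff q) := by
  by_cases hαβ : α = β
  · rw [hαβ]; exact TVLe.refl _ (nnCoeff_nonneg hq)
  by_cases hf1 : α ∉ D₁ ∧ β ∉ D₁
  · exact tvLe_nearest_fresh hq h1 h2 h3 h4 he1 he3 hw2 hw4 hαβ hf1.1 hf1.2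
  by_cases hf2 : α ∉ D₂ ∧ β ∉ D₂
  · rw [plaqProd_swap (insert α D₁), plaqProd_swap (insert β D₁)]
    exact tvLe_nearest_fresh hq h2 h1 h4 h3 hw2 hw4 he1 he3 hαβ hf2.1 hf2.2
  have g1 : α ∈ D₁ ∨ β ∈ D₁ := by tauto
  have g2 : α ∈ D₂ ∨ β ∈ D₂ := by tauto
  -- The intermediate law has `β` in the first plaquette and still `α` in the second.
  have s1 := tvLe_change_colour hq h1 (card_insert_le_three h2 α) h3 h4
    (Finset.insert_nonempty _ _) ⟨e, he3⟩ ⟨w, hw4⟩ g1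
  have s2 := tvLe_change_colour hq h2 (card_insert_le_three h1 β) h4 h3
    (Finset.insert_nonempty _ _) ⟨w, hw4⟩ ⟨e, he3⟩ g2
  rw [plaqProd_swap (insert α D₂), plaqProd_swap (insert β D₂)] at s2
  exact (s1.trans s2).mono (by linarith [two_mul_stepBound_le hq])

/-- The effect of changing a site that lies in one of the four plaquettes. -/
lemma tvLe_diagonal (hq : 5 ≤ q) {D₁ B₂ B₃ B₄ : Finset (Fin q)} (h1 : D₁.card ≤ 2)
    (h2 : B₂.card ≤ 3) (h3 : B₃.card ≤ 3) (h4 : B₄.card ≤ 3) (hB4 : B₄.Nonempty) {a b : Fin q}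
    (ha1 : a ∈ D₁) (ha2 : a ∈ B₂) (hb1 : b ∈ D₁) (hb3 : b ∈ B₃) (α β : Fin q) :
    TVLe (plaqProd (insert α D₁) B₂ B₃ B₄) (plaqProd (insert β D₁) B₂ B₃ B₄) (nnnCoeff q) := by
  by_cases hαβ : α = β
  · rw [hαβ]; exact TVLe.refl _ (nnnCoeff_nonneg hq)
  by_cases hf1 : α ∉ D₁ ∧ β ∉ D₁
  · exact tvLe_fresh_diagonal hq h1 h2 h3 h4 hB4 ha1 ha2 hb1 hb3 hαβ hf1.1 hf1.2
  · exact (tvLe_change_colour hq h1 h2 h3 h4 ⟨a, ha2⟩ ⟨b, hb3⟩ hB4 (by tauto)).mono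
      (stepBound_le_nnnCoeff hq)

end FinalBounds

/-! ### The interdependence coefficients of the decimated system -/

section Coefficients

variable {q : ℕ}

/-- The conditional probability that the spin at `i` equals `s`. -/
def siteProb (q : ℕ) (i : EvenSite) (t : EvenSite → Fin q) (s : Fin q) : ℝ :=
  decimatedWeight q {i} (Function.update t i s) /
    ∑ s', decimatedWeight q {i} (Function.update t i s')

lemma sum_decimatedWeight_pos (hq : 5 ≤ q) (i : EvenSite) (t : EvenSite → Fin q) :
    0 < ∑ s, decimatedWeight q {i} (Function.update t i s) := by
  rw [← sumOver_singleton]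
  exact (goodWeight_decimated hq).pos {i} t

lemma siteProb_nonneg (hq : 5 ≤ q) (i : EvenSite) (t : EvenSite → Fin q) (s : Fin q) :
    0 ≤ siteProb q i t s :=
  div_nonneg ((goodWeight_decimated hq).nonneg _ _) (sum_decimatedWeight_pos hq i t).le

lemma sum_siteProb (hq : 5 ≤ q) (i : EvenSite) (t : EvenSite → Fin q) :
    ∑ s, siteProb q i t s = 1 := by
  unfold siteProb
  rw [← Finset.sum_div, div_self (sum_decimatedWeight_pos hq i t).ne']

lemma gibbsAvg_decimated_singleton (i : EvenSite) (f : (EvenSite → Fin q) → ℝ)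
    (t : EvenSite → Fin q) : gibbsAvg (decimatedWeight q) {i} f t =
      ∑ s, siteProb q i t s * f (Function.update t i s) := by
  unfold gibbsAvg siteProb
  rw [sumOver_singleton, sumOver_singleton, Finset.sum_div]
  exact Finset.sum_congr rfl fun s _ => by ring

lemma singleSpin_real (hq : 5 ≤ q) (i : EvenSite) (t : EvenSite → Fin q) (A : Finset (Fin q)) :
    (singleSpin (decimatedSpec q) i t).real A = ∑ s ∈ A, siteProb q i t s := by
  have hA : MeasurableSet ((A : Set (Fin q))) := A.measurableSet
  have hm : Measurable (fun σ : EvenSite → Fin q => σ i) := measurable_pi_apply i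
  rw [singleSpin, map_measureReal_apply hm hA, decimatedSpec,
    (goodWeight_decimated hq).gibbsKernel_real _ _ (hm hA), gibbsAvg_decimated_singleton,
    ← Finset.sum_filter_add_sum_filter_not Finset.univ (· ∈ A)]
  rw [Finset.sum_eq_zero (s := Finset.univ.filter (· ∉ A)), add_zero]
  · rw [Finset.filter_mem_eq_inter, Finset.univ_inter]
    exact Finset.sum_congr rfl fun s hs => by simp [hs]
  · intro s hs
    simp [(Finset.mem_filter.1 hs).2]

lemma varDist_eq_iSup {E : Type} [Fintype E] [DecidableEq E] [MeasurableSpace E]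
    [MeasurableSingletonClass E] (μ ν : Measure E) :
    varDist μ ν = ⨆ A : Finset E, ENNReal.ofReal |μ.real A - ν.real A| := by
  classical
  refine le_antisymm (iSup₂_le fun A _ => ?_) (iSup_le fun A => ?_)
  · refine le_iSup_of_le A.toFinset ?_
    rw [Set.coe_toFinset]
  · exact le_iSup₂_of_le (A : Set E) A.measurableSet le_rfl

lemma abs_sum_siteProb_le_dobrushinCoeff (hq : 5 ≤ q) {i j : EvenSite} {t t' : EvenSite → Fin q}
    (h : ∀ k, k ≠ j → t k = t' k) (A : Finset (Fin q)) :
    ENNReal.ofReal |∑ s ∈ A, siteProb q i t s - ∑ s ∈ A, siteProb q i t' s| ≤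
      dobrushinCoeff (decimatedSpec q) i j := by
  refine le_iSup₂_of_le t t' (le_iSup_of_le h ?_)
  rw [varDist_eq_iSup]
  refine le_iSup_of_le A ?_
  rw [singleSpin_real hq, singleSpin_real hq]

lemma dobrushinCoeff_le (hq : 5 ≤ q) {i j : EvenSite} {c : ℝ}
    (h : ∀ t t' : EvenSite → Fin q, (∀ k, k ≠ j → t k = t' k) → ∀ A : Finset (Fin q),
      ∑ s ∈ A, siteProb q i t' s - ∑ s ∈ A, siteProb q i t s ≤ c) :
    dobrushinCoeff (decimatedSpec q) i j ≤ ENNReal.ofReal c := by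
  refine iSup₂_le fun t t' => iSup_le fun htt => ?_
  rw [varDist_eq_iSup]
  refine iSup_le fun A => ENNReal.ofReal_le_ofReal ?_
  rw [singleSpin_real hq, singleSpin_real hq]
  exact abs_sub_le_iff.2 ⟨h t' t (fun k hk => (htt k hk).symm) A, h t t' htt A⟩

lemma dobrushinCoeff_ne_top (hq : 5 ≤ q) (i j : EvenSite) :
    dobrushinCoeff (decimatedSpec q) i j ≠ ∞ := by
  refine ne_top_of_le_ne_top ENNReal.ofReal_ne_top (dobrushinCoeff_le hq (c := 1) ?_)
  intro t t' _ A
  have h1 : ∑ s ∈ A, siteProb q i t' s ≤ 1 := by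
    rw [← sum_siteProb hq i t']
    exact Finset.sum_le_sum_of_subset_of_nonneg (Finset.subset_univ _)
      fun s _ _ => siteProb_nonneg hq i t' s
  have h2 : 0 ≤ ∑ s ∈ A, siteProb q i t s := Finset.sum_nonneg fun s _ => siteProb_nonneg hq i t s
  linarith

/-- The sites around `i`, with the four plaquettes to which they belong. -/
structure Patch (i N E W S NE NW SE SW : EvenSite) : Prop where
  nodup : [i, N, E, W, S, NE, NW, SE, SW].Nodup
  centers : ∃ x₁ x₂ x₃ x₄ : ℤ × ℤ, nbrs i.1 = {x₁, x₂, x₃, x₄} ∧ [x₁, x₂, x₃, x₄].Nodup ∧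
    plaquette x₁ = {i, N, E, NE} ∧ plaquette x₂ = {i, N, W, NW} ∧
    plaquette x₃ = {i, E, S, SE} ∧ plaquette x₄ = {i, W, S, SW}

set_option maxHeartbeats 2000000 in
-- `u` and `v` are perpendicular unit vectors and the plaquettes around the site are centred at its
-- translates by `±u` and `±v`. By the choice of `u` and `v` any nearest neighbour can play the part
-- of `N`, and any next-to-nearest neighbour that of `NE`, so symmetry needs no separate argument.
lemma exists_patch_aux {a b u₁ u₂ v₁ v₂ : ℤ} (hab : Even (a + b))
    (h : (u₁ = 1 ∨ u₁ = -1) ∧ u₂ = 0 ∧ v₁ = 0 ∧ (v₂ = 1 ∨ v₂ = -1) ∨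
      u₁ = 0 ∧ (u₂ = 1 ∨ u₂ = -1) ∧ (v₁ = 1 ∨ v₁ = -1) ∧ v₂ = 0) :
    ∃ N E W S NE NW SE SW : EvenSite, Patch ⟨(a, b), hab⟩ N E W S NE NW SE SW ∧
      N.1 = (a + u₁ + v₁, b + u₂ + v₂) ∧ E.1 = (a + u₁ - v₁, b + u₂ - v₂) ∧
      W.1 = (a - u₁ + v₁, b - u₂ + v₂) ∧ S.1 = (a - u₁ - v₁, b - u₂ - v₂) ∧
      NE.1 = (a + 2 * u₁, b + 2 * u₂) ∧ NW.1 = (a + 2 * v₁, b + 2 * v₂) ∧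
      SE.1 = (a - 2 * v₁, b - 2 * v₂) ∧ SW.1 = (a - 2 * u₁, b - 2 * u₂) := by
  refine ⟨⟨(a + u₁ + v₁, b + u₂ + v₂), ?_⟩, ⟨(a + u₁ - v₁, b + u₂ - v₂), ?_⟩,
    ⟨(a - u₁ + v₁, b - u₂ + v₂), ?_⟩, ⟨(a - u₁ - v₁, b - u₂ - v₂), ?_⟩,
    ⟨(a + 2 * u₁, b + 2 * u₂), ?_⟩, ⟨(a + 2 * v₁, b + 2 * v₂), ?_⟩,
    ⟨(a - 2 * v₁, b - 2 * v₂), ?_⟩, ⟨(a - 2 * u₁, b - 2 * u₂), ?_⟩, ⟨?_, ?_⟩,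
    rfl, rfl, rfl, rfl, rfl, rfl, rfl, rfl⟩
  iterate 8
    rw [Int.even_iff] at hab ⊢
    simp only
    omega
  · simp only [List.nodup_cons, List.mem_cons, List.not_mem_nil, Subtype.mk.injEq, Prod.mk.injEq,
      or_false, not_or, not_false_eq_true, List.nodup_nil, and_true]
    clear hab
    rcases h with ⟨rfl | rfl, rfl, rfl, rfl | rfl⟩ | ⟨rfl, rfl | rfl, rfl | rfl, rfl⟩ <;> omega
  · refine ⟨(a + u₁, b + u₂), (a + v₁, b + v₂), (a - v₁, b - v₂), (a - u₁, b - u₂),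
      ?_, ?_, ?_, ?_, ?_, ?_⟩
    · ext ⟨c, d⟩
      simp only [mem_nbrs, Finset.mem_insert, Finset.mem_singleton, Prod.mk.injEq]
      clear hab
      rcases h with ⟨rfl | rfl, rfl, rfl, rfl | rfl⟩ | ⟨rfl, rfl | rfl, rfl | rfl, rfl⟩ <;> omega
    · simp only [List.nodup_cons, List.mem_cons, List.not_mem_nil, Prod.mk.injEq,
        or_false, not_or, not_false_eq_true, List.nodup_nil, and_true]
      omega
    all_goals
      ext ⟨⟨c, d⟩, hcd⟩
      simp only [mem_plaquette, mem_nbrs, Finset.mem_insert, Finset.mem_singleton, Prod.mk.injEq,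
        Subtype.mk.injEq]
      clear hab hcd
      rcases h with ⟨rfl | rfl, rfl, rfl, rfl | rfl⟩ | ⟨rfl, rfl | rfl, rfl | rfl, rfl⟩ <;> omega

/-- The relative weights of the spins at the centre of a patch. -/
lemma Patch.exists_weight_eq {i N E W S NE NW SE SW : EvenSite}
    (P : Patch i N E W S NE NW SE SW) (hq : 5 ≤ q) (t : EvenSite → Fin q) :
    ∃ K : ℝ, K ≠ 0 ∧ (fun s => decimatedWeight q {i} (Function.update t i s)) = fun s =>
      K * plaqProd {t N, t E, t NE} {t N, t W, t NW} {t E, t S, t SE} {t W, t S, t SW} s := by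
  obtain ⟨x₁, x₂, x₃, x₄, hn, hnd, e1, e2, e3, e4⟩ := P.centers
  have hd := P.nodup
  simp only [List.nodup_cons, List.mem_cons, List.not_mem_nil, or_false, not_or,
    not_false_eq_true, List.nodup_nil, and_true] at hd hnd
  obtain ⟨⟨d1, d2, d3, d4, d5, d6, d7, d8⟩, -⟩ := hd
  have hcol : ∀ (x : ℤ × ℤ) (a b c : EvenSite), plaquette x = {i, a, b, c} → i ≠ a → i ≠ b →
      i ≠ c → ∀ s, (q : ℝ) - numColors x (Function.update t i s) =
        (q - 1 - ({t a, t b, t c} : Finset (Fin q)).card) * (1 + enh {t a, t b, t c} s) := by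
    intro x a b c hx ha hb hc s
    have h1 : (plaquette x).image (Function.update t i s) = insert s {t a, t b, t c} := by
      rw [hx]
      simp only [Finset.image_insert, Finset.image_singleton, Function.update_self,
        Function.update_of_ne ha.symm, Function.update_of_ne hb.symm,
        Function.update_of_ne hc.symm]
    have h2 : ({t a, t b, t c} : Finset (Fin q)).card ≤ 3 := Finset.card_le_three
    rw [numColors, h1]
    generalize ({t a, t b, t c} : Finset (Fin q)) = B at h2 ⊢
    have h3 : (B.card : ℝ) ≤ 3 := by exact_mod_cast h2
    have h4 := cast_five_le hq
    have h5 : (q : ℝ) - 1 - B.card ≠ 0 := by linarith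
    by_cases hs : s ∈ B
    · rw [Finset.insert_eq_of_mem hs, enh_of_mem hs, exc]
      field_simp
      ring
    · rw [Finset.card_insert_of_notMem hs, enh_of_notMem hs]
      push_cast
      ring
  have hne : ∀ B : Finset (Fin q), B.card ≤ 3 → (q : ℝ) - 1 - B.card ≠ 0 := fun B hB => by
    have h3 : (B.card : ℝ) ≤ 3 := by exact_mod_cast hB
    have h4 := cast_five_le hq
    linarith
  refine ⟨(q - 1 - ({t N, t E, t NE} : Finset (Fin q)).card) *
    (q - 1 - ({t N, t W, t NW} : Finset (Fin q)).card) *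
    (q - 1 - ({t E, t S, t SE} : Finset (Fin q)).card) *
    (q - 1 - ({t W, t S, t SW} : Finset (Fin q)).card),
    mul_ne_zero (mul_ne_zero (mul_ne_zero (hne _ Finset.card_le_three)
      (hne _ Finset.card_le_three)) (hne _ Finset.card_le_three)) (hne _ Finset.card_le_three),
    funext fun s => ?_⟩
  rw [decimatedWeight, _root_.centers, Finset.singleton_biUnion, hn,
    Finset.prod_insert (by simp; tauto), Finset.prod_insert (by simp; tauto),
    Finset.prod_insert (by simp; tauto), Finset.prod_singleton,
    hcol x₁ N E NE e1 d1 d2 d5, hcol x₂ N W NW e2 d1 d3 d6, hcol x₃ E S SE e3 d2 d4 d7,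
    hcol x₄ W S SW e4 d3 d4 d8, plaqProd]
  ring

lemma Patch.siteProb_eq {i N E W S NE NW SE SW : EvenSite}
    (P : Patch i N E W S NE NW SE SW) (hq : 5 ≤ q) (t : EvenSite → Fin q) (s : Fin q) :
    siteProb q i t s =
      plaqProd {t N, t E, t NE} {t N, t W, t NW} {t E, t S, t SE} {t W, t S, t SW} s /
      ∑ s, plaqProd {t N, t E, t NE} {t N, t W, t NW} {t E, t S, t SE} {t W, t S, t SW} s := by
  obtain ⟨K, hK, h⟩ := P.exists_weight_eq hq t
  have h1 := congrFun h s
  unfold siteProb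
  rw [h, h1, ← Finset.mul_sum, mul_div_mul_left _ _ hK]

lemma Patch.sum_siteProb_sub_le {i N E W S NE NW SE SW : EvenSite}
    (P : Patch i N E W S NE NW SE SW) (hq : 5 ≤ q) {t t' : EvenSite → Fin q} {c : ℝ}
    (h : TVLe (plaqProd {t N, t E, t NE} {t N, t W, t NW} {t E, t S, t SE} {t W, t S, t SW})
      (plaqProd {t' N, t' E, t' NE} {t' N, t' W, t' NW} {t' E, t' S, t' SE} {t' W, t' S, t' SW})
      c) (A : Finset (Fin q)) :
    ∑ s ∈ A, siteProb q i t' s - ∑ s ∈ A, siteProb q i t s ≤ c := by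
  have := h A
  rw [Finset.sum_div, Finset.sum_div] at this
  simpa only [P.siteProb_eq hq] using this

lemma Patch.dobrushinCoeff_nearest_le {i N E W S NE NW SE SW : EvenSite}
    (P : Patch i N E W S NE NW SE SW) (hq : 5 ≤ q) :
    dobrushinCoeff (decimatedSpec q) i N ≤ ENNReal.ofReal (nnCoeff q) := by
  refine dobrushinCoeff_le hq fun t t' h A => P.sum_siteProb_sub_le hq ?_ A
  have hd := P.nodup
  simp only [List.nodup_cons, List.mem_cons, List.not_mem_nil, or_false, not_or,
    not_false_eq_true, List.nodup_nil, and_true] at hd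
  obtain ⟨-, ⟨d1, d2, d3, d4, d5, d6, d7⟩, -⟩ := hd
  rw [← h E (Ne.symm d1), ← h W (Ne.symm d2), ← h S (Ne.symm d3), ← h NE (Ne.symm d4),
    ← h NW (Ne.symm d5), ← h SE (Ne.symm d6), ← h SW (Ne.symm d7)]
  exact tvLe_nearest hq Finset.card_le_two Finset.card_le_two Finset.card_le_three
    Finset.card_le_three (e := t E) (w := t W) (by simp) (by simp) (by simp) (by simp) _ _

lemma Patch.dobrushinCoeff_diagonal_le {i N E W S NE NW SE SW : EvenSite}
    (P : Patch i N E W S NE NW SE SW) (hq : 5 ≤ q) :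
    dobrushinCoeff (decimatedSpec q) i NE ≤ ENNReal.ofReal (nnnCoeff q) := by
  refine dobrushinCoeff_le hq fun t t' h A => P.sum_siteProb_sub_le hq ?_ A
  have hd := P.nodup
  simp only [List.nodup_cons, List.mem_cons, List.not_mem_nil, or_false, not_or,
    not_false_eq_true, List.nodup_nil, and_true] at hd
  obtain ⟨-, ⟨-, -, -, d4, -⟩, ⟨-, -, e4, -⟩, ⟨-, f4, -⟩, ⟨g4, -⟩, ⟨h1, h2, h3⟩, -⟩ := hd
  rw [← h N d4, ← h E e4, ← h W f4, ← h S g4, ← h NW (Ne.symm h1), ← h SE (Ne.symm h2),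
    ← h SW (Ne.symm h3)]
  have e : ∀ a, ({t N, t E, a} : Finset (Fin q)) = insert a {t N, t E} := fun a => by
    rw [Finset.pair_comm (t E) a, Finset.insert_comm]
  rw [e, e]
  exact tvLe_diagonal hq Finset.card_le_two Finset.card_le_three Finset.card_le_three
    Finset.card_le_three (Finset.insert_nonempty _ _) (a := t N) (b := t E) (by simp) (by simp)
    (by simp) (by simp) _ _

lemma Patch.dobrushinCoeff_eq_zero {i N E W S NE NW SE SW : EvenSite}
    (P : Patch i N E W S NE NW SE SW) (hq : 5 ≤ q) {j : EvenSite}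
    (hj : j ∉ ({N, E, W, S, NE, NW, SE, SW} : Finset EvenSite)) :
    dobrushinCoeff (decimatedSpec q) i j = 0 := by
  refine le_antisymm ((dobrushinCoeff_le hq (c := 0) fun t t' h A =>
    P.sum_siteProb_sub_le hq ?_ A).trans_eq ENNReal.ofReal_zero) zero_le
  simp only [Finset.mem_insert, Finset.mem_singleton, not_or] at hj
  obtain ⟨j1, j2, j3, j4, j5, j6, j7, j8⟩ := hj
  rw [← h N (Ne.symm j1), ← h E (Ne.symm j2), ← h W (Ne.symm j3), ← h S (Ne.symm j4),
    ← h NE (Ne.symm j5), ← h NW (Ne.symm j6), ← h SE (Ne.symm j7), ← h SW (Ne.symm j8)]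
  exact TVLe.refl _ le_rfl

end Coefficients

/-! ### Attaining configurations and the Dobrushin constant -/

section Attain

variable {q : ℕ}

lemma sum_eq_card_add {w : Fin q → ℝ} (T : Finset (Fin q)) (h : ∀ s, s ∉ T → w s = 1) :
    ∑ s, w s = q + ∑ s ∈ T, (w s - 1) := by
  have h1 : ∑ s ∈ T, (w s - 1) = ∑ s, (w s - 1) :=
    Finset.sum_subset (Finset.subset_univ _) fun s _ hs => by rw [h s hs, sub_self]
  rw [h1, Finset.sum_sub_distrib]
  simp

/-- Eight prescribed spins. -/
lemma Patch.exists_config {i N E W S NE NW SE SW : EvenSite} (P : Patch i N E W S NE NW SE SW)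
    (n e w s a b c d : Fin q) : ∃ t : EvenSite → Fin q, t N = n ∧ t E = e ∧ t W = w ∧ t S = s ∧
      t NE = a ∧ t NW = b ∧ t SE = c ∧ t SW = d := by
  have hd := P.nodup
  simp only [List.nodup_cons, List.mem_cons, List.not_mem_nil, or_false, not_or,
    not_false_eq_true, List.nodup_nil, and_true] at hd
  refine ⟨Function.update (Function.update (Function.update (Function.update (Function.update
    (Function.update (Function.update (Function.update (fun _ => n) N n) E e) W w) S s) NE a) NW b)
    SE c) SW d, ?_⟩
  simp [hd]

lemma Patch.le_dobrushinCoeff_nearest {i N E W S NE NW SE SW : EvenSite}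
    (P : Patch i N E W S NE NW SE SW) (hq : 5 ≤ q) (n n' e w s a b c d r : Fin q) :
    ENNReal.ofReal
      (plaqProd {n, e, a} {n, w, b} {e, s, c} {w, s, d} r /
        (∑ r, plaqProd {n, e, a} {n, w, b} {e, s, c} {w, s, d} r) -
      plaqProd {n', e, a} {n', w, b} {e, s, c} {w, s, d} r /
        ∑ r, plaqProd {n', e, a} {n', w, b} {e, s, c} {w, s, d} r) ≤
      dobrushinCoeff (decimatedSpec q) i N := by
  obtain ⟨t, h1, h2, h3, h4, h5, h6, h7, h8⟩ := P.exists_config n e w s a b c d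
  have hd := P.nodup
  simp only [List.nodup_cons, List.mem_cons, List.not_mem_nil, or_false, not_or,
    not_false_eq_true, List.nodup_nil, and_true] at hd
  obtain ⟨-, ⟨d1, d2, d3, d4, d5, d6, d7⟩, -⟩ := hd
  refine le_trans (ENNReal.ofReal_le_ofReal (le_trans (le_of_eq ?_) (le_abs_self _)))
    (abs_sum_siteProb_le_dobrushinCoeff hq (t := t) (t' := Function.update t N n')
      (fun k hk => (Function.update_of_ne hk _ _).symm) {r})
  rw [Finset.sum_singleton, Finset.sum_singleton, P.siteProb_eq hq, P.siteProb_eq hq,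
    Function.update_self, Function.update_of_ne (Ne.symm d1), Function.update_of_ne (Ne.symm d2),
    Function.update_of_ne (Ne.symm d3), Function.update_of_ne (Ne.symm d4),
    Function.update_of_ne (Ne.symm d5), Function.update_of_ne (Ne.symm d6),
    Function.update_of_ne (Ne.symm d7), h1, h2, h3, h4, h5, h6, h7, h8]

lemma Patch.le_dobrushinCoeff_diagonal {i N E W S NE NW SE SW : EvenSite}
    (P : Patch i N E W S NE NW SE SW) (hq : 5 ≤ q) (n e w s a a' b c d r : Fin q) :
    ENNReal.ofReal
      (plaqProd {n, e, a} {n, w, b} {e, s, c} {w, s, d} r /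
        (∑ r, plaqProd {n, e, a} {n, w, b} {e, s, c} {w, s, d} r) -
      plaqProd {n, e, a'} {n, w, b} {e, s, c} {w, s, d} r /
        ∑ r, plaqProd {n, e, a'} {n, w, b} {e, s, c} {w, s, d} r) ≤
      dobrushinCoeff (decimatedSpec q) i NE := by
  obtain ⟨t, h1, h2, h3, h4, h5, h6, h7, h8⟩ := P.exists_config n e w s a b c d
  have hd := P.nodup
  simp only [List.nodup_cons, List.mem_cons, List.not_mem_nil, or_false, not_or,
    not_false_eq_true, List.nodup_nil, and_true] at hd
  obtain ⟨-, ⟨-, -, -, d4, -⟩, ⟨-, -, e4, -⟩, ⟨-, f4, -⟩, ⟨g4, -⟩, ⟨k1, k2, k3⟩, -⟩ := hd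
  refine le_trans (ENNReal.ofReal_le_ofReal (le_trans (le_of_eq ?_) (le_abs_self _)))
    (abs_sum_siteProb_le_dobrushinCoeff hq (t := t) (t' := Function.update t NE a')
      (fun k hk => (Function.update_of_ne hk _ _).symm) {r})
  rw [Finset.sum_singleton, Finset.sum_singleton, P.siteProb_eq hq, P.siteProb_eq hq,
    Function.update_self, Function.update_of_ne d4, Function.update_of_ne e4,
    Function.update_of_ne f4, Function.update_of_ne g4,
    Function.update_of_ne (Ne.symm k1), Function.update_of_ne (Ne.symm k2),
    Function.update_of_ne (Ne.symm k3), h1, h2, h3, h4, h5, h6, h7, h8]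

lemma card_triple {α : Type*} [DecidableEq α] {a b c : α} (h1 : a ≠ b) (h2 : a ≠ c)
    (h3 : b ≠ c) : ({a, b, c} : Finset α).card = 3 :=
  Finset.card_eq_three.2 ⟨a, b, c, h1, h2, h3, rfl⟩

lemma enh_triple {a b c : Fin q} (h1 : a ≠ b) (h2 : a ≠ c) (h3 : b ≠ c) (s : Fin q) :
    enh {a, b, c} s = if s = a ∨ s = b ∨ s = c then exc q 3 else 0 := by
  rw [enh, card_triple h1 h2 h3]
  simp

lemma Patch.dobrushinCoeff_diagonal {i N E W S NE NW SE SW : EvenSite}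
    (P : Patch i N E W S NE NW SE SW) (hq : 5 ≤ q) :
    dobrushinCoeff (decimatedSpec q) i NE = ENNReal.ofReal (nnnCoeff q) := by
  refine le_antisymm (P.dobrushinCoeff_diagonal_le hq) ?_
  obtain ⟨c0, h0⟩ : ∃ c : Fin q, c.1 = 0 := ⟨⟨0, by omega⟩, rfl⟩
  obtain ⟨c1, h1⟩ : ∃ c : Fin q, c.1 = 1 := ⟨⟨1, by omega⟩, rfl⟩
  obtain ⟨c2, h2⟩ : ∃ c : Fin q, c.1 = 2 := ⟨⟨2, by omega⟩, rfl⟩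
  obtain ⟨c3, h3⟩ : ∃ c : Fin q, c.1 = 3 := ⟨⟨3, by omega⟩, rfl⟩
  obtain ⟨c4, h4⟩ : ∃ c : Fin q, c.1 = 4 := ⟨⟨4, by omega⟩, rfl⟩
  refine le_trans (ENNReal.ofReal_le_ofReal (le_of_eq ?_))
    -- Every plaquette has three distinct other colours. `c0` occurs in all four and `c1` in three;
    -- the change at `NE` interchanges these roles, so the two totals agree and the exchange bound
    -- is an equality.
    (P.le_dobrushinCoeff_diagonal hq c3 c2 c1 c0 c0 c1 c0 c1 c4 c0)
  have hval : ∀ s, plaqProd {c3, c2, c0} {c3, c1, c0} {c2, c0, c1} {c1, c0, c4} s =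
      (1 + if s = c3 ∨ s = c2 ∨ s = c0 then exc q 3 else 0) *
      (1 + if s = c3 ∨ s = c1 ∨ s = c0 then exc q 3 else 0) *
      ((1 + if s = c2 ∨ s = c0 ∨ s = c1 then exc q 3 else 0) *
      (1 + if s = c1 ∨ s = c0 ∨ s = c4 then exc q 3 else 0)) := fun s => by
    rw [plaqProd, enh_triple, enh_triple, enh_triple, enh_triple] <;>
      simp [Fin.ext_iff, h0, h1, h2, h3, h4]
  have hval' : ∀ s, plaqProd {c3, c2, c1} {c3, c1, c0} {c2, c0, c1} {c1, c0, c4} s =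
      (1 + if s = c3 ∨ s = c2 ∨ s = c1 then exc q 3 else 0) *
      (1 + if s = c3 ∨ s = c1 ∨ s = c0 then exc q 3 else 0) *
      ((1 + if s = c2 ∨ s = c0 ∨ s = c1 then exc q 3 else 0) *
      (1 + if s = c1 ∨ s = c0 ∨ s = c4 then exc q 3 else 0)) := fun s => by
    rw [plaqProd, enh_triple, enh_triple, enh_triple, enh_triple] <;>
      simp [Fin.ext_iff, h0, h1, h2, h3, h4]
  have hZ : ∑ s, plaqProd {c3, c2, c0} {c3, c1, c0} {c2, c0, c1} {c1, c0, c4} s =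
      q - 5 + (1 + exc q 3) ^ 4 + (1 + exc q 3) ^ 3 + 2 * (1 + exc q 3) ^ 2 + (1 + exc q 3) := by
    rw [sum_eq_card_add {c0, c1, c2, c3, c4} fun s hs => by
      simp only [Finset.mem_insert, Finset.mem_singleton, not_or] at hs
      simp [hval, hs]]
    rw [Finset.sum_insert, Finset.sum_insert, Finset.sum_insert, Finset.sum_insert,
      Finset.sum_singleton, hval, hval, hval, hval, hval] <;>
      simp [Fin.ext_iff, h0, h1, h2, h3, h4]
    ring
  have hZ' : ∑ s, plaqProd {c3, c2, c1} {c3, c1, c0} {c2, c0, c1} {c1, c0, c4} s =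
      q - 5 + (1 + exc q 3) ^ 4 + (1 + exc q 3) ^ 3 + 2 * (1 + exc q 3) ^ 2 + (1 + exc q 3) := by
    rw [sum_eq_card_add {c0, c1, c2, c3, c4} fun s hs => by
      simp only [Finset.mem_insert, Finset.mem_singleton, not_or] at hs
      simp [hval', hs]]
    rw [Finset.sum_insert, Finset.sum_insert, Finset.sum_insert, Finset.sum_insert,
      Finset.sum_singleton, hval', hval', hval', hval', hval'] <;>
      simp [Fin.ext_iff, h0, h1, h2, h3, h4]
    ring
  rw [hZ, hZ', hval, hval']
  simp only [Fin.ext_iff, h0, h1, h2, h3, h4]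
  norm_num
  obtain ⟨m, hm, hQ⟩ := exists_eq_add_five hq
  rw [hQ, nnnCoeff_add_five, (exc_add_five m).2.2, add_sub_cancel_right]
  field_simp
  ring

lemma Patch.dobrushinCoeff_nearest {i N E W S NE NW SE SW : EvenSite}
    (P : Patch i N E W S NE NW SE SW) (hq : 5 ≤ q) :
    dobrushinCoeff (decimatedSpec q) i N = ENNReal.ofReal (nnCoeff q) := by
  refine le_antisymm (P.dobrushinCoeff_nearest_le hq) ?_
  obtain ⟨c0, h0⟩ : ∃ c : Fin q, c.1 = 0 := ⟨⟨0, by omega⟩, rfl⟩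
  obtain ⟨c1, h1⟩ : ∃ c : Fin q, c.1 = 1 := ⟨⟨1, by omega⟩, rfl⟩
  obtain ⟨c2, h2⟩ : ∃ c : Fin q, c.1 = 2 := ⟨⟨2, by omega⟩, rfl⟩
  obtain ⟨c3, h3⟩ : ∃ c : Fin q, c.1 = 3 := ⟨⟨3, by omega⟩, rfl⟩
  obtain ⟨c4, h4⟩ : ∃ c : Fin q, c.1 = 4 := ⟨⟨4, by omega⟩, rfl⟩
  -- For `q = 5` there is no sixth colour and `c4` is used twice.
  obtain ⟨c5, h5⟩ : ∃ c : Fin q, c.1 = if q = 5 then 4 else 5 :=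
    ⟨⟨if q = 5 then 4 else 5, by split_ifs <;> omega⟩, rfl⟩
  refine le_trans (ENNReal.ofReal_le_ofReal (le_of_eq ?_))
    -- `c0` occurs in all four plaquettes and `c1` only in the two that do not contain `N`; the
    -- change at `N` interchanges these roles.
    (P.le_dobrushinCoeff_nearest hq c0 c1 c2 c3 c0 c4 c5 c1 c1 c0)
  have h5' : c5.1 = 4 ∨ c5.1 = 5 := by rw [h5]; split_ifs <;> simp
  have hne : c0 ≠ c5 ∧ c1 ≠ c5 ∧ c3 ≠ c5 := by
    simp only [ne_eq, Fin.ext_iff, h0, h1, h3]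
    omega
  have hval : ∀ s, plaqProd {c0, c2, c4} {c0, c3, c5} {c2, c0, c1} {c3, c0, c1} s =
      (1 + if s = c0 ∨ s = c2 ∨ s = c4 then exc q 3 else 0) *
      (1 + if s = c0 ∨ s = c3 ∨ s = c5 then exc q 3 else 0) *
      ((1 + if s = c2 ∨ s = c0 ∨ s = c1 then exc q 3 else 0) *
      (1 + if s = c3 ∨ s = c0 ∨ s = c1 then exc q 3 else 0)) := fun s => by
    rw [plaqProd, enh_triple, enh_triple _ hne.1 hne.2.2, enh_triple, enh_triple] <;>
      simp [Fin.ext_iff, h0, h1, h2, h3, h4]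
  have hval' : ∀ s, plaqProd {c1, c2, c4} {c1, c3, c5} {c2, c0, c1} {c3, c0, c1} s =
      (1 + if s = c1 ∨ s = c2 ∨ s = c4 then exc q 3 else 0) *
      (1 + if s = c1 ∨ s = c3 ∨ s = c5 then exc q 3 else 0) *
      ((1 + if s = c2 ∨ s = c0 ∨ s = c1 then exc q 3 else 0) *
      (1 + if s = c3 ∨ s = c0 ∨ s = c1 then exc q 3 else 0)) := fun s => by
    rw [plaqProd, enh_triple, enh_triple _ hne.2.1 hne.2.2, enh_triple, enh_triple] <;>
      simp [Fin.ext_iff, h0, h1, h2, h3, h4]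
  rcases hq.eq_or_lt with rfl | hq6
  · rw [if_pos rfl] at h5
    rw [Fin.sum_univ_five, Fin.sum_univ_five]
    simp only [hval, hval', Fin.ext_iff, h0, h1, h2, h3, h4, h5]
    norm_num [nnCoeff, exc]
  · rw [if_neg (by omega)] at h5
    have hZ : ∑ s, plaqProd {c0, c2, c4} {c0, c3, c5} {c2, c0, c1} {c3, c0, c1} s =
        q - 6 + (1 + exc q 3) ^ 4 + 3 * (1 + exc q 3) ^ 2 + 2 * (1 + exc q 3) := by
      rw [sum_eq_card_add {c0, c1, c2, c3, c4, c5} fun s hs => by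
        simp only [Finset.mem_insert, Finset.mem_singleton, not_or] at hs
        simp [hval, hs]]
      rw [Finset.sum_insert, Finset.sum_insert, Finset.sum_insert, Finset.sum_insert,
        Finset.sum_insert, Finset.sum_singleton, hval, hval, hval, hval, hval, hval] <;>
        simp [Fin.ext_iff, h0, h1, h2, h3, h4, h5]
      ring
    have hZ' : ∑ s, plaqProd {c1, c2, c4} {c1, c3, c5} {c2, c0, c1} {c3, c0, c1} s =
        q - 6 + (1 + exc q 3) ^ 4 + 3 * (1 + exc q 3) ^ 2 + 2 * (1 + exc q 3) := by
      rw [sum_eq_card_add {c0, c1, c2, c3, c4, c5} fun s hs => by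
        simp only [Finset.mem_insert, Finset.mem_singleton, not_or] at hs
        simp [hval', hs]]
      rw [Finset.sum_insert, Finset.sum_insert, Finset.sum_insert, Finset.sum_insert,
        Finset.sum_insert, Finset.sum_singleton, hval', hval', hval', hval', hval', hval'] <;>
        simp [Fin.ext_iff, h0, h1, h2, h3, h4, h5]
      ring
    rw [hZ, hZ', hval, hval']
    simp only [Fin.ext_iff, h0, h1, h2, h3, h4, h5]
    norm_num
    obtain ⟨m, hm, hQ⟩ := exists_eq_add_six hq6
    rw [hQ, nnCoeff_add_six hm, (exc_add_six m).2.2, add_sub_cancel_right]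
    field_simp
    ring

lemma exists_patch_of_isNN {i j : EvenSite} (h : IsNN i j) :
    ∃ E W S NE NW SE SW : EvenSite, Patch i j E W S NE NW SE SW := by
  obtain ⟨⟨a, b⟩, hab⟩ := i
  obtain ⟨⟨c, d⟩, hcd⟩ := j
  obtain ⟨h1, h2⟩ := h
  simp only at h1 h2
  rw [abs_eq zero_le_one] at h1 h2
  obtain ⟨N, E, W, S, NE, NW, SE, SW, P, hN, -⟩ := exists_patch_aux hab (u₁ := c - a) (u₂ := 0)
    (v₁ := 0) (v₂ := d - b) (Or.inl ⟨by omega, rfl, rfl, by omega⟩)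
  have : N = ⟨(c, d), hcd⟩ := Subtype.ext (hN.trans (Prod.ext (by simp) (by simp)))
  exact ⟨E, W, S, NE, NW, SE, SW, this ▸ P⟩

lemma exists_patch_of_isNNN {i j : EvenSite} (h : IsNNN i j) :
    ∃ N E W S NW SE SW : EvenSite, Patch i N E W S j NW SE SW := by
  obtain ⟨⟨a, b⟩, hab⟩ := i
  obtain ⟨⟨c, d⟩, hcd⟩ := j
  simp only [IsNNN] at h
  have hab' := hab
  have hcd' := hcd
  simp only [Int.even_iff] at hab' hcd'
  rcases h with ⟨h1, h2⟩ | ⟨h1, h2⟩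
  · rw [abs_eq zero_le_two] at h1
    obtain ⟨N, E, W, S, NE, NW, SE, SW, P, -, -, -, -, hNE, -⟩ := exists_patch_aux hab
      (u₁ := (c - a) / 2) (u₂ := 0) (v₁ := 0) (v₂ := 1) (Or.inl ⟨by omega, rfl, rfl, by omega⟩)
    have : NE = ⟨(c, d), hcd⟩ := Subtype.ext (hNE.trans (Prod.ext (by simp only; omega)
      (by simp only; omega)))
    exact ⟨N, E, W, S, NW, SE, SW, this ▸ P⟩
  · rw [abs_eq zero_le_two] at h2
    obtain ⟨N, E, W, S, NE, NW, SE, SW, P, -, -, -, -, hNE, -⟩ := exists_patch_aux hab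
      (u₁ := 0) (u₂ := (d - b) / 2) (v₁ := 1) (v₂ := 0) (Or.inr ⟨rfl, by omega, by omega, rfl⟩)
    have : NE = ⟨(c, d), hcd⟩ := Subtype.ext (hNE.trans (Prod.ext (by simp only; omega)
      (by simp only; omega)))
    exact ⟨N, E, W, S, NW, SE, SW, this ▸ P⟩

lemma dobrushinCoeff_of_isNN (hq : 5 ≤ q) {i j : EvenSite} (h : IsNN i j) :
    dobrushinCoeff (decimatedSpec q) i j = ENNReal.ofReal (nnCoeff q) := by
  obtain ⟨E, W, S, NE, NW, SE, SW, P⟩ := exists_patch_of_isNN h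
  exact P.dobrushinCoeff_nearest hq

lemma dobrushinCoeff_of_isNNN (hq : 5 ≤ q) {i j : EvenSite} (h : IsNNN i j) :
    dobrushinCoeff (decimatedSpec q) i j = ENNReal.ofReal (nnnCoeff q) := by
  obtain ⟨N, E, W, S, NW, SE, SW, P⟩ := exists_patch_of_isNNN h
  exact P.dobrushinCoeff_diagonal hq

/-- A patch around a given site, with its neighbours identified. -/
lemma exists_patch (i : EvenSite) : ∃ N E W S NE NW SE SW : EvenSite,
    Patch i N E W S NE NW SE SW ∧ (IsNN i N ∧ IsNN i E ∧ IsNN i W ∧ IsNN i S) ∧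
      IsNNN i NE ∧ IsNNN i NW ∧ IsNNN i SE ∧ IsNNN i SW := by
  obtain ⟨⟨a, b⟩, hab⟩ := i
  obtain ⟨N, E, W, S, NE, NW, SE, SW, P, h1, h2, h3, h4, h5, h6, h7, h8⟩ := exists_patch_aux hab
    (u₁ := 1) (u₂ := 0) (v₁ := 0) (v₂ := 1) (Or.inl ⟨Or.inl rfl, rfl, rfl, Or.inl rfl⟩)
  refine ⟨N, E, W, S, NE, NW, SE, SW, P, ⟨?_, ?_, ?_, ?_⟩, ?_, ?_, ?_, ?_⟩
  · simp [IsNN, h1]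
  · simp [IsNN, h2]
  · simp [IsNN, h3]
  · simp [IsNN, h4]
  · simp [IsNNN, h5]
  · simp [IsNNN, h6]
  · simp [IsNNN, h7]
  · simp [IsNNN, h8]

lemma tsum_dobrushinCoeff (hq : 5 ≤ q) (i : EvenSite) :
    ∑' j : {j : EvenSite // j ≠ i}, dobrushinCoeff (decimatedSpec q) i j =
      4 * ENNReal.ofReal (nnCoeff q) + 4 * ENNReal.ofReal (nnnCoeff q) := by
  obtain ⟨N, E, W, S, NE, NW, SE, SW, P, ⟨n1, n2, n3, n4⟩, m1, m2, m3, m4⟩ := exists_patch i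
  have hd := P.nodup
  simp only [List.nodup_cons, List.mem_cons, List.not_mem_nil, or_false, not_or,
    not_false_eq_true, List.nodup_nil, and_true] at hd
  have hsub : ({N, E, W, S, NE, NW, SE, SW} : Finset EvenSite) =
      ({N, E, W, S, NE, NW, SE, SW} : Finset EvenSite).filter (· ≠ i) := by
    refine (Finset.filter_true_of_mem fun j hj => ?_).symm
    rintro rfl
    simp only [Finset.mem_insert, Finset.mem_singleton] at hj
    tauto
  calc ∑' j : {j : EvenSite // j ≠ i}, dobrushinCoeff (decimatedSpec q) i j
      = ∑' j, ({j | j ≠ i} : Set EvenSite).indicator (dobrushinCoeff (decimatedSpec q) i) j :=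
        tsum_subtype {j | j ≠ i} _
    _ = ∑ j ∈ {N, E, W, S, NE, NW, SE, SW},
          ({j | j ≠ i} : Set EvenSite).indicator (dobrushinCoeff (decimatedSpec q) i) j := by
        refine tsum_eq_sum fun j hj => ?_
        by_cases hji : j ≠ i
        · rw [Set.indicator_of_mem (by exact hji), P.dobrushinCoeff_eq_zero hq hj]
        · exact Set.indicator_of_notMem hji _
    _ = ∑ j ∈ {N, E, W, S, NE, NW, SE, SW}, dobrushinCoeff (decimatedSpec q) i j := by
        refine Finset.sum_congr rfl fun j hj => Set.indicator_of_mem ?_ _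
        rw [hsub] at hj
        exact (Finset.mem_filter.1 hj).2
    _ = _ := by
        rw [Finset.sum_insert (by simp; tauto), Finset.sum_insert (by simp; tauto),
          Finset.sum_insert (by simp; tauto), Finset.sum_insert (by simp; tauto),
          Finset.sum_insert (by simp; tauto), Finset.sum_insert (by simp; tauto),
          Finset.sum_insert (by simp; tauto), Finset.sum_singleton,
          dobrushinCoeff_of_isNN hq n1, dobrushinCoeff_of_isNN hq n2,
          dobrushinCoeff_of_isNN hq n3, dobrushinCoeff_of_isNN hq n4,
          dobrushinCoeff_of_isNNN hq m1, dobrushinCoeff_of_isNNN hq m2,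
          dobrushinCoeff_of_isNNN hq m3, dobrushinCoeff_of_isNNN hq m4]
        ring

lemma dobrushinConst_decimated (hq : 5 ≤ q) : dobrushinConst (decimatedSpec q) =
    4 * ENNReal.ofReal (nnCoeff q) + 4 * ENNReal.ofReal (nnnCoeff q) := by
  have : Nonempty EvenSite := ⟨⟨(0, 0), by simp⟩⟩
  unfold dobrushinConst
  simp only [tsum_dobrushinCoeff hq, ciSup_const]

lemma dobrushinConst_decimated_lt_one (hq : 7 ≤ q) : dobrushinConst (decimatedSpec q) < 1 := by
  have h5 : 5 ≤ q := by omega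
  have h1 := nnCoeff_nonneg h5
  have h2 := nnnCoeff_nonneg h5
  rw [dobrushinConst_decimated h5, show (4 : ℝ≥0∞) = ENNReal.ofReal 4 by simp,
    ← ENNReal.ofReal_mul (by norm_num), ← ENNReal.ofReal_mul (by norm_num),
    ← ENNReal.ofReal_add (by positivity) (by positivity), ENNReal.ofReal_lt_one]
  exact four_mul_coeff_lt_one hq

end Attain

/-! ### The contraction condition for the two systems -/

section Systems

variable {q : ℕ}

lemma osc_gibbsAvg_eq_zero {L E : Type} [DecidableEq L] [Fintype E]
    {W : Finset L → (L → E) → ℝ} {Λ : Finset L} {i : L} (hi : i ∈ Λ) (f : (L → E) → ℝ) :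
    osc (gibbsAvg W Λ f) i = 0 := by
  refine le_antisymm (osc_le fun σ σ' h => ?_) bot_le
  rw [gibbsAvg_congr_out Λ f fun k hk => h k fun hki => hk (hki ▸ hi)]
  simp

lemma dobrushinCoeff_ne_zero (hq : 5 ≤ q) {i j : EvenSite}
    (h : dobrushinCoeff (decimatedSpec q) i j ≠ 0) : IsNN i j ∨ IsNNN i j := by
  obtain ⟨N, E, W, S, NE, NW, SE, SW, P, ⟨n1, n2, n3, n4⟩, m1, m2, m3, m4⟩ := exists_patch i
  have h1 := mt (P.dobrushinCoeff_eq_zero hq (j := j)) h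
  rw [not_not] at h1
  simp only [Finset.mem_insert, Finset.mem_singleton] at h1
  rcases h1 with rfl | rfl | rfl | rfl | rfl | rfl | rfl | rfl <;> tauto

lemma dist_le_two {i j : EvenSite} (h : IsNN i j ∨ IsNNN i j) : dist i j ≤ 2 := by
  have h1 : |i.1.1 - j.1.1| ≤ 2 ∧ |i.1.2 - j.1.2| ≤ 2 := by
    rcases h with h | h | h
    · exact ⟨h.1.le.trans one_le_two, h.2.le.trans one_le_two⟩
    · exact ⟨h.1.le, by rw [h.2]; simp⟩
    · exact ⟨by rw [h.1]; simp, h.2.le⟩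
  rw [Subtype.dist_eq, Prod.dist_eq, Int.dist_eq, Int.dist_eq]
  exact max_le (by exact_mod_cast h1.1) (by exact_mod_cast h1.2)

lemma dist_le_one_of_mem_nbrs {x y : ℤ × ℤ} (h : y ∈ nbrs x) : dist x y ≤ 1 := by
  rw [Prod.dist_eq, Int.dist_eq, Int.dist_eq]
  rw [mem_nbrs] at h
  rcases h with rfl | rfl | rfl | rfl <;> simp

/-- The interdependence matrix of the decimated system, with zeros on the diagonal. -/
def decimatedMatrix (q : ℕ) (i j : EvenSite) : ℝ≥0∞ :=
  if j = i then 0 else dobrushinCoeff (decimatedSpec q) i j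

lemma tsum_decimatedMatrix_le (q : ℕ) (i : EvenSite) :
    ∑' j, decimatedMatrix q i j ≤ dobrushinConst (decimatedSpec q) := by
  refine le_iSup_of_le (f := fun i : EvenSite =>
    ∑' j : {j // j ≠ i}, dobrushinCoeff (decimatedSpec q) i j) i (le_of_eq ?_)
  rw [show (∑' j : {j // j ≠ i}, dobrushinCoeff (decimatedSpec q) i j) =
    ∑' j, ({j | j ≠ i} : Set EvenSite).indicator (dobrushinCoeff (decimatedSpec q) i) j from
    tsum_subtype {j | j ≠ i} _]
  refine tsum_congr fun j => ?_
  by_cases h : j = i <;> simp [decimatedMatrix, h]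

lemma decimatedMatrix_ne_zero (hq : 5 ≤ q) {i j : EvenSite} (h : decimatedMatrix q i j ≠ 0) :
    dist i j ≤ 2 := by
  unfold decimatedMatrix at h
  split_ifs at h with hij
  · exact absurd rfl h
  · exact dist_le_two (dobrushinCoeff_ne_zero hq h)

/-- The single-site updates of the decimated system. -/
def decimatedBlocks (hq : 5 ≤ q) : BlockSystem (decimatedWeight q) where
  O := ∅
  block i := {i}
  c := decimatedMatrix q
  mem_block i := Finset.mem_singleton_self i
  mem_O i k hk hki := absurd (Finset.mem_singleton.1 hk) hki
  block_of_mem x hx := absurd hx (Set.notMem_empty x)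
  c_eq_zero i j hj := absurd hj (Set.notMem_empty j)
  osc_self i f := osc_gibbsAvg_eq_zero (Finset.mem_singleton_self i) f
  osc_le i f hi _ j hj := by
    rw [decimatedMatrix, if_neg hj]
    exact osc_average_le (siteProb_nonneg hq i) (sum_siteProb hq i)
      (gibbsAvg_decimated_singleton i f)
      (fun σ σ' h A => abs_sum_siteProb_le_dobrushinCoeff hq h A)
      (dobrushinCoeff_ne_top hq i j) hi

lemma decimatedBlocks_contracts (hq : 5 ≤ q) (h : dobrushinConst (decimatedSpec q) < 1) :
    (decimatedBlocks hq).Contracts (fun _ => 1) 1 (dobrushinConst (decimatedSpec q)) where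
  bound_ne_top := ENNReal.one_ne_top
  one_le _ := le_rfl
  le_bound _ := le_rfl
  lt_one := h
  contract i _ := by
    simp only [mul_one]
    exact tsum_decimatedMatrix_le q i
  nonexpand i hi := absurd hi (Set.notMem_empty i)

/-- The interdependence matrix used for the Potts antiferromagnet. -/
def pottsMatrix (q : ℕ) (x y : ℤ × ℤ) : ℝ≥0∞ :=
  if hx : Even (x.1 + x.2) then
    if hy : Even (y.1 + y.2) then decimatedMatrix q ⟨x, hx⟩ ⟨y, hy⟩ else 0
  else if y ∈ nbrs x then 1 else 0

/-- An even site is updated together with its neighbours, an odd site alone. -/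
def pottsBlock (x : ℤ × ℤ) : Finset (ℤ × ℤ) :=
  if hx : Even (x.1 + x.2) then evenPart {⟨x, hx⟩} ∪ centers {⟨x, hx⟩} else {x}

lemma evenPart_singleton (i : EvenSite) : evenPart {i} = {i.1} := by
  ext x; rw [mem_evenPart]; simp [eq_comm]

lemma centers_singleton (i : EvenSite) : centers {i} = nbrs i.1 := Finset.singleton_biUnion

lemma restrictEven_update (σ : ℤ × ℤ → Fin q) (i : EvenSite) (s : Fin q) :
    restrictEven (Function.update σ i.1 s) = Function.update (restrictEven σ) i s := by
  funext y
  by_cases h : y = i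
  · subst h; simp [restrictEven]
  · have : y.1 ≠ i.1 := fun h' => h (Subtype.ext h')
    simp [restrictEven, h, this]

/-- On functions that ignore the odd neighbours, the block average is the single-site average of the
decimated system; the block therefore inherits the decimated coefficients. -/
lemma gibbsAvg_pottsBlock_even (i : EvenSite) {f : (ℤ × ℤ → Fin q) → ℝ}
    (hf : ∀ k ∈ nbrs i.1, osc f k = 0) (σ : ℤ × ℤ → Fin q) :
    gibbsAvg (pottsWeight q) (evenPart {i} ∪ centers {i}) f σ =
      ∑ s, siteProb q i (restrictEven σ) s * f (Function.update σ i.1 s) := by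
  rw [gibbsAvg_potts_eq, evenPart_singleton, sumOver_singleton, sumOver_singleton,
    Finset.sum_div]
  · refine Finset.sum_congr rfl fun s _ => ?_
    simp only [restrictEven_update, siteProb]
    ring
  · intro η τ
    refine eq_of_osc_eq_zero_on (Λ := centers {i}) (fun k hk => hf k ?_)
      fun k hk => glue_of_notMem hk η τ
    rwa [centers_singleton] at hk

/-- The conditional probability that the spin at `x` equals `s` in the Potts antiferromagnet. -/
def pottsSiteProb (q : ℕ) (x : ℤ × ℤ) (σ : ℤ × ℤ → Fin q) (s : Fin q) : ℝ :=
  pottsWeight q {x} (Function.update σ x s) / ∑ s', pottsWeight q {x} (Function.update σ x s')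

lemma pottsSiteProb_nonneg (hq : 5 ≤ q) (x : ℤ × ℤ) (σ : ℤ × ℤ → Fin q) (s : Fin q) :
    0 ≤ pottsSiteProb q x σ s :=
  div_nonneg ((goodWeight_potts hq).nonneg _ _)
    (Finset.sum_nonneg fun _ _ => (goodWeight_potts hq).nonneg _ _)

lemma sum_pottsSiteProb (hq : 5 ≤ q) (x : ℤ × ℤ) (σ : ℤ × ℤ → Fin q) :
    ∑ s, pottsSiteProb q x σ s = 1 := by
  unfold pottsSiteProb
  rw [← Finset.sum_div, div_self]
  rw [← sumOver_singleton]
  exact ((goodWeight_potts hq).pos {x} σ).ne'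

lemma gibbsAvg_potts_singleton (x : ℤ × ℤ) (f : (ℤ × ℤ → Fin q) → ℝ) (σ : ℤ × ℤ → Fin q) :
    gibbsAvg (pottsWeight q) {x} f σ =
      ∑ s, pottsSiteProb q x σ s * f (Function.update σ x s) := by
  unfold gibbsAvg pottsSiteProb
  rw [sumOver_singleton, sumOver_singleton, Finset.sum_div]
  exact Finset.sum_congr rfl fun s _ => by ring

lemma pottsSiteProb_congr {x : ℤ × ℤ} {σ σ' : ℤ × ℤ → Fin q} (h : ∀ y ∈ nbrs x, σ y = σ' y) :
    pottsSiteProb q x σ = pottsSiteProb q x σ' := by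
  have : ∀ s, pottsWeight q {x} (Function.update σ x s) =
      pottsWeight q {x} (Function.update σ' x s) := fun s => by
    unfold pottsWeight
    refine if_congr (forall₂_congr fun z hz => forall₂_congr fun y hy => ?_) rfl rfl
    rw [Finset.mem_singleton] at hz
    subst hz
    have hyz := (ne_of_mem_nbrs hy).symm
    rw [Function.update_self, Function.update_self, Function.update_of_ne hyz,
      Function.update_of_ne hyz, h y hy]
  funext s
  simp only [pottsSiteProb, this]

lemma abs_sum_pottsSiteProb_sub_le (hq : 5 ≤ q) (x : ℤ × ℤ) (σ σ' : ℤ × ℤ → Fin q)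
    (A : Finset (Fin q)) :
    |∑ s ∈ A, pottsSiteProb q x σ s - ∑ s ∈ A, pottsSiteProb q x σ' s| ≤ 1 := by
  have h0 : ∀ τ, 0 ≤ ∑ s ∈ A, pottsSiteProb q x τ s := fun τ =>
    Finset.sum_nonneg fun s _ => pottsSiteProb_nonneg hq x τ s
  have h1 : ∀ τ, ∑ s ∈ A, pottsSiteProb q x τ s ≤ 1 := fun τ => by
    rw [← sum_pottsSiteProb hq x τ]
    exact Finset.sum_le_sum_of_subset_of_nonneg (Finset.subset_univ _)
      fun s _ _ => pottsSiteProb_nonneg hq x τ s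
  exact abs_sub_le_iff.2 ⟨by linarith [h1 σ, h0 σ'], by linarith [h1 σ', h0 σ]⟩

lemma mem_pottsBlock_self (x : ℤ × ℤ) : x ∈ pottsBlock x := by
  unfold pottsBlock
  split_ifs with hx
  · rw [evenPart_singleton]; simp
  · simp

lemma mem_nbrs_of_mem_pottsBlock {x y : ℤ × ℤ} (h : y ∈ pottsBlock x) (hyx : y ≠ x) :
    Even (x.1 + x.2) ∧ y ∈ nbrs x := by
  unfold pottsBlock at h
  split_ifs at h with hx
  · rw [evenPart_singleton, centers_singleton, Finset.mem_union, Finset.mem_singleton] at h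
    exact ⟨hx, h.resolve_left hyx⟩
  · exact absurd (Finset.mem_singleton.1 h) hyx

/-- The block updates of the Potts antiferromagnet. -/
def pottsBlocks (hq : 5 ≤ q) : BlockSystem (pottsWeight q) where
  O := {x | ¬ Even (x.1 + x.2)}
  block := pottsBlock
  c := pottsMatrix q
  mem_block := mem_pottsBlock_self
  mem_O x y hy hyx := by
    obtain ⟨h1, h2⟩ := mem_nbrs_of_mem_pottsBlock hy hyx
    exact fun h => (even_iff_of_mem_nbrs h2).1 h h1
  block_of_mem x hx := dif_neg hx
  c_eq_zero x y hy := by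
    unfold pottsMatrix
    split_ifs with h1 h2 h3
    · exact absurd h2 hy
    · rfl
    · exact absurd ((even_iff_of_mem_nbrs h3).2 h1) hy
    · rfl
  osc_self x f := osc_gibbsAvg_eq_zero (mem_pottsBlock_self x) f
  osc_le x f hi hf y hyx := by
    by_cases hx : Even (x.1 + x.2)
    · have hf' : ∀ k ∈ nbrs x, osc f k = 0 := fun k hk => hf k (by
        rw [pottsBlock, dif_pos hx, centers_singleton]
        exact Finset.mem_union_right _ hk) (ne_of_mem_nbrs hk).symm
      have hblock : gibbsAvg (pottsWeight q) (pottsBlock x) f = fun σ =>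
          ∑ s, siteProb q ⟨x, hx⟩ (restrictEven σ) s * f (Function.update σ x s) := by
        funext σ
        rw [pottsBlock, dif_pos hx]
        exact gibbsAvg_pottsBlock_even ⟨x, hx⟩ hf' σ
      by_cases hy : Even (y.1 + y.2)
      · have hne : (⟨y, hy⟩ : EvenSite) ≠ ⟨x, hx⟩ := fun h => hyx (congrArg Subtype.val h)
        rw [pottsMatrix, dif_pos hx, dif_pos hy, decimatedMatrix, if_neg hne]
        refine osc_average_le (fun σ => siteProb_nonneg hq ⟨x, hx⟩ (restrictEven σ))
          (fun σ => sum_siteProb hq ⟨x, hx⟩ (restrictEven σ)) (fun σ => congrFun hblock σ)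
          (fun σ σ' h A => abs_sum_siteProb_le_dobrushinCoeff hq (fun k hk => ?_) A)
          (dobrushinCoeff_ne_top hq _ _) hi
        exact h k.1 fun hky => hk (Subtype.ext hky)
      -- Once the odd neighbours are summed out, the law of the even spin depends on even spins
      -- only.
      · rw [pottsMatrix, dif_pos hx, dif_neg hy]
        refine osc_average_le (fun σ => siteProb_nonneg hq ⟨x, hx⟩ (restrictEven σ))
          (fun σ => sum_siteProb hq ⟨x, hx⟩ (restrictEven σ)) (fun σ => congrFun hblock σ)
          (fun σ σ' h A => ?_) ENNReal.zero_ne_top hi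
        have : restrictEven σ = restrictEven σ' :=
          funext fun k => h k.1 fun hky => hy (hky ▸ k.2)
        simp [this]
    · have hblock : pottsBlock x = {x} := dif_neg hx
      rw [hblock, pottsMatrix, dif_neg hx]
      refine osc_average_le (pottsSiteProb_nonneg hq x) (sum_pottsSiteProb hq x)
        (gibbsAvg_potts_singleton x f) (fun σ σ' h A => ?_) (by split_ifs <;> simp) hi
      split_ifs with hy
      · rw [← ENNReal.ofReal_one]
        exact ENNReal.ofReal_le_ofReal (abs_sum_pottsSiteProb_sub_le hq x σ σ' A)
      · rw [pottsSiteProb_congr fun z hz => h z fun hzy => hy (hzy ▸ hz)]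
        simp

/-- The weights with which the block updates of the Potts antiferromagnet contract. -/
def parityWeight (x : ℤ × ℤ) : ℝ≥0∞ := if Even (x.1 + x.2) then 1 else 4

/-- Even sites influence one another through the decimated matrix. The weight `4` at an odd site
pays for the trivial coefficient `1` towards each of its four neighbours. -/
lemma pottsBlocks_contracts (hq : 5 ≤ q) (h : dobrushinConst (decimatedSpec q) < 1) :
    (pottsBlocks hq).Contracts parityWeight 4 (dobrushinConst (decimatedSpec q)) where
  bound_ne_top := by simp
  one_le x := by unfold parityWeight; split_ifs <;> norm_num
  le_bound x := by unfold parityWeight; split_ifs <;> norm_num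
  lt_one := h
  contract x hx := by
    have hx' : Even (x.1 + x.2) := not_not.1 hx
    have e1 : ∀ y, (pottsBlocks hq).c x y * parityWeight y =
        ({y | Even (y.1 + y.2)} : Set (ℤ × ℤ)).indicator (fun y => pottsMatrix q x y) y := by
      intro y
      change pottsMatrix q x y * parityWeight y = _
      by_cases hy : Even (y.1 + y.2)
      · rw [Set.indicator_of_mem (by exact hy), parityWeight, if_pos hy, mul_one]
      · rw [Set.indicator_of_notMem (by exact hy), pottsMatrix, dif_pos hx', dif_neg hy, zero_mul]
    rw [tsum_congr e1, ← tsum_subtype, parityWeight, if_pos hx', mul_one]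
    refine le_trans (le_of_eq (tsum_congr fun y => ?_)) (tsum_decimatedMatrix_le q ⟨x, hx'⟩)
    rw [pottsMatrix, dif_pos hx']
    exact dif_pos (show Even (y.1.1 + y.1.2) from y.2)
  nonexpand x hx := by
    have hx' : ¬ Even (x.1 + x.2) := hx
    rw [tsum_eq_sum (s := nbrs x) fun y hy => by
      change pottsMatrix q x y * parityWeight y = 0
      rw [pottsMatrix, dif_neg hx', if_neg hy, zero_mul]]
    rw [parityWeight, if_neg hx']
    calc ∑ y ∈ nbrs x, (pottsBlocks hq).c x y * parityWeight y
        = ∑ y ∈ nbrs x, (1 : ℝ≥0∞) := Finset.sum_congr rfl fun y hy => by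
          change pottsMatrix q x y * parityWeight y = 1
          rw [pottsMatrix, dif_neg hx', if_pos hy, parityWeight,
            if_pos ((even_iff_of_mem_nbrs hy).2 hx'), mul_one]
      _ = ((nbrs x).card : ℝ≥0∞) := by simp
      _ ≤ 4 := by exact_mod_cast card_nbrs_le x

lemma pottsMatrix_ne_zero (hq : 5 ≤ q) {x y : ℤ × ℤ} (h : pottsMatrix q x y ≠ 0) :
    dist x y ≤ 2 := by
  unfold pottsMatrix at h
  split_ifs at h with h1 h2 h3
  · exact decimatedMatrix_ne_zero hq h
  · exact absurd rfl h
  · exact (dist_le_one_of_mem_nbrs h3).trans one_le_two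
  · exact absurd rfl h

/-- Existence, uniqueness and decay of correlations for a contracting block system. -/
theorem BlockSystem.Contracts.exists_unique_gibbs {L : Type} [DecidableEq L] [Countable L]
    [PseudoMetricSpace L] (hq : 5 ≤ q) {W : Finset L → (L → Fin q) → ℝ} {B : BlockSystem W}
    {e : L → ℝ≥0∞} {R α : ℝ≥0∞} (hB : B.Contracts e R α) (hW : GoodWeight W)
    (hc : ∀ i j, B.c i j ≠ 0 → dist i j ≤ 2) (hblock : ∀ i, ∀ k ∈ B.block i, dist i k ≤ 1) :
    ∃ μ : Measure (L → Fin q), IsGibbsMeasure (gibbsKernel W) μ ∧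
      (∀ μ', IsGibbsMeasure (gibbsKernel W) μ' → μ' = μ) ∧ HasExponentialDecay μ := by
  have : Nonempty (Fin q) := ⟨⟨0, by omega⟩⟩
  obtain ⟨μ, hμ, hinv⟩ := hW.exists_invariant
  refine ⟨μ, hW.isGibbsMeasure_of_invariant hinv, fun ν hν => ?_,
    hB.hasExponentialDecay hW hinv hc hblock⟩
  have := hν.1
  exact hB.unique hW (hW.invariant_of_isGibbsMeasure hν) hinv

end Systems

end

theorem mainTheorem2 (q : ℕ) (hq : 5 ≤ q) :
    -- decimation: the sum over a removed spin gives the plaquette weight `q - C`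
    (∀ x : ℤ × ℤ, ¬ Even (x.1 + x.2) → ∀ t : EvenSite → Fin q,
      ∑ s : Fin q, ∏ y ∈ plaquette x, (1 - (if s = t y then (1 : ℝ) else 0)) =
        (q : ℝ) - (numColors x t : ℝ)) ∧
    -- decimation of Gibbs measures
    (∀ μ : Measure (ℤ × ℤ → Fin q), IsGibbsMeasure (pottsSpec q) μ →
      IsGibbsMeasure (decimatedSpec q) (μ.map restrictEven)) ∧
    -- the Dobrushin coefficients and the Dobrushin constant of the decimated system
    (∃ c_nn c_nnn : ℝ≥0∞,
      (∀ i j : EvenSite, IsNN i j → dobrushinCoeff (decimatedSpec q) i j = c_nn) ∧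
      (∀ i j : EvenSite, IsNNN i j → dobrushinCoeff (decimatedSpec q) i j = c_nnn) ∧
      dobrushinConst (decimatedSpec q) = 4 * c_nn + 4 * c_nnn ∧
      (q = 5 → c_nn = ENNReal.ofReal (3 / 8)) ∧
      (6 ≤ q → c_nn = ENNReal.ofReal
        (((q : ℝ) - 3) ^ 2 * (2 * (q : ℝ) - 7) /
          ((q : ℝ) ^ 5 - 16 * (q : ℝ) ^ 4 + 108 * (q : ℝ) ^ 3 - 391 * (q : ℝ) ^ 2
            + 764 * (q : ℝ) - 639))) ∧
      c_nnn = ENNReal.ofReal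
        (((q : ℝ) - 3) ^ 3 /
          ((q : ℝ) ^ 5 - 16 * (q : ℝ) ^ 4 + 108 * (q : ℝ) ^ 3 - 389 * (q : ℝ) ^ 2
            + 749 * (q : ℝ) - 611))) ∧
    -- uniqueness and exponential decay, for the decimated and for the original system
    (7 ≤ q →
      dobrushinConst (decimatedSpec q) < 1 ∧
      (∃ ν : Measure (EvenSite → Fin q), IsGibbsMeasure (decimatedSpec q) ν ∧
        (∀ ν', IsGibbsMeasure (decimatedSpec q) ν' → ν' = ν) ∧ HasExponentialDecay ν) ∧
      (∃ μ : Measure (ℤ × ℤ → Fin q), IsGibbsMeasure (pottsSpec q) μ ∧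
        (∀ μ', IsGibbsMeasure (pottsSpec q) μ' → μ' = μ) ∧ HasExponentialDecay μ)) := by
  refine ⟨fun x _ t => sum_prod_plaquette x t,
    fun μ hμ => isGibbsMeasure_map_restrictEven hq hμ,
    ⟨ENNReal.ofReal (nnCoeff q), ENNReal.ofReal (nnnCoeff q),
      fun i j h => dobrushinCoeff_of_isNN hq h, fun i j h => dobrushinCoeff_of_isNNN hq h,
      dobrushinConst_decimated hq, ?_, ?_, rfl⟩, fun h7 => ?_⟩
  · rintro rfl
    exact congrArg _ (by exact_mod_cast nnCoeff_five)
  · intro h6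
    rw [nnCoeff, if_neg]
    exact_mod_cast (by omega : q ≠ 5)
  · have h := dobrushinConst_decimated_lt_one h7
    refine ⟨h, ?_, ?_⟩
    · refine (decimatedBlocks_contracts hq h).exists_unique_gibbs hq (goodWeight_decimated hq)
        (fun i j hij => decimatedMatrix_ne_zero hq hij) fun i k hk => ?_
      rw [Finset.mem_singleton.1 hk, dist_self]
      exact zero_le_one
    · refine (pottsBlocks_contracts hq h).exists_unique_gibbs hq (goodWeight_potts hq)
        (fun x y hxy => pottsMatrix_ne_zero hq hxy) fun x k hk => ?_
      rcases eq_or_ne k x with rfl | hkx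
      · rw [dist_self]
        exact zero_le_one
      · exact dist_le_one_of_mem_nbrs (mem_nbrs_of_mem_pottsBlock hk hkx).2
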